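/- Let $\Sigma$ be the group of bijections $w:\mathbb Z\to\mathbb Z$ with $w(x)=x$ for all but finitely many $x$, with simple transpositions $s_i=(i,i+1)$ and length $\ell$. For $u\in\Sigma$ let $u\cdot s_i=us_i$ if $\ell(us_i)>\ell(u)$ and $u\cdot s_i=u$ otherwise (Hecke product). *Grothendieck polynomials.* For permutations $w\in\Sigma$ fixing all integers $\le 0$, the polynomials $\mathfrak G_w\in\mathbb Z[x_1,x_2,\dots]$ are defined by $\mathfrak G_{w_0}=\prod_{i=1}^{n-1}x_i^{n-i}$ when $w_0$ is the longest permutation of $[1,n]$ (for any $n$), and by $$\mathfrak G_w=\frac{(1+x_{i+1})\,\mathfrak G_{ws_i}-(1+x_i)\,\mathfrak G_{ws_i}(\dots,x_{i+1},x_i,\dots)}{x_i-x_{i+1}}$$ for any $i\ge1$ with $w(i)<w(i+1)$. For $w\in\Sigma$ and $m\ge 0$ let $(1^m\times w)(i)=w(i-m)+m$, and let $G_w=\lim_{m\to\infty}\mathfrak G_{1^m\times w}\in\mathbb Z[[x_1,x_2,\dots]]$ (coefficientwise limit) be the stable Grothendieck polynomial of $w$. For a Young diagram (partition) $\lambda=(\lambda_1\ge\dots\ge\lambda_\ell>0)$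 let $G_\lambda=G_{w_\lambda}$, where $w_\lambda\in\Sigma$ is the permutation with $w_\lambda(i)=i+\lambda_{\ell+1-i}$ for $1\le i\le\ell$, $w_\lambda(0)=0$, and $w_\lambda(i)<w_\lambda(i+1)$ for $i\ne\ell$. *Tableaux.* For Young diagrams $\lambda\subset\nu$, an increasing tableau of shape $\nu/\lambda$ is a filling of the boxes of $\nu$ not in $\lambda$ by integers that increases strictly along rows (left to right) and down columns. Its Hecke permutation is $w(T)=s_{a_1}\cdot s_{a_2}\cdot\ldots\cdot s_{a_k}$ (Hecke product, computed from left to right), where $(a_1,\dots,a_k)$ is the row word of $T$, obtained by reading the rows from left to right starting with the bottom row. **Statement.** The polynomials $\mathfrak G_w$ are well defined and the limits $G_w$ exist. For every $w\in\Sigma$ and every Young diagram $\lambda$, $$G_w\cdot G_\lambda=\sum_{\nu\supset\lambda}c^\nu_{w,\lambda}\,G_\nu \quad\text{in } \mathbb Z[[x_1,x_2,\dots]],$$ where $c^\nu_{w,\lambda}$ is the (finite) number of increasing tableaux $T$ of shape $\nu/\lambda$ with $w(T)=w^{-1}$, and only finitely many $c^\nu_{w,\lambda}$ are non-zero. -/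

import Mathlib

noncomputable section

namespace StableGroth

open Filter Topology
open scoped MvPowerSeries.WithPiTopology

/-- A permutation of `ℤ` moving only finitely many integers. -/
def FinitelySupported (w : Equiv.Perm ℤ) : Prop := {x : ℤ | w x ≠ x}.Finite

/-- The simple transposition `s_i = (i, i+1)`. -/
def simpleTransposition (i : ℤ) : Equiv.Perm ℤ := Equiv.swap i (i + 1)

/-- The length of a finitely supported permutation: its number of inversions. -/
def length (w : Equiv.Perm ℤ) : ℕ := {p : ℤ × ℤ | p.1 < p.2 ∧ w p.2 < w p.1}.ncard

open Classical in
/-- The Hecke product `u · s_i` of a permutation and a simple transposition. -/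
def heckeStep (u : Equiv.Perm ℤ) (i : ℤ) : Equiv.Perm ℤ :=
  if length u < length (u * simpleTransposition i) then u * simpleTransposition i else u

/-- The Hecke product `s_{a₁} · s_{a₂} · … · s_{a_k}`, multiplied from left to right. -/
def heckeWord (a : List ℤ) : Equiv.Perm ℤ := a.foldl heckeStep 1

/-! ### Tableaux -/

/-- A filling by integers of the boxes of the skew shape `ν/μ`. -/
abbrev SkewFilling (ν μ : YoungDiagram) : Type := {c : ℕ × ℕ // c ∈ ν ∧ c ∉ μ} → ℤ

/-- A filling is increasing if `T α < T β` whenever `α < β`, where boxes `(row, column)`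
are compared componentwise. -/
def IsIncreasing {ν μ : YoungDiagram} (T : SkewFilling ν μ) : Prop := StrictMono T

open Classical in
/-- The row word: rows are read from left to right, starting with the bottom row. -/
def rowWord {ν μ : YoungDiagram} (T : SkewFilling ν μ) : List ℤ :=
  (List.range (ν.colLen 0)).reverse.flatMap fun r =>
    (List.range (ν.rowLen r)).filterMap fun c =>
      if h : (r, c) ∈ ν ∧ (r, c) ∉ μ then some (T ⟨(r, c), h⟩) else none

/-- The Hecke permutation `w(T)`. -/
def heckePerm {ν μ : YoungDiagram} (T : SkewFilling ν μ) : Equiv.Perm ℤ := heckeWord (rowWord T)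

/-- The increasing tableaux `T` of shape `ν/μ` such that `w(T) = w⁻¹`. -/
def heckeTableaux (w : Equiv.Perm ℤ) (μ ν : YoungDiagram) : Set (SkewFilling ν μ) :=
  {T | IsIncreasing T ∧ heckePerm T = w⁻¹}

/-- The coefficient `c^ν_{w,μ}`. -/
def coefficient (w : Equiv.Perm ℤ) (μ ν : YoungDiagram) : ℕ := (heckeTableaux w μ ν).ncard

/-! ### Grothendieck polynomials

The variable `x_i`, `i ≥ 1`, is `X (i - 1)`. -/

/-- The longest permutation of the interval `[1, n]`. -/
def longest (n : ℕ) : Equiv.Perm ℤ :=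
  Function.Involutive.toPerm (fun i : ℤ => if 1 ≤ i ∧ i ≤ n then n + 1 - i else i) (by
    intro i
    dsimp only
    split_ifs <;> omega)

/-- `IsGrothendieck w f` says that `f` arises as the Grothendieck polynomial of `w` from the
longest permutation of some interval `[1, n]`, with `∏ x_i ^ (n - i)`, by steps
`𝔊_w = ((1 + x_{i+1}) 𝔊_{w s_i} - (1 + x_i) s_i 𝔊_{w s_i}) / (x_i - x_{i+1})`, in each of which
`i ≥ 1` is any integer such that `w i < w (i + 1)`. In the code `i = k + 1`. -/
inductive IsGrothendieck : Equiv.Perm ℤ → MvPolynomial ℕ ℤ → Prop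
  | longest (n : ℕ) :
      IsGrothendieck (longest n) (∏ k ∈ Finset.range (n - 1), MvPolynomial.X k ^ (n - (k + 1)))
  | step (w : Equiv.Perm ℤ) (k : ℕ) (f g : MvPolynomial ℕ ℤ)
      (hasc : w (k + 1) < w (k + 1 + 1))
      (hf : IsGrothendieck (w * simpleTransposition (k + 1)) f)
      (hg : g * (MvPolynomial.X k - MvPolynomial.X (k + 1)) =
        (1 + MvPolynomial.X (k + 1)) * f -
          (1 + MvPolynomial.X k) * MvPolynomial.rename (Equiv.swap k (k + 1)) f) :
      IsGrothendieck w g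

open Classical in
/-- The Grothendieck polynomial `𝔊_w` of a finitely supported permutation `w` of the positive
integers (and `0` for other `w`). -/
def grothendieck (w : Equiv.Perm ℤ) : MvPolynomial ℕ ℤ :=
  if h : ∃ f, IsGrothendieck w f then h.choose else 0

/-- The shifted permutation `1^m × w`, that is `i ↦ w (i - m) + m`. -/
def shift (m : ℕ) (w : Equiv.Perm ℤ) : Equiv.Perm ℤ :=
  ((Equiv.subRight (m : ℤ)).trans w).trans (Equiv.addRight (m : ℤ))

theorem shift_apply (m : ℕ) (w : Equiv.Perm ℤ) (i : ℤ) : shift m w i = w (i - m) + m := rfl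

/-- The polynomials `𝔊_{1^m × w}` as elements of `ℤ⟦x₁, x₂, …⟧`. -/
def shiftedGrothendieck (w : Equiv.Perm ℤ) (m : ℕ) : MvPowerSeries ℕ ℤ :=
  (grothendieck (shift m w) : MvPowerSeries ℕ ℤ)

/-- The stable Grothendieck polynomial `G_w = lim 𝔊_{1^m × w}`, where power series carry the
topology of coefficientwise convergence. -/
def stableGrothendieck (w : Equiv.Perm ℤ) : MvPowerSeries ℕ ℤ :=
  limUnder atTop (shiftedGrothendieck w)

/-! ### Grassmannian permutations -/

/-- The map underlying the Grassmannian permutation of `μ`, where `μ` has `ℓ = μ.colLen 0`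
rows. Rows and columns of a `YoungDiagram` are numbered from `0`. -/
def grassmannianFun (μ : YoungDiagram) (i : ℤ) : ℤ :=
  if i ≤ 0 then i
  else if i ≤ μ.colLen 0 then i + μ.rowLen (μ.colLen 0 - i).toNat
  else i - μ.colLen (i - μ.colLen 0 - 1).toNat

theorem grassmannianFun_injective (μ : YoungDiagram) :
    Function.Injective (grassmannianFun μ) := by
  have hr : ∀ r r' : ℕ, r ≤ r' → μ.rowLen r' ≤ μ.rowLen r := fun r r' h => μ.rowLen_anti r r' h
  have hc : ∀ r r' : ℕ, r ≤ r' → μ.colLen r' ≤ μ.colLen r := fun r r' h => μ.colLen_anti r r' h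
  have hd : ∀ r c : ℕ, c < μ.rowLen r ↔ r < μ.colLen c := fun r c => by
    rw [← YoungDiagram.mem_iff_lt_rowLen, ← YoungDiagram.mem_iff_lt_colLen]
  intro i j hij
  unfold grassmannianFun at hij
  have h1 := hr (μ.colLen 0 - i).toNat (μ.colLen 0 - j).toNat
  have h2 := hr (μ.colLen 0 - j).toNat (μ.colLen 0 - i).toNat
  have h3 := hc (i - μ.colLen 0 - 1).toNat (j - μ.colLen 0 - 1).toNat
  have h4 := hc (j - μ.colLen 0 - 1).toNat (i - μ.colLen 0 - 1).toNat
  have h5 := hd (μ.colLen 0 - i).toNat (j - μ.colLen 0 - 1).toNat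
  have h6 := hd (μ.colLen 0 - j).toNat (i - μ.colLen 0 - 1).toNat
  have h7 := hc 0 (i - μ.colLen 0 - 1).toNat (Nat.zero_le _)
  have h8 := hc 0 (j - μ.colLen 0 - 1).toNat (Nat.zero_le _)
  split_ifs at hij <;> omega

theorem grassmannianFun_bijective (μ : YoungDiagram) :
    Function.Bijective (grassmannianFun μ) := by
  refine ⟨grassmannianFun_injective μ, fun y => ?_⟩
  have hr : ∀ r : ℕ, μ.rowLen r ≤ μ.rowLen 0 := fun r => μ.rowLen_anti 0 r (Nat.zero_le _)
  have hc : ∀ r : ℕ, μ.colLen r ≤ μ.colLen 0 := fun r => μ.colLen_anti 0 r (Nat.zero_le _)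
  have hd : ∀ r c : ℕ, c < μ.rowLen r ↔ r < μ.colLen c := fun r c => by
    rw [← YoungDiagram.mem_iff_lt_rowLen, ← YoungDiagram.mem_iff_lt_colLen]
  by_cases hy : 1 ≤ y ∧ y ≤ μ.colLen 0 + μ.rowLen 0
  · have hmaps : Set.MapsTo (grassmannianFun μ)
        (Finset.Icc (1 : ℤ) (μ.colLen 0 + μ.rowLen 0)) (Finset.Icc (1 : ℤ) (μ.colLen 0 + μ.rowLen 0)) := by
      intro i hi
      simp only [Finset.coe_Icc, Set.mem_Icc] at hi ⊢
      unfold grassmannianFun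
      have h1 := hr (μ.colLen 0 - i).toNat
      have h2 := hc (i - μ.colLen 0 - 1).toNat
      split_ifs <;> omega
    obtain ⟨x, -, hx⟩ := Finset.surjOn_of_injOn_of_card_le (grassmannianFun μ) hmaps
      (grassmannianFun_injective μ).injOn le_rfl
      (show y ∈ ((Finset.Icc (1 : ℤ) (μ.colLen 0 + μ.rowLen 0) : Finset ℤ) : Set ℤ) by
        simpa using hy)
    exact ⟨x, hx⟩
  · refine ⟨y, ?_⟩
    unfold grassmannianFun
    have h1 := hd 0 (y - μ.colLen 0 - 1).toNat
    split_ifs <;> omega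

/-- The Grassmannian permutation `w_μ`. -/
def grassmannianPerm (μ : YoungDiagram) : Equiv.Perm ℤ :=
  Equiv.ofBijective (grassmannianFun μ) (grassmannianFun_bijective μ)

/-- `w_μ` has finite support, `w_μ(0) = 0`, `w_μ(i) = i + μ_{ℓ+1-i}` for `1 ≤ i ≤ ℓ`, and
`w_μ(i) < w_μ(i+1)` for `i ≠ ℓ`; these properties determine `w_μ`. -/
theorem grassmannianPerm_spec (μ : YoungDiagram) :
    FinitelySupported (grassmannianPerm μ) ∧ grassmannianPerm μ 0 = 0 ∧
    (∀ i : ℕ, 1 ≤ i → i ≤ μ.colLen 0 →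
      grassmannianPerm μ i = i + μ.rowLen (μ.colLen 0 - i)) ∧
    ∀ i : ℤ, i ≠ μ.colLen 0 → grassmannianPerm μ i < grassmannianPerm μ (i + 1) := by
  have hd : ∀ r c : ℕ, c < μ.rowLen r ↔ r < μ.colLen c := fun r c => by
    rw [← YoungDiagram.mem_iff_lt_rowLen, ← YoungDiagram.mem_iff_lt_colLen]
  refine ⟨?_, ?_, ?_, ?_⟩
  · refine (Finset.finite_toSet (Finset.Icc (1 : ℤ) (μ.colLen 0 + μ.rowLen 0))).subset ?_
    intro y hy
    by_contra hy'
    apply hy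
    change grassmannianFun μ y = y
    simp only [Finset.coe_Icc, Set.mem_Icc] at hy'
    unfold grassmannianFun
    have h1 := hd 0 (y - μ.colLen 0 - 1).toNat
    split_ifs <;> omega
  · change grassmannianFun μ 0 = 0
    simp [grassmannianFun]
  · intro i h1 h2
    change grassmannianFun μ i = _
    have h3 : ((μ.colLen 0 : ℤ) - i).toNat = μ.colLen 0 - i := by omega
    unfold grassmannianFun
    rw [h3]
    split_ifs <;> omega
  · intro i hi
    change grassmannianFun μ i < grassmannianFun μ (i + 1)
    unfold grassmannianFun
    have h1 := μ.rowLen_anti (μ.colLen 0 - (i + 1)).toNat (μ.colLen 0 - i).toNat (by omega)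
    have h2 := μ.colLen_anti (i - μ.colLen 0 - 1).toNat (i + 1 - μ.colLen 0 - 1).toNat (by omega)
    have h3 := hd (μ.colLen 0 - 1) 0
    split_ifs <;> omega

/-- The stable Grothendieck polynomial `G_μ = G_{w_μ}` of a Young diagram. -/
def stableGrothendieckOfDiagram (μ : YoungDiagram) : MvPowerSeries ℕ ℤ :=
  stableGrothendieck (grassmannianPerm μ)

end StableGroth

end

/-!
Everything is expressed through the 0-Hecke algebra of `Σ`, whose generators act on linear
combinations of permutations by `v ↦ v · s_j`. For a finite set `S` of letters and a variable `x`,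
let the block `A(x, S)` be the product of the factors `1 + x s_j`, `j ∈ S`, in order of decreasing
`j`. Expanding a product of blocks, one for each row, gives a sum over tuples of strictly
increasing rows, and its coefficient at a permutation `v` selects the tuples whose row word has
Hecke product `v`. The basic fact is that `A(x, [a, b])` and `A(y, [a, b])` commute
(`commute_block_Icc`).

*Grothendieck polynomials.* By the formula of Fomin and Kirillov, `𝔊_w` is the coefficient of
`w⁻¹` in `A(x₁, [1, N]) A(x₂, [2, N]) ⋯` for all large `N`. The divided difference recursion
(`blockCoeff_flag_recursion`) holds because multiplication by `1 + x_{i+1} s_i` *on the left* of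
permutations, which commutes with all the blocks, extends the alphabet of row `i + 1` to that of
row `i`, after which the two blocks commute. For the longest permutation only one tuple of rows
contributes (`blockCoeff_reversal`). This proves uniqueness; existence follows since the
numerators of the recursion are divisible by `x_i - x_{i+1}`. As letters outside the support of a
permutation cannot contribute, `1^m × w` yields for large `m` the coefficient of `w⁻¹` in
`A(x₁, [a, b]) A(x₂, [a, b]) ⋯`, up to any given monomial (`coeff_stableGrothendieck`).

*Products.* Work in `n` variables and let `alt(μ)` be the alternant
`∑ sgn(σ) ∏ x_{σ k} ^ (μ_k + n - 1 - k) (1 + x_{σ k}) ^ k`. The product of the blocks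
`A(x_k, [a, b])` is symmetric, so its product with `alt(μ)` is the sum of `alt(μ + |T|)` times the
word of `T` over all tuples `T` of rows. If `T`, placed to the right of `μ`, is not column strict,
consider the first violation, in rows `i` and `i + 1` at the letter `j`. For fixed entries up to
there, the sum over the remaining tails of these two rows is symmetric in the two variables, again
since blocks commute, hence cancels in the alternating sum (`sum_firstViolation_eq_zero`). What
remains is the sum over increasing tableaux (`alternant_smul_prod_block`), so that
`alt(μ) G_w = ∑ c^ν_{w,μ} alt(ν)`.

For `w = w_λ` and `μ = ∅`, the sum has one term: following the positions of the large values of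
the permutation while the rows act, each letter is forced, and there is exactly one
increasing tableau of straight shape with Hecke permutation `w_λ⁻¹`, whose shape is `λ`. Hence
`alt(∅) G_λ = alt(λ)` (`alternant_mul_blockCoeff_grassmannianPerm`). Multiplying
`G_w G_μ` by `alt(∅)`, which is not zero, therefore gives `∑ c^ν_{w,μ} alt(∅) G_ν`, and `alt(∅)`
can be cancelled.
-/

noncomputable section

namespace StableGroth

open Filter Topology
open scoped MvPowerSeries.WithPiTopology

/-! ### Hecke steps -/

theorem simpleTransposition_left (i : ℤ) : simpleTransposition i i = i + 1 :=
  Equiv.swap_apply_left _ _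

theorem simpleTransposition_right (i : ℤ) : simpleTransposition i (i + 1) = i :=
  Equiv.swap_apply_right _ _

theorem simpleTransposition_of_ne {i x : ℤ} (h1 : x ≠ i) (h2 : x ≠ i + 1) :
    simpleTransposition i x = x :=
  Equiv.swap_apply_of_ne_of_ne h1 h2

theorem simpleTransposition_apply (i x : ℤ) :
    simpleTransposition i x = if x = i then i + 1 else if x = i + 1 then i else x :=
  Equiv.swap_apply_def _ _ _

@[simp] theorem simpleTransposition_mul_self (i : ℤ) :
    simpleTransposition i * simpleTransposition i = 1 := Equiv.swap_mul_self _ _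

@[simp] theorem simpleTransposition_inv (i : ℤ) :
    (simpleTransposition i)⁻¹ = simpleTransposition i := Equiv.swap_inv _ _

@[simp] theorem simpleTransposition_self_apply (i x : ℤ) :
    simpleTransposition i (simpleTransposition i x) = x := by
  rw [← Equiv.Perm.mul_apply, simpleTransposition_mul_self, Equiv.Perm.one_apply]

theorem perm_inv_apply_eq_iff {v : Equiv.Perm ℤ} {x y : ℤ} : v⁻¹ x = y ↔ v y = x := by
  rw [Equiv.Perm.inv_eq_iff_eq, eq_comm]

/-- The Hecke product `w · s_i`, with the length comparison replaced by the comparison of the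
values of `w` at `i` and `i + 1`. Unlike `heckeStep` it behaves well on all permutations
of `ℤ`. -/
def hstep (w : Equiv.Perm ℤ) (i : ℤ) : Equiv.Perm ℤ :=
  if w i < w (i + 1) then w * simpleTransposition i else w

/-- The Hecke product `s_i · v`. -/
def lstep (i : ℤ) (v : Equiv.Perm ℤ) : Equiv.Perm ℤ :=
  if v⁻¹ i < v⁻¹ (i + 1) then simpleTransposition i * v else v

theorem apply_ne_apply_succ (w : Equiv.Perm ℤ) (i : ℤ) : w i ≠ w (i + 1) := fun h => by
  have := w.injective h
  omega

theorem hstep_hstep_self (w : Equiv.Perm ℤ) (i : ℤ) : hstep (hstep w i) i = hstep w i := by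
  unfold hstep
  split_ifs with h1 h2
  · simp only [Equiv.Perm.mul_apply, simpleTransposition_left, simpleTransposition_right] at h2
    omega
  · rfl
  · rfl

theorem hstep_comm (w : Equiv.Perm ℤ) {i j : ℤ} (h : i + 2 ≤ j) :
    hstep (hstep w i) j = hstep (hstep w j) i := by
  have a1 := simpleTransposition_of_ne (i := i) (x := j) (by omega) (by omega)
  have a2 := simpleTransposition_of_ne (i := i) (x := j + 1) (by omega) (by omega)
  have a3 := simpleTransposition_of_ne (i := j) (x := i) (by omega) (by omega)
  have a4 := simpleTransposition_of_ne (i := j) (x := i + 1) (by omega) (by omega)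
  have hc : simpleTransposition i * simpleTransposition j =
      simpleTransposition j * simpleTransposition i := by
    ext x
    simp only [Equiv.Perm.mul_apply, simpleTransposition_apply]
    split_ifs <;> omega
  unfold hstep
  by_cases h1 : w i < w (i + 1) <;> by_cases h2 : w j < w (j + 1) <;>
    simp [h1, h2, a1, a2, a3, a4, mul_assoc, hc]

theorem hstep_braid (w : Equiv.Perm ℤ) (i : ℤ) :
    hstep (hstep (hstep w i) (i + 1)) i = hstep (hstep (hstep w (i + 1)) i) (i + 1) := by
  have e1 : simpleTransposition (i + 1) i = i :=
    simpleTransposition_of_ne (by omega) (by omega)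
  have e2 : simpleTransposition i (i + 1 + 1) = i + 1 + 1 :=
    simpleTransposition_of_ne (by omega) (by omega)
  have hb : simpleTransposition i * (simpleTransposition (i + 1) * simpleTransposition i) =
      simpleTransposition (i + 1) * (simpleTransposition i * simpleTransposition (i + 1)) := by
    ext x
    simp only [Equiv.Perm.mul_apply, simpleTransposition_apply]
    split_ifs <;> omega
  have n1 := apply_ne_apply_succ w i
  have n2 := apply_ne_apply_succ w (i + 1)
  have n3 : w i ≠ w (i + 1 + 1) := fun h => by
    have := w.injective h
    omega
  unfold hstep
  rcases lt_or_gt_of_ne n1 with h1 | h1 <;> rcases lt_or_gt_of_ne n2 with h2 | h2 <;>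
    rcases lt_or_gt_of_ne n3 with h3 | h3 <;>
    first
    | (exfalso; omega)
    | simp [h1, h2, h3, h1.not_gt, h2.not_gt, h3.not_gt, e1, e2, simpleTransposition_left,
        simpleTransposition_right, mul_assoc, hb]

theorem lstep_hstep_comm (v : Equiv.Perm ℤ) (i j : ℤ) :
    lstep i (hstep v j) = hstep (lstep i v) j := by
  have key : v * simpleTransposition j = Equiv.swap (v j) (v (j + 1)) * v := by
    unfold simpleTransposition
    rw [Equiv.mul_swap_eq_swap_mul]
  have hne := apply_ne_apply_succ v j
  by_cases h1 : v j = i ∧ v (j + 1) = i + 1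
  · obtain ⟨h1, h2⟩ := h1
    have p1 : v⁻¹ i = j := perm_inv_apply_eq_iff.2 h1
    have p2 : v⁻¹ (i + 1) = j + 1 := perm_inv_apply_eq_iff.2 h2
    have k2 : v * simpleTransposition j = simpleTransposition i * v := by
      rw [key, h1, h2]; rfl
    simp only [hstep, lstep, h1, h2, p1, p2, ← k2, lt_add_one, if_true, mul_inv_rev,
      simpleTransposition_inv, Equiv.Perm.mul_apply, simpleTransposition_left,
      simpleTransposition_right, (lt_add_one _).not_gt, if_false]
  by_cases h2 : v j = i + 1 ∧ v (j + 1) = i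
  · obtain ⟨h1, h2⟩ := h2
    have p1 : v⁻¹ (i + 1) = j := perm_inv_apply_eq_iff.2 h1
    have p2 : v⁻¹ i = j + 1 := perm_inv_apply_eq_iff.2 h2
    simp only [hstep, lstep, h1, h2, p1, p2, (lt_add_one _).not_gt, if_false]
  have c1 : simpleTransposition i (v j) < simpleTransposition i (v (j + 1)) ↔
      v j < v (j + 1) := by
    simp only [simpleTransposition_apply]
    split_ifs <;> omega
  have q1 : v (v⁻¹ i) = i := by simp
  have q2 : v (v⁻¹ (i + 1)) = i + 1 := by simp
  have c2 : simpleTransposition j (v⁻¹ i) < simpleTransposition j (v⁻¹ (i + 1)) ↔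
      v⁻¹ i < v⁻¹ (i + 1) := by
    have d1 : ¬ (v⁻¹ i = j ∧ v⁻¹ (i + 1) = j + 1) := fun ⟨x, y⟩ => h1 ⟨by rw [← x, q1], by rw [← y, q2]⟩
    have d2 : ¬ (v⁻¹ i = j + 1 ∧ v⁻¹ (i + 1) = j) := fun ⟨x, y⟩ => h2 ⟨by rw [← y, q2], by rw [← x, q1]⟩
    have := v⁻¹.injective.ne (show i ≠ i + 1 by omega)
    simp only [simpleTransposition_apply]
    split_ifs <;> omega
  unfold hstep lstep
  by_cases h3 : v j < v (j + 1) <;> by_cases h4 : v⁻¹ i < v⁻¹ (i + 1) <;>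
    simp only [h3, h4, c1, c2, mul_assoc, mul_inv_rev, simpleTransposition_inv,
      Equiv.Perm.mul_apply, if_true, if_false]

theorem lstep_one (i : ℤ) : lstep i 1 = hstep 1 i := by
  simp [lstep, hstep]

/-! ### Lengths -/

theorem FinitelySupported.exists_bounds {w : Equiv.Perm ℤ} (hw : FinitelySupported w) :
    ∃ p q : ℤ, p ≤ q ∧ ∀ x, x < p ∨ q < x → w x = x := by
  obtain ⟨q, hq⟩ := hw.bddAbove
  obtain ⟨p, hp⟩ := hw.bddBelow
  refine ⟨p, max p q, le_max_left _ _, fun x hx => ?_⟩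
  by_contra h
  have h1 := hq h
  have h2 := hp h
  rcases hx with hx | hx
  · omega
  · have := lt_of_le_of_lt (le_max_right p q) hx
    omega

theorem finitelySupported_of_bounds {w : Equiv.Perm ℤ} {p q : ℤ}
    (h : ∀ x, x < p ∨ q < x → w x = x) : FinitelySupported w := by
  refine (Set.finite_Icc p q).subset fun x hx => ?_
  by_contra h'
  apply hx
  apply h
  simp only [Set.mem_Icc] at h'
  omega

theorem FinitelySupported.mul {u w : Equiv.Perm ℤ} (hu : FinitelySupported u)
    (hw : FinitelySupported w) : FinitelySupported (u * w) := by
  refine (Set.Finite.union hu hw).subset fun x hx => ?_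
  by_contra h
  simp only [Set.mem_union, Set.mem_ofPred_eq, not_or, not_not] at h
  apply hx
  simp [h.1, h.2]

theorem finitelySupported_one : FinitelySupported 1 := by simp [FinitelySupported]

theorem finitelySupported_simpleTransposition (i : ℤ) :
    FinitelySupported (simpleTransposition i) :=
  finitelySupported_of_bounds (p := i) (q := i + 1) fun _ _ =>
    simpleTransposition_of_ne (by omega) (by omega)

/-- The set of inversions. -/
def inversions (w : Equiv.Perm ℤ) : Set (ℤ × ℤ) := {p : ℤ × ℤ | p.1 < p.2 ∧ w p.2 < w p.1}

theorem inversions_subset {w : Equiv.Perm ℤ} {p q : ℤ} (h : ∀ x, x < p ∨ q < x → w x = x) :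
    inversions w ⊆ (Set.Icc p q ×ˢ Set.Icc p q) := by
  have hlo : ∀ x, w x < p → x < p := fun x hx => by
    have := w.injective (h (w x) (Or.inl hx))
    omega
  have hhi : ∀ x, q < w x → q < x := fun x hx => by
    have := w.injective (h (w x) (Or.inr hx))
    omega
  rintro ⟨a, b⟩ ⟨h1, h2⟩
  dsimp only at h1 h2
  have ha := h a
  have hb := h b
  have := hlo b
  have := hhi a
  simp only [Set.mem_prod, Set.mem_Icc]
  by_contra hcon
  have : a < p ∨ q < b := by omega
  rcases this with h3 | h3
  · have := ha (Or.inl h3)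
    omega
  · have := hb (Or.inr h3)
    omega

theorem FinitelySupported.finite_inversions {w : Equiv.Perm ℤ} (hw : FinitelySupported w) :
    (inversions w).Finite := by
  obtain ⟨p, q, -, h⟩ := hw.exists_bounds
  exact ((Set.finite_Icc p q).prod (Set.finite_Icc p q)).subset (inversions_subset h)

theorem length_mul_simpleTransposition {w : Equiv.Perm ℤ} (hw : FinitelySupported w) {i : ℤ}
    (h : w i < w (i + 1)) : length (w * simpleTransposition i) = length w + 1 := by
  have hI : inversions (w * simpleTransposition i) = insert (i, i + 1)
      (Prod.map (simpleTransposition i) (simpleTransposition i) '' inversions w) := by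
    ext ⟨a, b⟩
    simp only [inversions, Set.mem_ofPred_eq, Equiv.Perm.mul_apply, Set.mem_insert_iff,
      Set.mem_image, Prod.exists, Prod.map_apply, Prod.mk.injEq]
    constructor
    · rintro ⟨h1, h2⟩
      by_cases h3 : a = i ∧ b = i + 1
      · exact Or.inl h3
      · refine Or.inr ⟨simpleTransposition i a, simpleTransposition i b, ⟨?_, h2⟩, by simp, by simp⟩
        simp only [simpleTransposition_apply]
        split_ifs <;> omega
    · rintro (⟨rfl, rfl⟩ | ⟨c, d, ⟨h1, h2⟩, rfl, rfl⟩)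
      · simp [simpleTransposition_left, simpleTransposition_right, h]
      · refine ⟨?_, by simpa using h2⟩
        have : ¬ (c = i ∧ d = i + 1) := by
          rintro ⟨rfl, rfl⟩
          omega
        simp only [simpleTransposition_apply]
        split_ifs <;> omega
  change (inversions _).ncard = (inversions _).ncard + 1
  rw [hI, Set.ncard_insert_of_notMem _ (hw.finite_inversions.image _),
    Set.ncard_image_of_injective]
  · exact (simpleTransposition i).injective.prodMap (simpleTransposition i).injective
  · rintro ⟨⟨c, d⟩, ⟨h1, -⟩, h2⟩
    simp only [Prod.map_apply, Prod.mk.injEq] at h1 h2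
    have h3 := h2.1
    have h4 := h2.2
    simp only [simpleTransposition_apply] at h3 h4
    split_ifs at h3 h4 <;> omega

theorem heckeStep_eq_hstep {w : Equiv.Perm ℤ} (hw : FinitelySupported w) (i : ℤ) :
    heckeStep w i = hstep w i := by
  unfold heckeStep hstep
  by_cases h : w i < w (i + 1)
  · rw [if_pos h, if_pos (by rw [length_mul_simpleTransposition hw h]; omega)]
  · rw [if_neg h, if_neg]
    have hne := apply_ne_apply_succ w i
    have := length_mul_simpleTransposition (i := i)
      (hw.mul (finitelySupported_simpleTransposition i))
      (by simp [simpleTransposition_left, simpleTransposition_right]; omega)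
    rw [mul_assoc, simpleTransposition_mul_self, mul_one] at this
    omega

theorem FinitelySupported.hstep {w : Equiv.Perm ℤ} (hw : FinitelySupported w) (i : ℤ) :
    FinitelySupported (hstep w i) := by
  unfold StableGroth.hstep
  split_ifs
  · exact hw.mul (finitelySupported_simpleTransposition i)
  · exact hw

theorem foldl_heckeStep {w : Equiv.Perm ℤ} (hw : FinitelySupported w) (a : List ℤ) :
    a.foldl heckeStep w = a.foldl hstep w := by
  induction a generalizing w with
  | nil => rfl
  | cons i a ih => rw [List.foldl_cons, List.foldl_cons, heckeStep_eq_hstep hw, ih (hw.hstep i)]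

theorem heckeWord_eq (a : List ℤ) : heckeWord a = a.foldl hstep 1 :=
  foldl_heckeStep finitelySupported_one a

/-! ### The letters of a Hecke word -/

/-- The permutation `v` preserves the half line of the integers up to `c`. -/
def PreservesCut (c : ℤ) (v : Equiv.Perm ℤ) : Prop := ∀ x, v x ≤ c ↔ x ≤ c

theorem not_preservesCut_hstep {c : ℤ} {v : Equiv.Perm ℤ} (h : ¬ PreservesCut c v) (i : ℤ) :
    ¬ PreservesCut c (hstep v i) := by
  unfold hstep
  split_ifs with hv
  swap
  · exact h
  intro hp
  apply h
  have key := hp (simpleTransposition i c)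
  intro x
  have hx := hp (simpleTransposition i x)
  simp only [Equiv.Perm.mul_apply, simpleTransposition_self_apply] at hx key
  have h1 := hp i
  have h2 := hp (i + 1)
  simp only [Equiv.Perm.mul_apply, simpleTransposition_left, simpleTransposition_right] at h1 h2
  rw [hx]
  simp only [simpleTransposition_apply]
  split_ifs with h3 h4 <;> omega

theorem not_preservesCut_hstep_self (c : ℤ) (v : Equiv.Perm ℤ) :
    ¬ PreservesCut c (hstep v c) := by
  by_cases h : PreservesCut c v
  · have h1 := h c
    have h2 := h (c + 1)
    intro hp
    have h3 := hp c
    unfold hstep at h3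
    split_ifs at h3 with hv
    · simp only [Equiv.Perm.mul_apply, simpleTransposition_left] at h3
      omega
    · omega
  · exact not_preservesCut_hstep h c

theorem preservesCut_hstep {c i : ℤ} {v : Equiv.Perm ℤ} (h : PreservesCut c v) (hi : i ≠ c) :
    PreservesCut c (hstep v i) := by
  unfold hstep
  split_ifs
  · intro x
    rw [Equiv.Perm.mul_apply, h, simpleTransposition_apply]
    split_ifs <;> omega
  · exact h

theorem not_preservesCut_foldl {c : ℤ} {v : Equiv.Perm ℤ} (h : ¬ PreservesCut c v)
    (a : List ℤ) : ¬ PreservesCut c (a.foldl hstep v) := by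
  induction a generalizing v with
  | nil => exact h
  | cons i a ih => exact ih (not_preservesCut_hstep h i)

theorem not_preservesCut_of_mem {c : ℤ} {a : List ℤ} (hc : c ∈ a) (v : Equiv.Perm ℤ) :
    ¬ PreservesCut c (a.foldl hstep v) := by
  induction a generalizing v with
  | nil => simp at hc
  | cons i a ih =>
    rcases List.mem_cons.1 hc with rfl | h
    · exact not_preservesCut_foldl (not_preservesCut_hstep_self c v) a
    · exact ih h _

theorem preservesCut_of_bounds {w : Equiv.Perm ℤ} {p q : ℤ} (h : ∀ x, x < p ∨ q < x → w x = x)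
    {c : ℤ} (hc : c < p ∨ q ≤ c) : PreservesCut c w := by
  have hlo : ∀ x, w x < p → w x = x := fun x hx => w.injective (h (w x) (Or.inl hx))
  have hhi : ∀ x, q < w x → w x = x := fun x hx => w.injective (h (w x) (Or.inr hx))
  intro x
  have h1 := hlo x
  have h2 := hhi x
  have h3 := h x
  by_cases h4 : x < p
  · have := h3 (Or.inl h4); omega
  by_cases h5 : q < x
  · have := h3 (Or.inr h5); omega
  by_cases h6 : w x < p
  · have := h1 h6; omega
  by_cases h7 : q < w x
  · have := h2 h7; omega
  omega

/-! ### Commuting elements of the 0-Hecke algebra -/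

section Abstract

variable {R E : Type*} [CommRing R] [Ring E] [Algebra R E]

/-- The product of the elements `f j`, `j ∈ S`, in order of decreasing `j`. -/
def decProd {M : Type*} [Monoid M] (f : ℤ → M) (S : Finset ℤ) : M :=
  ((S.sort (· ≤ ·)).map f).reverse.prod

theorem sort_insert_max {S : Finset ℤ} {m : ℤ} (h : ∀ x ∈ S, x < m) :
    (insert m S).sort (· ≤ ·) = S.sort (· ≤ ·) ++ [m] := by
  have hm : m ∉ S := fun hm => lt_irrefl _ (h m hm)
  refine List.Perm.eq_of_pairwise (le := (· ≤ ·)) ?_ (Finset.pairwise_sort _ _) ?_ ?_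
  · intro a b _ _ h1 h2
    exact le_antisymm h1 h2
  · rw [List.pairwise_append]
    refine ⟨Finset.pairwise_sort _ _, List.pairwise_singleton _ _, fun a ha b hb => ?_⟩
    rw [List.mem_singleton] at hb
    rw [Finset.mem_sort] at ha
    exact hb ▸ (h a ha).le
  · rw [List.perm_ext_iff_of_nodup (Finset.sort_nodup _ _)]
    · intro a
      simp [or_comm]
    · rw [List.nodup_append]
      refine ⟨Finset.sort_nodup _ _, List.nodup_singleton _, fun a ha b hb => ?_⟩
      rw [List.mem_singleton] at hb
      rw [Finset.mem_sort] at ha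
      exact hb ▸ (h a ha).ne

section Monoid

variable {M : Type*} [Monoid M] (f : ℤ → M)

@[simp] theorem decProd_empty : decProd f ∅ = 1 := by simp [decProd]

theorem decProd_insert_max {S : Finset ℤ} {m : ℤ} (h : ∀ x ∈ S, x < m) :
    decProd f (insert m S) = f m * decProd f S := by
  unfold decProd
  rw [sort_insert_max h]
  simp

@[simp] theorem decProd_singleton (m : ℤ) : decProd f {m} = f m := by simp [decProd]

theorem decProd_union {S T : Finset ℤ} (h : ∀ x ∈ S, ∀ y ∈ T, y < x) :
    decProd f (S ∪ T) = decProd f S * decProd f T := by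
  induction S using Finset.induction_on_max with
  | empty => simp
  | insert m S hm ih =>
    rw [Finset.insert_union, decProd_insert_max, ih, decProd_insert_max f hm, mul_assoc]
    · exact fun x hx => h x (Finset.mem_insert_of_mem hx)
    · intro x hx
      rcases Finset.mem_union.1 hx with hx | hx
      · exact hm x hx
      · exact h m (Finset.mem_insert_self _ _) x hx

theorem commute_decProd {z : M} {S : Finset ℤ} (h : ∀ j ∈ S, Commute z (f j)) :
    Commute z (decProd f S) := by
  induction S using Finset.induction_on_max with
  | empty => simp
  | insert m S hm ih =>
    rw [decProd_insert_max f hm]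
    exact (h m (Finset.mem_insert_self _ _)).mul_right
      (ih fun j hj => h j (Finset.mem_insert_of_mem hj))

end Monoid

/-- The relations of the generators of the 0-Hecke algebra of the group `Σ`. -/
structure HeckeRelations (u : ℤ → E) : Prop where
  idem : ∀ i, u i * u i = u i
  comm : ∀ i j, i + 2 ≤ j → Commute (u i) (u j)
  braid : ∀ i, u i * (u (i + 1) * u i) = u (i + 1) * (u i * u (i + 1))

/-- The product of the factors `1 + x u_j`, `j ∈ S`, in order of decreasing `j`. -/
def block (u : ℤ → E) (x : R) (S : Finset ℤ) : E := decProd (fun j => 1 + x • u j) S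

theorem block_eq_sum (u : ℤ → E) (x : R) (S : Finset ℤ) :
    block u x S = ∑ T ∈ S.powerset, x ^ T.card • decProd u T := by
  unfold block
  induction S using Finset.induction_on_max with
  | empty => simp
  | insert m S hm ih =>
    have hm' : m ∉ S := fun h => lt_irrefl _ (hm m h)
    rw [decProd_insert_max _ hm, Finset.sum_powerset_insert hm', ih, add_mul, one_mul,
      Finset.mul_sum]
    congr 1
    refine Finset.sum_congr rfl fun T hT => ?_
    rw [Finset.mem_powerset] at hT
    rw [decProd_insert_max u fun x hx => hm x (hT hx),
      Finset.card_insert_of_notMem fun h => hm' (hT h), smul_mul_smul_comm, pow_succ']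

@[simp] theorem block_zero (u : ℤ → E) (S : Finset ℤ) : block u (0 : R) S = 1 := by
  simp [block, decProd]

@[simp] theorem block_empty (u : ℤ → E) (x : R) : block u x ∅ = 1 := by simp [block]

/-- The exchange identity for two neighbouring generators `p` and `q`. -/
theorem exchange {p q a b : E} {x y : R} (hp : p * p = p) (hq : q * q = q)
    (hpq : p * (q * p) = q * (p * q)) (h : (1 + x • q) * a = (1 + y • q) * b) :
    (1 + x • p) * ((1 + x • q) * ((1 + y • p) * a)) =
      (1 + y • p) * ((1 + y • q) * ((1 + x • p) * b)) := by
  have hp' : ∀ c, p * (p * c) = p * c := fun c => by rw [← mul_assoc, hp]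
  have hq' : ∀ c, q * (q * c) = q * c := fun c => by rw [← mul_assoc, hq]
  have hpq' : ∀ c, p * (q * (p * c)) = q * (p * (q * c)) := fun c => by
    have := congrArg (· * c) hpq
    simpa only [mul_assoc] using this
  have h1 := congrArg (q * ·) h
  have h2 := congrArg (p * ·) h
  have h3 := congrArg (p * ·) h1
  have h4 := congrArg (q * ·) h2
  simp only [add_mul, mul_add, one_mul, smul_mul_assoc, mul_smul_comm, smul_add, hp', hq',
    hpq'] at h h1 h2 h3 h4 ⊢
  linear_combination (norm := module) h + (x * y) • h4 + (x + y + x * y) • h2 - (x * y) • h3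

theorem Ico_succ_eq_insert (a : ℤ) (n : ℕ) :
    Finset.Ico a (a + (n + 1 : ℕ)) = insert (a + n) (Finset.Ico a (a + n)) := by
  ext x
  simp only [Finset.mem_Ico, Finset.mem_insert]
  omega

theorem block_Ico_succ (u : ℤ → E) (x : R) (a : ℤ) (n : ℕ) :
    block u x (Finset.Ico a (a + (n + 1 : ℕ))) =
      (1 + x • u (a + n)) * block u x (Finset.Ico a (a + n)) := by
  unfold block
  rw [Ico_succ_eq_insert, decProd_insert_max]
  intro x hx
  exact (Finset.mem_Ico.1 hx).2

theorem commute_factor_block {u : ℤ → E} (hu : HeckeRelations u) (x y : R) {i : ℤ}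
    {S : Finset ℤ} (h : ∀ j ∈ S, j + 2 ≤ i ∨ i + 2 ≤ j) :
    Commute (1 + x • u i) (block u y S) := by
  refine commute_decProd _ fun j hj => ?_
  have : Commute (u i) (u j) := by
    rcases h j hj with h | h
    · exact (hu.comm _ _ h).symm
    · exact hu.comm _ _ h
  refine (Commute.one_left _).add_left ((Commute.one_right _).add_right ?_)
  exact (this.smul_left x).smul_right y

/-- The elements `∏ (1 + x u_j)` over an interval, for varying `x`, commute. -/
theorem commute_block_Ico {u : ℤ → E} (hu : HeckeRelations u) (x y : R) (a : ℤ) (n : ℕ) :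
    Commute (block u x (Finset.Ico a (a + n))) (block u y (Finset.Ico a (a + n))) := by
  induction n using Nat.strong_induction_on with
  | _ n ih =>
  match n with
  | 0 => simp [block]
  | 1 =>
    rw [block_Ico_succ, block_Ico_succ]
    simp only [Nat.cast_zero, add_zero, Finset.Ico_self, block, decProd_empty, mul_one]
    refine (Commute.one_left _).add_left ((Commute.one_right _).add_right ?_)
    exact ((Commute.refl (u a)).smul_left x).smul_right y
  | n + 2 =>
    have h1 : ∀ z w : R, Commute (1 + z • u (a + (n + 1 : ℕ)))
        (block u w (Finset.Ico a (a + n))) := fun z w =>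
      commute_factor_block hu z w fun j hj => by
        rw [Finset.mem_Ico] at hj
        push_cast
        omega
    -- the hypothesis of `exchange` is that the blocks of the interval without its largest letter
    -- commute; the largest letter commutes with all letters except the one before it
    have h2 := (ih (n + 1) (by omega)).eq
    rw [block_Ico_succ, block_Ico_succ, mul_assoc, mul_assoc] at h2
    have hb := hu.braid (a + n)
    have key := exchange (p := u (a + (n + 1 : ℕ))) (q := u (a + n)) (hu.idem _) (hu.idem _)
      (by push_cast; rw [← add_assoc, hb]) h2
    change _ * _ = _ * _
    rw [block_Ico_succ u x a (n + 1), block_Ico_succ u y a (n + 1), block_Ico_succ u x a n,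
      block_Ico_succ u y a n]
    simp only [mul_assoc]
    rw [← mul_assoc (block u x (Finset.Ico a (a + n))) (1 + y • u (a + (n + 1 : ℕ))),
      ← (h1 y x).eq, mul_assoc, key,
      ← mul_assoc (block u y (Finset.Ico a (a + n))) (1 + x • u (a + (n + 1 : ℕ))),
      ← (h1 x y).eq, mul_assoc]

theorem commute_block_Icc {u : ℤ → E} (hu : HeckeRelations u) (x y : R) (a b : ℤ) :
    Commute (block u x (Finset.Icc a b)) (block u y (Finset.Icc a b)) := by
  have : Finset.Icc a b = Finset.Ico a (a + (b + 1 - a).toNat) := by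
    ext z
    simp only [Finset.mem_Icc, Finset.mem_Ico]
    omega
  rw [this]
  exact commute_block_Ico hu x y a _

theorem block_Icc_eq_mul (u : ℤ → E) (x : R) {a b : ℤ} (h : a ≤ b) :
    block u x (Finset.Icc a b) = block u x (Finset.Icc (a + 1) b) * (1 + x • u a) := by
  have : Finset.Icc a b = Finset.Icc (a + 1) b ∪ {a} := by
    ext z
    simp only [Finset.mem_Icc, Finset.mem_union, Finset.mem_singleton]
    omega
  unfold block
  rw [this, decProd_union, decProd_singleton]
  intro x hx y hy
  rw [Finset.mem_Icc] at hx
  rw [Finset.mem_singleton] at hy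
  omega

end Abstract

/-! ### The 0-Hecke algebra acting on permutations -/

section Operators

variable {R : Type*} [CommRing R]

/-- The operator `v ↦ v · s_i` on linear combinations of permutations. A product of such
operators applied to `1` is the Hecke product of the letters read from right to left. -/
def heckeOp (R : Type*) [CommRing R] (i : ℤ) : Module.End R (Equiv.Perm ℤ →₀ R) :=
  Finsupp.lmapDomain R R fun v => hstep v i

/-- The operator `v ↦ s_i · v` on linear combinations of permutations. -/
def leftHeckeOp (R : Type*) [CommRing R] (i : ℤ) : Module.End R (Equiv.Perm ℤ →₀ R) :=
  Finsupp.lmapDomain R R (lstep i)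

@[simp] theorem heckeOp_single (i : ℤ) (v : Equiv.Perm ℤ) (c : R) :
    heckeOp R i (Finsupp.single v c) = Finsupp.single (hstep v i) c := by
  simp [heckeOp, Finsupp.mapDomain_single]

@[simp] theorem leftHeckeOp_single (i : ℤ) (v : Equiv.Perm ℤ) (c : R) :
    leftHeckeOp R i (Finsupp.single v c) = Finsupp.single (lstep i v) c := by
  simp [leftHeckeOp, Finsupp.mapDomain_single]

theorem heckeRelations_heckeOp : HeckeRelations (E := Module.End R (Equiv.Perm ℤ →₀ R)) (heckeOp R) where
  idem i := by
    refine Finsupp.lhom_ext fun v c => ?_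
    simp [hstep_hstep_self]
  comm i j h := by
    refine Finsupp.lhom_ext fun v c => ?_
    simp [hstep_comm v h]
  braid i := by
    refine Finsupp.lhom_ext fun v c => ?_
    simp [hstep_braid]

theorem commute_leftHeckeOp_heckeOp (i j : ℤ) : Commute (leftHeckeOp R i) (heckeOp R j) := by
  refine Finsupp.lhom_ext fun v c => ?_
  simp [lstep_hstep_comm]

/-- The action of a row: the letters of `S` act in increasing order. -/
def rowAct (v : Equiv.Perm ℤ) (S : Finset ℤ) : Equiv.Perm ℤ :=
  (S.sort (· ≤ ·)).foldl hstep v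

theorem decProd_heckeOp_single (S : Finset ℤ) (v : Equiv.Perm ℤ) (c : R) :
    decProd (heckeOp R) S (Finsupp.single v c) = Finsupp.single (rowAct v S) c := by
  induction S using Finset.induction_on_max with
  | empty => simp [rowAct]
  | insert m S hm ih =>
    rw [decProd_insert_max _ hm, Module.End.mul_apply, ih, heckeOp_single]
    simp [rowAct, sort_insert_max hm]

/-- The product of the blocks of `n` rows, where row `k` has alphabet `S k` and variable `x k`. -/
def blockProd (x : ℕ → R) (S : ℕ → Finset ℤ) (n : ℕ) : Module.End R (Equiv.Perm ℤ →₀ R) :=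
  ((List.range n).map fun k => block (heckeOp R) (x k) (S k)).prod

/-- The coefficient of the permutation `v` in a product of blocks. -/
def blockCoeff (x : ℕ → R) (S : ℕ → Finset ℤ) (n : ℕ) (v : Equiv.Perm ℤ) : R :=
  blockProd x S n (Finsupp.single 1 1) v

/-- An operator relation compatible with composition can be checked on the factors
of a product of blocks. -/
theorem blockProd_induction {R' : Type*} [CommRing R'] {x : ℕ → R} {y : ℕ → R'}
    {S S' : ℕ → Finset ℤ} {n : ℕ}
    (P : (Equiv.Perm ℤ →₀ R) → (Equiv.Perm ℤ →₀ R') → Prop)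
    (h : ∀ k < n, ∀ a b, P a b →
      P (block (heckeOp R) (x k) (S k) a) (block (heckeOp R') (y k) (S' k) b))
    {a : Equiv.Perm ℤ →₀ R} {b : Equiv.Perm ℤ →₀ R'} (hab : P a b) :
    P (blockProd x S n a) (blockProd y S' n b) := by
  induction n generalizing a b with
  | zero => simpa [blockProd] using hab
  | succ n ih =>
    have e1 : blockProd x S (n + 1) = blockProd x S n * block (heckeOp R) (x n) (S n) := by
      simp [blockProd, List.range_succ]
    have e2 : blockProd y S' (n + 1) = blockProd y S' n * block (heckeOp R') (y n) (S' n) := by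
      simp [blockProd, List.range_succ]
    rw [e1, e2, Module.End.mul_apply, Module.End.mul_apply]
    exact ih (fun k hk => h k (by omega)) (h n (by omega) a b hab)

theorem mapRange_heckeOp {R' : Type*} [CommRing R'] (φ : R →+* R') (i : ℤ)
    (a : Equiv.Perm ℤ →₀ R) :
    Finsupp.mapRange φ (map_zero φ) (heckeOp R i a) =
      heckeOp R' i (Finsupp.mapRange φ (map_zero φ) a) := by
  induction a using Finsupp.induction_linear with
  | zero => simp
  | add f g hf hg => rw [map_add, Finsupp.mapRange_add (map_add φ), hf, hg,
      Finsupp.mapRange_add (map_add φ), map_add]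
  | single v c => simp [Finsupp.mapRange_single]

theorem map_block {R' : Type*} [CommRing R'] (φ : R →+* R') (x : R) (S : Finset ℤ)
    (a : Equiv.Perm ℤ →₀ R) :
    Finsupp.mapRange φ (map_zero φ) (block (heckeOp R) x S a) =
      block (heckeOp R') (φ x) S (Finsupp.mapRange φ (map_zero φ) a) := by
  unfold block
  induction S using Finset.induction_on_max with
  | empty => simp
  | insert m S hm ih =>
    rw [decProd_insert_max _ hm, decProd_insert_max _ hm, Module.End.mul_apply,
      Module.End.mul_apply, ← ih]
    simp only [LinearMap.add_apply, Module.End.one_apply, LinearMap.smul_apply]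
    rw [Finsupp.mapRange_add (map_add φ), ← mapRange_heckeOp]
    congr 1
    ext v
    simp

/-- Coefficients of products of blocks are compatible with changes of the variables. -/
theorem map_blockCoeff {R' : Type*} [CommRing R'] (φ : R →+* R') (x : ℕ → R)
    (S : ℕ → Finset ℤ) (n : ℕ) (v : Equiv.Perm ℤ) :
    φ (blockCoeff x S n v) = blockCoeff (fun k => φ (x k)) S n v := by
  have := blockProd_induction (x := x) (y := fun k => φ (x k)) (S := S) (S' := S) (n := n)
    (fun a b => Finsupp.mapRange φ (map_zero φ) a = b)
    (fun k _ a b h => by rw [map_block, h])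
    (a := Finsupp.single 1 1) (b := Finsupp.single 1 1) (by simp [Finsupp.mapRange_single])
  unfold blockCoeff
  rw [← this, Finsupp.mapRange_apply]

/-- Rows whose variable vanishes or whose alphabet is empty can be dropped. -/
theorem blockCoeff_of_trivial {x : ℕ → R} {S : ℕ → Finset ℤ} {m n : ℕ} (hmn : m ≤ n)
    (h : ∀ k, m ≤ k → k < n → x k = 0 ∨ S k = ∅) (v : Equiv.Perm ℤ) :
    blockCoeff x S n v = blockCoeff x S m v := by
  induction n, hmn using Nat.le_induction with
  | base => rfl
  | succ n hmn ih =>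
    rw [← ih fun k h1 h2 => h k h1 (by omega)]
    rcases h n hmn (by omega) with h | h <;>
      simp [blockCoeff, blockProd, List.range_succ, h]

/-- Letters that destroy a half line preserved by `v` do not contribute to the coefficient
of `v`. -/
theorem blockCoeff_of_subset {x : ℕ → R} {S S' : ℕ → Finset ℤ} {n : ℕ} {v : Equiv.Perm ℤ}
    (hS : ∀ k < n, S' k ⊆ S k) (h : ∀ k < n, ∀ c ∈ S k, c ∉ S' k → PreservesCut c v) :
    blockCoeff x S n v = blockCoeff x S' n v := by
  -- `P a b` says that `a` and `b` agree on permutations preserving at least the cuts of `v`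
  let P : (Equiv.Perm ℤ →₀ R) → (Equiv.Perm ℤ →₀ R) → Prop := fun a b =>
    ∀ w : Equiv.Perm ℤ, (∀ c, PreservesCut c v → PreservesCut c w) → a w = b w
  have hzero : ∀ (c : ℤ) (a : Equiv.Perm ℤ →₀ R), PreservesCut c v →
      P (heckeOp R c a) 0 := by
    intro c a hc w hw
    induction a using Finsupp.induction_linear with
    | zero => simp
    | add f g hf hg => simp_all
    | single u r =>
      rw [heckeOp_single, Finsupp.single_eq_of_ne, Finsupp.zero_apply]
      rintro rfl
      exact not_preservesCut_hstep_self c u (hw c hc)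
  have hop : ∀ (i : ℤ) (a : Equiv.Perm ℤ →₀ R), P a 0 → P (heckeOp R i a) 0 := by
    intro i a ha w hw
    rw [heckeOp, Finsupp.lmapDomain_apply, Finsupp.mapDomain, Finsupp.sum_apply,
      Finsupp.zero_apply]
    refine Finset.sum_eq_zero fun u _ => ?_
    by_cases hu : hstep u i = w
    · have : a u = 0 := ha u fun c hc => by
        by_contra h'
        exact not_preservesCut_hstep h' i (hu ▸ hw c hc)
      simp [this]
    · exact Finsupp.single_eq_of_ne fun h => hu h.symm
  have hsub : ∀ a b, P a b ↔ P (a - b) 0 := fun a b => by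
    simp [P, sub_eq_zero]
  have hop' : ∀ (i : ℤ) (a b : Equiv.Perm ℤ →₀ R), P a b →
      P (heckeOp R i a) (heckeOp R i b) := by
    intro i a b hab
    rw [hsub, ← map_sub]
    exact hop i _ ((hsub _ _).1 hab)
  have hfac : ∀ (i : ℤ) (z : R) (a b : Equiv.Perm ℤ →₀ R), P a b →
      P ((1 + z • heckeOp R i) a) ((1 + z • heckeOp R i) b) := by
    intro i z a b hab w hw
    simp [hab w hw, hop' i a b hab w hw]
  have hdrop : ∀ (i : ℤ) (z : R) (a b : Equiv.Perm ℤ →₀ R), PreservesCut i v → P a b →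
      P ((1 + z • heckeOp R i) a) b := by
    intro i z a b hi hab w hw
    simp [hab w hw, hzero i a hi w hw]
  have hblock : ∀ (z : R) (U U' : Finset ℤ), U' ⊆ U →
      (∀ c ∈ U, c ∉ U' → PreservesCut c v) → ∀ a b, P a b →
      P (block (heckeOp R) z U a) (block (heckeOp R) z U' b) := by
    intro z U
    unfold block
    induction U using Finset.induction_on_max with
    | empty =>
      intro U' hU' _ a b hab
      rw [Finset.subset_empty.1 hU']
      simpa using hab
    | insert m U hm ih =>
      intro U' hU' hcut a b hab
      have hmU : m ∉ U := fun h => lt_irrefl _ (hm m h)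
      rw [decProd_insert_max _ hm, Module.End.mul_apply]
      by_cases hmem : m ∈ U'
      · have e : U' = insert m (U'.erase m) := (Finset.insert_erase hmem).symm
        have hsub' : U'.erase m ⊆ U := fun c hc => by
          rw [Finset.mem_erase] at hc
          exact (Finset.mem_insert.1 (hU' hc.2)).resolve_left hc.1
        rw [e, decProd_insert_max _ fun c hc => hm c (hsub' hc), Module.End.mul_apply]
        refine hfac m z _ _ (ih _ hsub' (fun c hc hc' => ?_) a b hab)
        refine hcut c (Finset.mem_insert_of_mem hc) fun h' => hc' ?_
        exact Finset.mem_erase.2 ⟨fun h => hmU (h ▸ hc), h'⟩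
      · have hsub' : U' ⊆ U := fun c hc =>
          (Finset.mem_insert.1 (hU' hc)).resolve_left fun h => hmem (h ▸ hc)
        refine hdrop m z _ _ (hcut m (Finset.mem_insert_self _ _) hmem) (ih _ hsub' ?_ a b hab)
        exact fun c hc => hcut c (Finset.mem_insert_of_mem hc)
  exact blockProd_induction P (fun k hk a b hab => hblock _ _ _ (hS k hk) (h k hk) a b hab)
    (fun w _ => rfl) v fun c hc => hc

theorem shift_injective (m : ℕ) : Function.Injective (shift m) := fun v w h => by
  ext x
  have := congrArg (fun u : Equiv.Perm ℤ => u (x + m)) h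
  simpa [shift_apply] using this

theorem shift_one (m : ℕ) : shift m 1 = 1 := by
  ext x
  simp [shift_apply]

theorem shift_inv (m : ℕ) (w : Equiv.Perm ℤ) : (shift m w)⁻¹ = shift m w⁻¹ := by
  ext x
  rw [perm_inv_apply_eq_iff]
  simp [shift_apply]

theorem hstep_shift (m : ℕ) (v : Equiv.Perm ℤ) (i : ℤ) :
    hstep (shift m v) (i + m) = shift m (hstep v i) := by
  have h : ∀ w : Equiv.Perm ℤ, shift m w * simpleTransposition (i + m) =
      shift m (w * simpleTransposition i) := fun w => by
    ext x
    simp only [Equiv.Perm.mul_apply, shift_apply, simpleTransposition_apply]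
    congr 2
    split_ifs <;> omega
  have e : i + (m : ℤ) + 1 - m = i + 1 := by ring
  unfold hstep
  simp only [h, shift_apply, e, add_sub_cancel_right, add_lt_add_iff_right]
  split_ifs <;> rfl

/-- Coefficients of products of blocks are invariant under translation of the letters. -/
theorem blockCoeff_shift (m : ℕ) (x : ℕ → R) (S : ℕ → Finset ℤ) (n : ℕ) (v : Equiv.Perm ℤ) :
    blockCoeff x (fun k => (S k).image (· + (m : ℤ))) n (shift m v) = blockCoeff x S n v := by
  have hop : ∀ (i : ℤ) (a : Equiv.Perm ℤ →₀ R), (heckeOp R i a).mapDomain (shift m) =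
      heckeOp R (i + m) (a.mapDomain (shift m)) := by
    intro i a
    rw [heckeOp, heckeOp, Finsupp.lmapDomain_apply, Finsupp.lmapDomain_apply,
      ← Finsupp.mapDomain_comp, ← Finsupp.mapDomain_comp]
    congr 1
    ext1 u
    exact (hstep_shift m u i).symm
  have := blockProd_induction (x := x) (y := x) (S := S)
    (S' := fun k => (S k).image (· + (m : ℤ))) (n := n)
    (fun a b => a.mapDomain (shift m) = b) (fun k _ a b h => ?_)
    (a := Finsupp.single 1 1) (b := Finsupp.single 1 1)
    (by simp [Finsupp.mapDomain_single, shift_one])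
  · unfold blockCoeff
    rw [← this, Finsupp.mapDomain_apply (shift_injective m)]
  · subst h
    unfold block
    generalize S k = U
    induction U using Finset.induction_on_max with
    | empty => simp
    | insert j U hj ih =>
      rw [decProd_insert_max _ hj, Finset.image_insert, decProd_insert_max, Module.End.mul_apply,
        Module.End.mul_apply, ← ih]
      · simp [Finsupp.mapDomain_add, Finsupp.mapDomain_smul, hop]
      · intro z hz
        obtain ⟨y, hy, rfl⟩ := Finset.mem_image.1 hz
        have := hj y hy
        omega

end Operators

/-! ### Alternants and tuples of rows -/

section Alternant

variable {R E : Type*} [CommRing R] [Ring E] [Algebra R E] {n : ℕ}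

/-- The monomial-like function `∏ x_k ^ (e_k + n - 1 - k) (1 + x_k) ^ k`, with `0 ≤ k < n`. -/
def rowWeight (e : Fin n → ℕ) (x : Fin n → R) : R :=
  ∏ k, x k ^ (e k + (n - 1 - k)) * (1 + x k) ^ (k : ℕ)

/-- The alternant `∑ sgn(σ) ∏ x_{σ k} ^ (e_k + n - 1 - k) (1 + x_{σ k}) ^ k`. For the row
lengths `e` of a partition, it is the product of the Vandermonde determinant
and the stable Grothendieck polynomial of the partition in `n` variables. -/
def alternant (e : Fin n → ℕ) (x : Fin n → R) : R :=
  ∑ σ : Equiv.Perm (Fin n), (Equiv.Perm.sign σ : ℤ) • rowWeight e (x ∘ σ)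

/-- The word of a tuple of rows, as a product of decreasing words, with the top row `0` in the
leftmost position. -/
def rowsProd (u : ℤ → E) (T : Fin n → Finset ℤ) : E := (List.ofFn fun k => decProd u (T k)).prod

theorem prod_ofFn_block_eq_sum (u : ℤ → E) (x : Fin n → R) (S : Finset ℤ) :
    (List.ofFn fun k => block u (x k) S).prod =
      ∑ T ∈ Fintype.piFinset fun _ => S.powerset, (∏ k, x k ^ (T k).card) • rowsProd u T := by
  simp only [block_eq_sum]
  have := (MultilinearMap.mkPiAlgebraFin R n E).map_sum_finset
    (fun k (T : Finset ℤ) => x k ^ T.card • decProd u T) (fun _ => S.powerset)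
  simp only [MultilinearMap.mkPiAlgebraFin_apply] at this
  rw [this]
  refine Finset.sum_congr rfl fun T _ => ?_
  have := (MultilinearMap.mkPiAlgebraFin R n E).map_smul_univ (fun k => x k ^ (T k).card)
    (fun k => decProd u (T k))
  simpa only [MultilinearMap.mkPiAlgebraFin_apply, rowsProd] using this

theorem prod_ofFn_block_comp_perm {u : ℤ → E} (hu : HeckeRelations u) (x : Fin n → R) (a b : ℤ)
    (σ : Equiv.Perm (Fin n)) :
    (List.ofFn fun k => block u ((x ∘ σ) k) (Finset.Icc a b)).prod =
      (List.ofFn fun k => block u (x k) (Finset.Icc a b)).prod := by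
  refine List.Perm.prod_eq' (Equiv.Perm.ofFn_comp_perm σ fun k => block u (x k) (Finset.Icc a b)) ?_
  exact List.pairwise_ofFn.2 fun _ _ _ => commute_block_Icc hu _ _ a b

/-- The rows `i` and `i'`, where `i'` is below `i`, violate column strictness at the letter `j`:
if `m` is the tuple of the lengths of the rows of the inner shape, then the boxes in row `i'`
with entries at most `j` extend beyond the boxes in row `i` with entries smaller than `j`. -/
def Violates (m : Fin n → ℕ) (T : Fin n → Finset ℤ) (i i' : Fin n) (j : ℤ) : Prop :=
  m i + ((T i).filter (· < j)).card < m i' + ((T i').filter (· ≤ j)).card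

/-- The tuple of rows is an increasing tableau on the skew shape with inner row lengths `m`. -/
def IsColumnStrict (m : Fin n → ℕ) (T : Fin n → Finset ℤ) : Prop :=
  ∀ i i' : Fin n, (i : ℕ) + 1 = i' → ∀ j, ¬ Violates m T i i' j

/-- Among the violations of column strictness, the one of rows `i` and `i'` at `j` comes first,
where small `j` come first and, for equal `j`, lower rows come first. -/
def FirstViolation (m : Fin n → ℕ) (T : Fin n → Finset ℤ) (i i' : Fin n) (j : ℤ) : Prop :=
  Violates m T i i' j ∧
    (∀ j' < j, ∀ k k' : Fin n, (k : ℕ) + 1 = k' → ¬ Violates m T k k' j') ∧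
    ∀ k k' : Fin n, (k : ℕ) + 1 = k' → i < k → ¬ Violates m T k k' j

theorem filter_le_eq_of_filter_lt_eq {S S' : Finset ℤ} {j j' : ℤ}
    (h : S.filter (· < j) = S'.filter (· < j)) (hj : j' < j) :
    S.filter (· ≤ j') = S'.filter (· ≤ j') := by
  ext x
  have := congrArg (x ∈ ·) h
  simp only [Finset.mem_filter, eq_iff_iff] at this ⊢
  constructor <;> rintro ⟨h1, h2⟩
  · exact ⟨(this.1 ⟨h1, by omega⟩).1, h2⟩
  · exact ⟨(this.2 ⟨h1, by omega⟩).1, h2⟩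

theorem filter_lt_eq_of_filter_lt_eq {S S' : Finset ℤ} {j j' : ℤ}
    (h : S.filter (· < j) = S'.filter (· < j)) (hj : j' ≤ j) :
    S.filter (· < j') = S'.filter (· < j') := by
  ext x
  have := congrArg (x ∈ ·) h
  simp only [Finset.mem_filter, eq_iff_iff] at this ⊢
  constructor <;> rintro ⟨h1, h2⟩
  · exact ⟨(this.1 ⟨h1, by omega⟩).1, h2⟩
  · exact ⟨(this.2 ⟨h1, by omega⟩).1, h2⟩

theorem FirstViolation.congr {m : Fin n → ℕ} {T T' : Fin n → Finset ℤ} {i i' : Fin n} {j : ℤ}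
    (hi : (i : ℕ) + 1 = i')
    (h : ∀ k, (T k).filter (· < j) = (T' k).filter (· < j))
    (h' : ∀ k, i < k → (T k).filter (· ≤ j) = (T' k).filter (· ≤ j))
    (hT : FirstViolation m T i i' j) : FirstViolation m T' i i' j := by
  obtain ⟨h1, h2, h3⟩ := hT
  unfold FirstViolation Violates at *
  refine ⟨?_, fun j' hj' k k' hk => ?_, fun k k' hk hik => ?_⟩
  · rw [← h i, ← h' i' (Fin.lt_def.2 (by omega))]
    exact h1
  · rw [← filter_lt_eq_of_filter_lt_eq (h k) hj'.le, ← filter_le_eq_of_filter_lt_eq (h k') hj']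
    exact h2 j' hj' k k' hk
  · rw [← h k, ← h' k' (hik.trans (Fin.lt_def.2 (by omega)))]
    exact h3 k k' hk hik

theorem FirstViolation.unique {m : Fin n → ℕ} {T : Fin n → Finset ℤ} {i i' k k' : Fin n}
    {j l : ℤ} (hi : (i : ℕ) + 1 = i') (hk : (k : ℕ) + 1 = k') (h1 : FirstViolation m T i i' j)
    (h2 : FirstViolation m T k k' l) : i = k ∧ i' = k' ∧ j = l := by
  have hjl : j = l := by
    rcases lt_trichotomy j l with h | h | h
    · exact (h2.2.1 j h i i' hi h1.1).elim
    · exact h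
    · exact (h1.2.1 l h k k' hk h2.1).elim
  subst hjl
  have hik : i = k := by
    rcases lt_trichotomy i k with h | h | h
    · exact (h1.2.2 k k' hk h h2.1).elim
    · exact h
    · exact (h2.2.2 i i' hi h h1.1).elim
  subst hik
  exact ⟨rfl, Fin.ext (by omega), rfl⟩

/-- The shape of the rows at the first violation: this is what makes the tails of the two rows
interchangeable. -/
theorem FirstViolation.spec {m : Fin n → ℕ} {T : Fin n → Finset ℤ} {i i' : Fin n} {j : ℤ}
    (hi : (i : ℕ) + 1 = i') (h : FirstViolation m T i i' j) :
    j ∈ T i' ∧ j - 1 ∉ T i ∧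
      m i' + ((T i').filter (· ≤ j)).card = m i + ((T i).filter (· < j)).card + 1 := by
  have h1 := h.1
  have h2 := h.2.1 (j - 1) (by omega) i i' hi
  unfold Violates at h1 h2
  have e1 : (T i').filter (· ≤ j - 1) = (T i').filter (· < j) :=
    Finset.filter_congr fun x _ => by omega
  have e2 : ((T i').filter (· ≤ j)).card =
      ((T i').filter (· < j)).card + if j ∈ T i' then 1 else 0 := by
    have : (T i').filter (· ≤ j) = (T i').filter (· < j) ∪ (T i').filter (· = j) := by
      ext x
      simp only [Finset.mem_filter, Finset.mem_union, ← and_or_left, le_iff_lt_or_eq]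
    rw [this, Finset.card_union_of_disjoint, Finset.filter_eq']
    · split_ifs <;> simp
    · rw [Finset.disjoint_filter]
      intro x _ hx
      omega
  have e3 : ((T i).filter (· < j)).card =
      ((T i).filter (· < j - 1)).card + if j - 1 ∈ T i then 1 else 0 := by
    have : (T i).filter (· < j) = (T i).filter (· < j - 1) ∪ (T i).filter (· = j - 1) := by
      ext x
      simp only [Finset.mem_filter, Finset.mem_union, ← and_or_left]
      exact and_congr_right fun _ => by omega
    rw [this, Finset.card_union_of_disjoint, Finset.filter_eq']
    · split_ifs <;> simp
    · rw [Finset.disjoint_filter]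
      intro x _ hx
      omega
  rw [e1] at h2
  split_ifs at e2 e3 with g1 g2 g2 <;> first | (exfalso; omega) | exact ⟨g1, g2, by omega⟩

theorem exists_firstViolation {m : Fin n → ℕ} (hm : Antitone m) {T : Fin n → Finset ℤ} {a b : ℤ}
    (hT : ∀ k, T k ⊆ Finset.Icc a b) (h : ¬ IsColumnStrict m T) :
    ∃ i i' : Fin n, (i : ℕ) + 1 = i' ∧ ∃ j ∈ Finset.Icc a b, FirstViolation m T i i' j := by
  classical
  have hmem : ∀ k, ∀ x ∈ T k, a ≤ x ∧ x ≤ b := fun k x hx => Finset.mem_Icc.1 (hT k hx)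
  have hlow : ∀ i i' : Fin n, (i : ℕ) + 1 = i' → ∀ j, Violates m T i i' j → a ≤ j := by
    intro i i' hi j hj
    by_contra hcon
    have h1 : (T i').filter (· ≤ j) = ∅ := Finset.filter_eq_empty_iff.2 fun x hx => by
      have := hmem i' x hx
      omega
    have h2 : m i' ≤ m i := hm (Fin.le_def.2 (by omega))
    unfold Violates at hj
    rw [h1, Finset.card_empty] at hj
    omega
  unfold IsColumnStrict at h
  push Not at h
  obtain ⟨i₀, i₀', hi₀, j₀, hj₀⟩ := h
  -- the smallest letter at which there is a violation
  obtain ⟨j, ⟨k, k', hk, hj⟩, hjmin⟩ : ∃ j, (∃ i i' : Fin n, (i : ℕ) + 1 = i' ∧ Violates m T i i' j) ∧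
      ∀ j', (∃ i i' : Fin n, (i : ℕ) + 1 = i' ∧ Violates m T i i' j') → j ≤ j' := by
    refine Int.exists_least_of_bdd ⟨a, ?_⟩ ⟨j₀, i₀, i₀', hi₀, hj₀⟩
    rintro j ⟨i, i', hi, hj⟩
    exact hlow i i' hi j hj
  -- the lowest row involved in a violation at that letter
  obtain ⟨i, hi, himax⟩ := Finset.exists_max_image
    (Finset.univ.filter fun i : Fin n => ∃ i' : Fin n, (i : ℕ) + 1 = i' ∧ Violates m T i i' j)
    (fun i => i) ⟨k, by simpa using ⟨k', hk, hj⟩⟩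
  simp only [Finset.mem_filter, Finset.mem_univ, true_and] at hi himax
  obtain ⟨i', hi, hv⟩ := hi
  have hfirst : FirstViolation m T i i' j := by
    refine ⟨hv, fun j' hj' l l' hl hv' => ?_, fun l l' hl hil hv' => ?_⟩
    · have := hjmin j' ⟨l, l', hl, hv'⟩
      omega
    · exact absurd (himax l ⟨l', hl, hv'⟩) (not_le.2 hil)
  exact ⟨i, i', hi, j, hT i' (hfirst.spec hi).1, hfirst⟩

theorem prod_ofFn_eq_of_adjacent {M : Type*} [Monoid M] (f : Fin n → M) {i i' : Fin n}
    (hi : (i : ℕ) + 1 = i') :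
    ∃ p q : M, ∀ g : Fin n → M, (∀ k, k ≠ i → k ≠ i' → g k = f k) →
      (List.ofFn g).prod = p * (g i * g i') * q := by
  refine ⟨((List.ofFn f).take i).prod, ((List.ofFn f).drop (i + 2)).prod, fun g hg => ?_⟩
  have h1 : (List.ofFn f).take i = (List.ofFn g).take i := by
    refine List.ext_getElem (by simp) fun k h2 h3 => ?_
    simp only [List.length_take, List.length_ofFn, lt_inf_iff] at h2
    simp only [List.getElem_take, List.getElem_ofFn]
    refine (hg _ ?_ ?_).symm <;> rw [Ne, Fin.ext_iff] <;> dsimp only <;> omega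
  have h2 : (List.ofFn f).drop (i + 2) = (List.ofFn g).drop (i + 2) := by
    refine List.ext_getElem (by simp) fun k h2 h3 => ?_
    simp only [List.getElem_drop, List.getElem_ofFn]
    refine (hg _ ?_ ?_).symm <;> rw [Ne, Fin.ext_iff] <;> dsimp only <;> omega
  rw [h1, h2]
  have hi2 := i'.2
  conv_lhs => rw [← List.prod_take_mul_prod_drop (List.ofFn g) i]
  rw [List.drop_eq_getElem_cons (by simp), List.drop_eq_getElem_cons (by simp; omega),
    List.prod_cons, List.prod_cons, List.getElem_ofFn, List.getElem_ofFn]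
  have : (⟨(i : ℕ) + 1, by omega⟩ : Fin n) = i' := Fin.ext hi
  rw [this]
  simp only [mul_assoc, Fin.eta]

theorem rowWeight_eq_adjacent (e : Fin n → ℕ) (x : Fin n → R) {i i' : Fin n} (h : i ≠ i') :
    rowWeight e x = (x i ^ (e i + (n - 1 - i)) * (1 + x i) ^ (i : ℕ)) *
      ((x i' ^ (e i' + (n - 1 - i')) * (1 + x i') ^ (i' : ℕ)) *
      ∏ k ∈ (Finset.univ.erase i).erase i', x k ^ (e k + (n - 1 - k)) * (1 + x k) ^ (k : ℕ)) := by
  unfold rowWeight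
  rw [← Finset.mul_prod_erase Finset.univ _ (Finset.mem_univ i),
    ← Finset.mul_prod_erase (Finset.univ.erase i) _
      (Finset.mem_erase.2 ⟨h.symm, Finset.mem_univ i'⟩)]

theorem one_add_mul_block {u : ℤ → E} (hu : HeckeRelations u) (y : R) {j b : ℤ} (h : j ≤ b) :
    (1 + y) • (block u y (Finset.Icc (j + 1) b) * u j) = block u y (Finset.Icc j b) * u j := by
  rw [block_Icc_eq_mul u y h, mul_assoc, add_mul, one_mul, smul_mul_assoc, hu.idem, ← mul_smul_comm]
  congr 1
  module

/-- The sum over all ways to extend the heads of the rows `i` and `i'` of a tuple with a first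
violation at `j` is symmetric in the variables of these rows. -/
theorem sum_tails_eq {u : ℤ → E} (hu : HeckeRelations u) {m : Fin n → ℕ} {H : Fin n → Finset ℤ}
    {a b : ℤ} {i i' : Fin n} {j : ℤ} (hi : (i : ℕ) + 1 = i') (hj : j ∈ Finset.Icc a b)
    (hH : FirstViolation m H i i' j) (hHi : ∀ x ∈ H i, x < j) (hHi' : ∀ x ∈ H i', x ≤ j) :
    ∃ p q : E, ∀ x : Fin n → R,
      ∑ t ∈ (Finset.Icc j b).powerset ×ˢ (Finset.Icc (j + 1) b).powerset,
        rowWeight (fun k => m k +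
          (Function.update (Function.update H i (t.1 ∪ H i)) i' (t.2 ∪ H i') k).card) x •
        rowsProd u (Function.update (Function.update H i (t.1 ∪ H i)) i' (t.2 ∪ H i')) =
      (((x i * x i') ^ (m i + (H i).card + (n - 1 - i)) * ((1 + x i) * (1 + x i')) ^ (i : ℕ)) *
        ∏ k ∈ (Finset.univ.erase i).erase i',
          x k ^ (m k + (H k).card + (n - 1 - k)) * (1 + x k) ^ (k : ℕ)) •
        (p * (block u (x i) (Finset.Icc j b) * block u (x i') (Finset.Icc j b)) * q) := by
  have hne : i ≠ i' := fun h => by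
    rw [h] at hi
    omega
  obtain ⟨s1, s2, s3⟩ := hH.spec hi
  rw [Finset.filter_true_of_mem hHi', Finset.filter_true_of_mem hHi] at s3
  obtain ⟨p, q, hpq⟩ := prod_ofFn_eq_of_adjacent (fun k => decProd u (H k)) hi
  refine ⟨p, u j * (decProd u (H i) * decProd u ((H i').erase j)) * q, fun x => ?_⟩
  have hjb := (Finset.mem_Icc.1 hj).2
  have hlt : ∀ x ∈ (H i').erase j, x < j := fun x hx => by
    rw [Finset.mem_erase] at hx
    exact lt_of_le_of_ne (hHi' x hx.2) hx.1
  have hdi' : decProd u (H i') = u j * decProd u ((H i').erase j) := by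
    conv_lhs => rw [← Finset.insert_erase s1]
    exact decProd_insert_max u hlt
  have hcomm : ∀ l, j ≤ l → Commute (u l) (decProd u (H i)) := fun l hl =>
    commute_decProd u fun y hy => by
      have h1 := hHi y hy
      have h2 : y ≠ j - 1 := fun h => s2 (h ▸ hy)
      exact (hu.comm y l (by omega)).symm
  have hterm : ∀ t ∈ (Finset.Icc j b).powerset ×ˢ (Finset.Icc (j + 1) b).powerset,
      rowWeight (fun k => m k +
          (Function.update (Function.update H i (t.1 ∪ H i)) i' (t.2 ∪ H i') k).card) x •
        rowsProd u (Function.update (Function.update H i (t.1 ∪ H i)) i' (t.2 ∪ H i')) =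
      (((x i * x i') ^ (m i + (H i).card + (n - 1 - i)) * ((1 + x i) * (1 + x i')) ^ (i : ℕ)) *
        ∏ k ∈ (Finset.univ.erase i).erase i',
          x k ^ (m k + (H k).card + (n - 1 - k)) * (1 + x k) ^ (k : ℕ)) •
        (p * ((x i ^ t.1.card • decProd u t.1) *
          ((1 + x i') • ((x i' ^ t.2.card • decProd u t.2) * u j))) *
          ((decProd u (H i) * decProd u ((H i').erase j)) * q)) := by
    rintro ⟨P, Q⟩ hPQ
    rw [Finset.mem_product, Finset.mem_powerset, Finset.mem_powerset] at hPQ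
    obtain ⟨hP, hQ⟩ := hPQ
    dsimp only at hP hQ ⊢
    have hPj : ∀ y ∈ P, j ≤ y := fun y hy => (Finset.mem_Icc.1 (hP hy)).1
    have hQj : ∀ y ∈ Q, j + 1 ≤ y := fun y hy => (Finset.mem_Icc.1 (hQ hy)).1
    have v1 : Function.update (Function.update H i (P ∪ H i)) i' (Q ∪ H i') i = P ∪ H i := by
      rw [Function.update_of_ne hne, Function.update_self]
    have v2 : Function.update (Function.update H i (P ∪ H i)) i' (Q ∪ H i') i' = Q ∪ H i' := by
      rw [Function.update_self]
    have v3 : ∀ k, k ≠ i → k ≠ i' →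
        Function.update (Function.update H i (P ∪ H i)) i' (Q ∪ H i') k = H k := fun k h1 h2 => by
      rw [Function.update_of_ne h2, Function.update_of_ne h1]
    have c1 : (P ∪ H i).card = P.card + (H i).card :=
      Finset.card_union_of_disjoint (Finset.disjoint_left.2 fun y hy hy' => by
        have := hPj y hy; have := hHi y hy'; omega)
    have c2 : (Q ∪ H i').card = Q.card + (H i').card :=
      Finset.card_union_of_disjoint (Finset.disjoint_left.2 fun y hy hy' => by
        have := hQj y hy; have := hHi' y hy'; omega)
    have d1 : decProd u (P ∪ H i) = decProd u P * decProd u (H i) :=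
      decProd_union u fun y hy z hz => lt_of_lt_of_le (hHi z hz) (hPj y hy)
    have d2 : decProd u (Q ∪ H i') = decProd u Q * decProd u (H i') :=
      decProd_union u fun y hy z hz => by
        have := hQj y hy; have := hHi' z hz; omega
    have hP2 : (List.ofFn fun k => decProd u
        (Function.update (Function.update H i (P ∪ H i)) i' (Q ∪ H i') k)).prod =
        p * (decProd u P * (decProd u Q * u j)) *
          ((decProd u (H i) * decProd u ((H i').erase j)) * q) := by
      rw [hpq _ fun k h1 h2 => by rw [v3 k h1 h2], v1, v2, d1, d2, hdi']
      have hc : Commute (decProd u (H i)) (decProd u Q * u j) :=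
        (commute_decProd u fun y hy => (hcomm y (by have := hQj y hy; omega)).symm).mul_right
          (hcomm j le_rfl).symm
      have hc' : ∀ z, decProd u (H i) * (decProd u Q * (u j * z)) =
          decProd u Q * (u j * (decProd u (H i) * z)) := fun z => by
        have := congrArg (· * z) hc.eq
        simpa only [mul_assoc] using this
      simp only [mul_assoc, hc']
    rw [rowsProd, hP2, rowWeight_eq_adjacent _ x hne]
    rw [v1, v2, c1, c2]
    have hprod : ∏ k ∈ (Finset.univ.erase i).erase i', x k ^ (m k +
          (Function.update (Function.update H i (P ∪ H i)) i' (Q ∪ H i') k).card + (n - 1 - k)) *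
            (1 + x k) ^ (k : ℕ) =
        ∏ k ∈ (Finset.univ.erase i).erase i',
          x k ^ (m k + (H k).card + (n - 1 - k)) * (1 + x k) ^ (k : ℕ) := by
      refine Finset.prod_congr rfl fun k hk => ?_
      rw [Finset.mem_erase, Finset.mem_erase] at hk
      rw [v3 k hk.2.1 hk.1]
    rw [hprod]
    -- the exponents of `x i` and `x i'` agree up to the contributions of the tails
    have e1 : m i + (P.card + (H i).card) + (n - 1 - i) =
        (m i + (H i).card + (n - 1 - i)) + P.card := by ring
    have e2 : m i' + (Q.card + (H i').card) + (n - 1 - i') =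
        (m i + (H i).card + (n - 1 - i)) + Q.card := by
      have := i'.2
      omega
    rw [e1, e2, ← hi]
    simp only [smul_mul_assoc, mul_smul_comm, smul_smul]
    congr 1
    rw [mul_pow (1 + x i)]
    ring
  rw [Finset.sum_congr rfl hterm, ← Finset.smul_sum, ← Finset.sum_mul, ← Finset.mul_sum,
    Finset.sum_product]
  simp only [← Finset.mul_sum, ← Finset.smul_sum, ← Finset.sum_mul]
  rw [← block_eq_sum, ← block_eq_sum, one_add_mul_block hu _ hjb]
  simp only [mul_assoc]

theorem sum_sign_smul_eq_zero {M : Type*} [AddCommGroup M] {ι : Type*} [Fintype ι]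
    [DecidableEq ι] (f : Equiv.Perm ι → M) {i i' : ι} (h : i ≠ i')
    (hf : ∀ σ, f (σ * Equiv.swap i i') = f σ) :
    ∑ σ : Equiv.Perm ι, (Equiv.Perm.sign σ : ℤ) • f σ = 0 := by
  refine Finset.sum_involution (fun σ _ => σ * Equiv.swap i i') (fun σ _ => ?_) (fun σ _ _ => ?_)
    (fun σ _ => Finset.mem_univ _) fun σ _ => ?_
  · rw [hf, Equiv.Perm.sign_mul, Equiv.Perm.sign_swap h]
    simp
  · intro h'
    rw [mul_eq_left, Equiv.swap_eq_one_iff] at h'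
    exact h h'
  · rw [mul_assoc, Equiv.swap_mul_self, mul_one]

open Classical in
/-- The tuples with a given first violation cancel in the alternating sum. -/
theorem sum_firstViolation_eq_zero {u : ℤ → E} (hu : HeckeRelations u) (m : Fin n → ℕ)
    {a b : ℤ} {i i' : Fin n} {j : ℤ} (hi : (i : ℕ) + 1 = i') (hj : j ∈ Finset.Icc a b)
    (x : Fin n → R) :
    ∑ T ∈ (Fintype.piFinset fun _ : Fin n => (Finset.Icc a b).powerset).filter
        (FirstViolation m · i i' j),
      alternant (fun k => m k + (T k).card) x • rowsProd u T = 0 := by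
  have hne : i ≠ i' := fun h => by
    rw [h] at hi
    omega
  have hja := (Finset.mem_Icc.1 hj).1
  set F := (Fintype.piFinset fun _ : Fin n => (Finset.Icc a b).powerset).filter
        (FirstViolation m · i i' j) with hF
  -- the head of a tuple: the rows `i` and `i'` are cut off at `j`
  let head : (Fin n → Finset ℤ) → Fin n → Finset ℤ := fun T =>
    Function.update (Function.update T i ((T i).filter (· < j))) i' ((T i').filter (· ≤ j))
  have hh1 : ∀ T, head T i = (T i).filter (· < j) := fun T => by
    simp only [head]
    rw [Function.update_of_ne hne, Function.update_self]
  have hh2 : ∀ T, head T i' = (T i').filter (· ≤ j) := fun T => by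
    simp only [head]
    rw [Function.update_self]
  have hh3 : ∀ T k, k ≠ i → k ≠ i' → head T k = T k := fun T k h1 h2 => by
    simp only [head]
    rw [Function.update_of_ne h2, Function.update_of_ne h1]
  have hhF : ∀ T ∈ F, head T ∈ F.image head := fun T hT => Finset.mem_image_of_mem _ hT
  suffices hs : ∀ H ∈ F.image head, ∑ σ : Equiv.Perm (Fin n), (Equiv.Perm.sign σ : ℤ) •
      ∑ T ∈ F.filter (head · = H),
        rowWeight (fun k => m k + (T k).card) (x ∘ σ) • rowsProd u T = 0 by
    rw [← Finset.sum_fiberwise_of_maps_to hhF]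
    refine Finset.sum_eq_zero fun H hH => ?_
    rw [← hs H hH]
    simp only [alternant, Finset.sum_smul, Finset.smul_sum]
    rw [Finset.sum_comm]
    simp only [smul_assoc]
  intro H hH
  obtain ⟨T₀, hT₀, rfl⟩ := Finset.mem_image.1 hH
  rw [hF, Finset.mem_filter, Fintype.mem_piFinset] at hT₀
  obtain ⟨hT₀, hv₀⟩ := hT₀
  set H := head T₀ with hHdef
  have hHi : ∀ y ∈ H i, y < j := fun y hy => by
    rw [hHdef, hh1, Finset.mem_filter] at hy
    exact hy.2
  have hHi' : ∀ y ∈ H i', y ≤ j := fun y hy => by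
    rw [hHdef, hh2, Finset.mem_filter] at hy
    exact hy.2
  have hHsub : ∀ k, H k ⊆ Finset.Icc a b := fun k => by
    have := Finset.mem_powerset.1 (hT₀ k)
    by_cases h1 : k = i
    · subst h1
      rw [hHdef, hh1]
      exact (Finset.filter_subset _ _).trans this
    · by_cases h2 : k = i'
      · subst h2
        rw [hHdef, hh2]
        exact (Finset.filter_subset _ _).trans this
      · rw [hHdef, hh3 _ _ h1 h2]
        exact this
  -- tuples with the same heads have the same first violation
  have hcongr : ∀ T T' : Fin n → Finset ℤ, head T = head T' → FirstViolation m T i i' j →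
      FirstViolation m T' i i' j := by
    intro T T' hTT' hT
    have hlt : ∀ T k, (head T k).filter (· < j) = (T k).filter (· < j) := fun T k => by
      by_cases h1 : k = i
      · subst h1
        rw [hh1, Finset.filter_filter]
        exact Finset.filter_congr fun _ _ => by omega
      · by_cases h2 : k = i'
        · subst h2
          rw [hh2, Finset.filter_filter]
          exact Finset.filter_congr fun _ _ => by omega
        · rw [hh3 _ _ h1 h2]
    have hle : ∀ T k, k ≠ i → (head T k).filter (· ≤ j) = (T k).filter (· ≤ j) := fun T k h1 => by
      by_cases h2 : k = i'
      · subst h2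
        rw [hh2, Finset.filter_filter]
        exact Finset.filter_congr fun _ _ => by omega
      · rw [hh3 _ _ h1 h2]
    refine hT.congr hi (fun k => ?_) fun k hk => ?_
    · rw [← hlt T, ← hlt T', hTT']
    · rw [← hle T k hk.ne', ← hle T' k hk.ne', hTT']
  have hheadH : head H = H := by
    funext k
    by_cases h1 : k = i
    · rw [h1, hh1, Finset.filter_true_of_mem hHi]
    · by_cases h2 : k = i'
      · rw [h2, hh2, Finset.filter_true_of_mem hHi']
      · rw [hh3 _ _ h1 h2]
  have hvH : FirstViolation m H i i' j := hcongr T₀ H (by rw [hheadH]) hv₀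
  let G : Finset ℤ × Finset ℤ → Fin n → Finset ℤ := fun t =>
    Function.update (Function.update H i (t.1 ∪ H i)) i' (t.2 ∪ H i')
  have g1 : ∀ t, G t i = t.1 ∪ H i := fun t => by
    simp only [G]
    rw [Function.update_of_ne hne, Function.update_self]
  have g2 : ∀ t, G t i' = t.2 ∪ H i' := fun t => by
    simp only [G]
    rw [Function.update_self]
  have g3 : ∀ t k, k ≠ i → k ≠ i' → G t k = H k := fun t k h1 h2 => by
    simp only [G]
    rw [Function.update_of_ne h2, Function.update_of_ne h1]
  obtain ⟨p, q, hpq⟩ := sum_tails_eq (R := R) hu hi hj hvH hHi hHi'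
  have hfib : ∀ y : Fin n → R, ∑ T ∈ F.filter (head · = H),
        rowWeight (fun k => m k + (T k).card) y • rowsProd u T =
      ∑ t ∈ (Finset.Icc j b).powerset ×ˢ (Finset.Icc (j + 1) b).powerset,
        rowWeight (fun k => m k + (G t k).card) y • rowsProd u (G t) := by
    intro y
    refine (Finset.sum_nbij' (i := G)
      (j := fun T => ((T i).filter (j ≤ ·), (T i').filter (j + 1 ≤ ·))) ?_ ?_ ?_ ?_ ?_).symm
    · rintro ⟨P, Q⟩ ht
      rw [Finset.mem_product, Finset.mem_powerset, Finset.mem_powerset] at ht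
      obtain ⟨hP, hQ⟩ := ht
      dsimp only at hP hQ
      have hPj : ∀ y ∈ P, ¬ y < j := fun y hy => not_lt.2 (Finset.mem_Icc.1 (hP hy)).1
      have hQj : ∀ y ∈ Q, ¬ y ≤ j := fun y hy => by
        have := (Finset.mem_Icc.1 (hQ hy)).1
        omega
      have hhead : head (G (P, Q)) = H := by
        funext k
        by_cases h1 : k = i
        · rw [h1, hh1, g1, Finset.filter_union, Finset.filter_true_of_mem hHi,
            Finset.filter_false_of_mem hPj, Finset.empty_union]
        · by_cases h2 : k = i'
          · rw [h2, hh2, g2, Finset.filter_union, Finset.filter_true_of_mem hHi',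
              Finset.filter_false_of_mem hQj, Finset.empty_union]
          · rw [hh3 _ _ h1 h2, g3 _ _ h1 h2]
      rw [Finset.mem_filter, hF, Finset.mem_filter, Fintype.mem_piFinset]
      refine ⟨⟨fun k => Finset.mem_powerset.2 ?_, hcongr H _ (by rw [hhead, hheadH]) hvH⟩, hhead⟩
      by_cases h1 : k = i
      · rw [h1, g1]
        refine Finset.union_subset (hP.trans ?_) (hHsub i)
        exact Finset.Icc_subset_Icc hja le_rfl
      · by_cases h2 : k = i'
        · rw [h2, g2]
          refine Finset.union_subset (hQ.trans ?_) (hHsub i')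
          exact Finset.Icc_subset_Icc (by omega) le_rfl
        · rw [g3 _ _ h1 h2]
          exact hHsub k
    · intro T hT
      rw [Finset.mem_filter, hF, Finset.mem_filter, Fintype.mem_piFinset] at hT
      have hTb : ∀ k, ∀ y ∈ T k, y ≤ b := fun k y hy =>
        (Finset.mem_Icc.1 (Finset.mem_powerset.1 (hT.1.1 k) hy)).2
      rw [Finset.mem_product, Finset.mem_powerset, Finset.mem_powerset]
      constructor
      · intro y hy
        rw [Finset.mem_filter] at hy
        exact Finset.mem_Icc.2 ⟨hy.2, hTb i y hy.1⟩
      · intro y hy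
        rw [Finset.mem_filter] at hy
        exact Finset.mem_Icc.2 ⟨hy.2, hTb i' y hy.1⟩
    · rintro ⟨P, Q⟩ ht
      rw [Finset.mem_product, Finset.mem_powerset, Finset.mem_powerset] at ht
      obtain ⟨hP, hQ⟩ := ht
      dsimp only at hP hQ
      have hPj : ∀ y ∈ P, j ≤ y := fun y hy => (Finset.mem_Icc.1 (hP hy)).1
      have hQj : ∀ y ∈ Q, j + 1 ≤ y := fun y hy => (Finset.mem_Icc.1 (hQ hy)).1
      rw [g1, g2, Finset.filter_union, Finset.filter_union, Finset.filter_true_of_mem hPj,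
        Finset.filter_true_of_mem hQj, Finset.filter_false_of_mem, Finset.filter_false_of_mem,
        Finset.union_empty, Finset.union_empty]
      · intro y hy
        have := hHi' y hy
        omega
      · intro y hy
        have := hHi y hy
        omega
    · intro T hT
      rw [Finset.mem_filter] at hT
      have hTH := hT.2
      funext k
      by_cases h1 : k = i
      · rw [h1, g1, ← hTH, hh1]
        ext y
        simp only [Finset.mem_union, Finset.mem_filter, ← and_or_left]
        exact and_iff_left_of_imp fun _ => by omega
      · by_cases h2 : k = i'
        · rw [h2, g2, ← hTH, hh2]
          ext y
          simp only [Finset.mem_union, Finset.mem_filter, ← and_or_left]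
          exact and_iff_left_of_imp fun _ => by omega
        · rw [g3 _ _ h1 h2, ← hTH, hh3 _ _ h1 h2]
    · exact fun _ _ => rfl
  refine sum_sign_smul_eq_zero _ hne fun σ => ?_
  rw [hfib, hfib]
  simp only [G]
  rw [hpq, hpq]
  have s1 : (x ∘ (σ * Equiv.swap i i' : Equiv.Perm (Fin n))) i = (x ∘ σ) i' := by simp
  have s2 : (x ∘ (σ * Equiv.swap i i' : Equiv.Perm (Fin n))) i' = (x ∘ σ) i := by simp
  have s3 : ∀ k, k ≠ i → k ≠ i' →
      (x ∘ (σ * Equiv.swap i i' : Equiv.Perm (Fin n))) k = (x ∘ σ) k := fun k h1 h2 => by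
    simp [Equiv.swap_apply_of_ne_of_ne h1 h2]
  rw [s1, s2, (commute_block_Icc hu _ _ _ _).eq, mul_comm ((x ∘ σ) i') ((x ∘ σ) i),
    mul_comm (1 + (x ∘ σ) i') (1 + (x ∘ σ) i)]
  congr 2
  refine Finset.prod_congr rfl fun k hk => ?_
  rw [Finset.mem_erase, Finset.mem_erase] at hk
  rw [s3 k hk.2.1 hk.1]

open Classical in
/-- Multiplication of an alternant by a product of `n` blocks: the result is a sum over
skew increasing tableaux with at most `n` rows. -/
theorem alternant_smul_prod_block {u : ℤ → E} (hu : HeckeRelations u) {m : Fin n → ℕ}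
    (hm : Antitone m) (a b : ℤ) (x : Fin n → R) :
    alternant m x • (List.ofFn fun k => block u (x k) (Finset.Icc a b)).prod =
      ∑ T ∈ (Fintype.piFinset fun _ : Fin n => (Finset.Icc a b).powerset).filter
          (IsColumnStrict m),
        alternant (fun k => m k + (T k).card) x • rowsProd u T := by
  set A := Fintype.piFinset fun _ : Fin n => (Finset.Icc a b).powerset with hA
  have h1 : alternant m x • (List.ofFn fun k => block u (x k) (Finset.Icc a b)).prod =
      ∑ T ∈ A, alternant (fun k => m k + (T k).card) x • rowsProd u T := by
    have : ∀ σ : Equiv.Perm (Fin n),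
        rowWeight m (x ∘ σ) • (List.ofFn fun k => block u (x k) (Finset.Icc a b)).prod =
        ∑ T ∈ A, rowWeight (fun k => m k + (T k).card) (x ∘ σ) • rowsProd u T := by
      intro σ
      rw [← prod_ofFn_block_comp_perm hu x a b σ, prod_ofFn_block_eq_sum, Finset.smul_sum]
      refine Finset.sum_congr rfl fun T _ => ?_
      rw [smul_smul]
      congr 1
      unfold rowWeight
      rw [← Finset.prod_mul_distrib]
      refine Finset.prod_congr rfl fun k _ => ?_
      ring
    simp only [alternant, Finset.sum_smul, smul_assoc, this, Finset.smul_sum]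
    rw [Finset.sum_comm]
  rw [h1, ← Finset.sum_filter_add_sum_filter_not A (IsColumnStrict m), add_eq_left]
  let K := (Finset.univ ×ˢ (Finset.univ ×ˢ Finset.Icc a b) : Finset (Fin n × Fin n × ℤ)).filter
    fun κ => (κ.1 : ℕ) + 1 = κ.2.1
  have h2 : A.filter (fun T => ¬ IsColumnStrict m T) =
      K.biUnion fun κ => A.filter (FirstViolation m · κ.1 κ.2.1 κ.2.2) := by
    ext T
    simp only [K, Finset.mem_filter, Finset.mem_biUnion, Finset.mem_product, Finset.mem_univ,
      true_and, Prod.exists]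
    constructor
    · rintro ⟨hT, hbad⟩
      obtain ⟨i, i', hi, j, hj, hv⟩ := exists_firstViolation hm
        (fun k => Finset.mem_powerset.1 (Fintype.mem_piFinset.1 hT k)) hbad
      exact ⟨i, i', j, ⟨hj, hi⟩, hT, hv⟩
    · rintro ⟨i, i', j, ⟨-, hi⟩, hT, hv⟩
      exact ⟨hT, fun hgood => hgood i i' hi j hv.1⟩
  rw [h2, Finset.sum_biUnion]
  · refine Finset.sum_eq_zero fun κ hκ => ?_
    simp only [K, Finset.mem_filter, Finset.mem_product, Finset.mem_univ, true_and] at hκ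
    exact sum_firstViolation_eq_zero hu m hκ.2 hκ.1 x
  · rintro ⟨i, i', j⟩ h ⟨k, k', l⟩ h' hne
    simp only [K, Finset.coe_filter, Set.mem_ofPred_eq] at h h'
    refine Finset.disjoint_left.2 fun T hT hT' => hne ?_
    obtain ⟨rfl, rfl, rfl⟩ := FirstViolation.unique h.2 h'.2 (Finset.mem_filter.1 hT).2
      (Finset.mem_filter.1 hT').2
    rfl

end Alternant

section Coefficients

variable {R : Type*} [CommRing R] {n : ℕ}

/-- The Hecke permutation of a list of rows, the top row first. The rows act one after the
other, starting with the bottom row. -/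
def rowsAct (L : List (Finset ℤ)) : Equiv.Perm ℤ := L.foldr (fun S v => rowAct v S) 1

theorem prod_decProd_heckeOp_single (L : List (Finset ℤ)) :
    (L.map (decProd (heckeOp R))).prod (Finsupp.single 1 1) = Finsupp.single (rowsAct L) 1 := by
  induction L with
  | nil => simp [rowsAct]
  | cons S L ih =>
    rw [List.map_cons, List.prod_cons, Module.End.mul_apply, ih, decProd_heckeOp_single]
    rfl

theorem not_preservesCut_rowsAct {L : List (Finset ℤ)} {S : Finset ℤ} (hS : S ∈ L) {c : ℤ}
    (hc : c ∈ S) : ¬ PreservesCut c (rowsAct L) := by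
  induction L with
  | nil => simp at hS
  | cons U L ih =>
    rcases List.mem_cons.1 hS with rfl | h
    · exact not_preservesCut_of_mem ((Finset.mem_sort _).2 hc) _
    · exact not_preservesCut_foldl (ih h) _

open Classical in
/-- The expansion of the product of an alternant and a coefficient of a product of `n` blocks. -/
theorem alternant_mul_blockCoeff {m : Fin n → ℕ} (hm : Antitone m) (a b : ℤ) (x : ℕ → R)
    (v : Equiv.Perm ℤ) :
    alternant m (fun k => x k) * blockCoeff x (fun _ => Finset.Icc a b) n v =
      ∑ T ∈ (Fintype.piFinset fun _ : Fin n => (Finset.Icc a b).powerset).filter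
          (fun T => IsColumnStrict m T ∧ rowsAct (List.ofFn T) = v),
        alternant (fun k => m k + (T k).card) (fun k => x k) := by
  have h1 : blockProd x (fun _ => Finset.Icc a b) n =
      (List.ofFn fun k : Fin n => block (heckeOp R) (x k) (Finset.Icc a b)).prod := by
    unfold blockProd
    congr 1
    refine List.ext_getElem (by simp) fun k _ _ => ?_
    simp
  have h2 := alternant_smul_prod_block (heckeRelations_heckeOp (R := R)) hm a b fun k => x k
  have h3 := congrArg (fun f : Module.End R (Equiv.Perm ℤ →₀ R) => f (Finsupp.single 1 1) v) h2
  simp only [LinearMap.smul_apply, Finsupp.smul_apply, smul_eq_mul, LinearMap.sum_apply,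
    Finsupp.finsetSum_apply] at h3
  rw [blockCoeff, h1, h3, Finset.sum_filter, Finset.sum_filter]
  refine Finset.sum_congr rfl fun T _ => ?_
  have h4 : rowsProd (heckeOp R) T (Finsupp.single 1 1) =
      Finsupp.single (rowsAct (List.ofFn T)) 1 := by
    rw [← prod_decProd_heckeOp_single, List.map_ofFn]
    rfl
  rw [h4, Finsupp.single_apply]
  split_ifs <;> simp_all

theorem subset_Icc_of_rowsAct {p q : ℤ} {L : List (Finset ℤ)}
    (h : ∀ x, x < p ∨ q < x → rowsAct L x = x) {S : Finset ℤ} (hS : S ∈ L) :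
    S ⊆ Finset.Icc p (q - 1) := by
  intro c hc
  have := not_preservesCut_rowsAct hS hc
  by_contra hcon
  rw [Finset.mem_Icc] at hcon
  exact this (preservesCut_of_bounds h (by omega))

end Coefficients

/-- The alternant of the empty partition does not vanish. -/
theorem alternant_zero_ne_zero (n : ℕ) :
    alternant (fun _ : Fin n => 0) (fun k => (MvPolynomial.X (k : ℕ) : MvPolynomial ℕ ℤ)) ≠ 0 := by
  intro h
  -- evaluation at `x_k = k + 1` gives a Vandermonde determinant in the numbers `1 + 1 / x_k`
  let x : Fin n → ℚ := fun k => (k : ℕ) + 1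
  have hx : ∀ k, x k ≠ 0 := fun k => by
    have : (0 : ℚ) < x k := by positivity
    exact this.ne'
  have h1 := congrArg (MvPolynomial.eval₂Hom (Int.castRingHom ℚ) fun k : ℕ => (k : ℚ) + 1) h
  have h2 : alternant (fun _ : Fin n => 0) x = 0 := by
    rw [map_zero] at h1
    rw [← h1]
    simp only [alternant, rowWeight, map_sum, map_zsmul, map_prod, map_mul, map_pow, map_add, map_one,
      Function.comp_apply, MvPolynomial.coe_eval₂Hom, MvPolynomial.eval₂_X, x]
  have h3 : alternant (fun _ : Fin n => 0) x =
      (Matrix.of fun i j : Fin n => x i ^ (n - 1) * Matrix.vandermonde (fun k => 1 + 1 / x k) i j).det := by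
    rw [Matrix.det_apply]
    unfold alternant rowWeight
    refine Finset.sum_congr rfl fun σ _ => ?_
    rw [Units.smul_def]
    congr 1
    refine Finset.prod_congr rfl fun k _ => ?_
    simp only [Function.comp_apply, Matrix.of_apply, Matrix.vandermonde_apply, zero_add]
    have e : n - 1 = (n - 1 - k) + k := by omega
    have h4 : 1 + x (σ k) = x (σ k) * (1 + 1 / x (σ k)) := by
      have := hx (σ k)
      field_simp
      ring
    conv_rhs => rw [e]
    rw [h4, mul_pow, pow_add, ← mul_assoc]
  rw [h3, Matrix.det_mul_column] at h2
  rcases mul_eq_zero.1 h2 with h2 | h2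
  · rw [Finset.prod_eq_zero_iff] at h2
    obtain ⟨k, -, hk⟩ := h2
    exact pow_ne_zero _ (hx k) hk
  · refine Matrix.det_vandermonde_ne_zero_iff.2 (fun k l hkl => ?_) h2
    simp only [add_right_inj, one_div, inv_inj, x, add_left_inj, Nat.cast_inj] at hkl
    exact Fin.ext hkl

/-! ### Grassmannian permutations and tableaux -/

/-- The inverse of `v` has no descents except possibly at `l`. -/
def IsInverseGrassmannian (l : ℤ) (v : Equiv.Perm ℤ) : Prop :=
  ∀ k, k ≠ l → v⁻¹ k < v⁻¹ (k + 1)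

theorem isInverseGrassmannian_one (l : ℤ) : IsInverseGrassmannian l 1 := fun k _ => by simp

theorem IsInverseGrassmannian.lt {l : ℤ} {v : Equiv.Perm ℤ} (h : IsInverseGrassmannian l v)
    {k k' : ℤ} (hk : k < k') (hl : k' ≤ l ∨ l < k) : v⁻¹ k < v⁻¹ k' := by
  have : ∀ d : ℕ, k + 1 + d ≤ k' → v⁻¹ k < v⁻¹ (k + 1 + d) := by
    intro d
    induction d with
    | zero =>
      intro hd
      simp only [Nat.cast_zero, add_zero] at hd ⊢
      exact h k (by omega)
    | succ d ih =>
      intro hd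
      push_cast at hd ⊢
      refine (ih (by omega)).trans ?_
      have := h (k + 1 + d) (by omega)
      rwa [add_assoc (k + 1) (d : ℤ) 1] at this
  have e : k' = k + 1 + ((k' - k - 1).toNat : ℕ) := by omega
  rw [e]
  exact this _ (by omega)

theorem hstep_of_lt {v : Equiv.Perm ℤ} {r : ℤ} (h : v r < v (r + 1)) :
    hstep v r = v * simpleTransposition r := if_pos h

theorem isInverseGrassmannian_of_hstep {l : ℤ} {v : Equiv.Perm ℤ} {r : ℤ}
    (h : IsInverseGrassmannian l (hstep v r)) : IsInverseGrassmannian l v := by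
  intro k hk
  have h1 := h k hk
  by_cases hv : v r < v (r + 1)
  · rw [hstep_of_lt hv, mul_inv_rev, simpleTransposition_inv, Equiv.Perm.mul_apply,
      Equiv.Perm.mul_apply] at h1
    by_contra h2
    have e1 : v (v⁻¹ k) = k := by simp
    have e2 : v (v⁻¹ (k + 1)) = k + 1 := by simp
    have hne := v⁻¹.injective.ne (show k ≠ k + 1 by omega)
    have : ¬ (v⁻¹ (k + 1) = r ∧ v⁻¹ k = r + 1) := by
      rintro ⟨h3, h4⟩
      rw [h3] at e2
      rw [h4] at e1
      omega
    simp only [simpleTransposition_apply] at h1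
    split_ifs at h1 <;> omega
  · rwa [hstep, if_neg hv] at h1

theorem isInverseGrassmannian_of_foldl {l : ℤ} {v : Equiv.Perm ℤ} {a : List ℤ}
    (h : IsInverseGrassmannian l (a.foldl hstep v)) : IsInverseGrassmannian l v := by
  induction a generalizing v with
  | nil => exact h
  | cons i a ih => exact isInverseGrassmannian_of_hstep (ih h)

/-- A letter `r` can only act on an inverse Grassmannian permutation when exactly one of the
values at `r` and `r + 1` exceeds `l`. -/
theorem IsInverseGrassmannian.not_iff {l : ℤ} {v : Equiv.Perm ℤ} {r : ℤ}
    (h : IsInverseGrassmannian l (hstep v r)) : ¬ (v r ≤ l ↔ v (r + 1) ≤ l) := by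
  intro hiff
  have hv := isInverseGrassmannian_of_hstep h
  have hne := apply_ne_apply_succ v r
  have e1 : v⁻¹ (v r) = r := by simp
  have e2 : v⁻¹ (v (r + 1)) = r + 1 := by simp
  have hlt : v r < v (r + 1) := by
    by_contra hcon
    have := hv.lt (k := v (r + 1)) (k' := v r) (by omega) (by omega)
    rw [e1, e2] at this
    omega
  have hsucc : v (r + 1) = v r + 1 := by
    by_contra hcon
    have h1 := hv.lt (k := v r) (k' := v r + 1) (by omega) (by omega)
    have h2 := hv.lt (k := v r + 1) (k' := v (r + 1)) (by omega) (by omega)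
    rw [e1] at h1
    rw [e2] at h2
    omega
  have h1 := h (v r) (by omega)
  rw [hstep_of_lt hlt, mul_inv_rev, simpleTransposition_inv, Equiv.Perm.mul_apply,
    Equiv.Perm.mul_apply, ← hsucc, e1, e2, simpleTransposition_left,
    simpleTransposition_right] at h1
  omega

/-- The permutation `v` is inverse Grassmannian, and the positions of its values above `l`, in
increasing order, are `h 0, h 1, …`, except that the first `c` of them are decreased by one. -/
def HasHoles (l : ℤ) (h : ℕ → ℤ) (c : ℕ) (v : Equiv.Perm ℤ) : Prop :=
  IsInverseGrassmannian l v ∧ ∀ i : ℕ, v⁻¹ (l + 1 + i) = if i < c then h i - 1 else h i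

theorem HasHoles.lt_apply_iff {l : ℤ} {h : ℕ → ℤ} {c : ℕ} {v : Equiv.Perm ℤ}
    (hv : HasHoles l h c v) (r : ℤ) :
    l < v r ↔ ∃ i : ℕ, r = if i < c then h i - 1 else h i := by
  constructor
  · intro hr
    refine ⟨(v r - l - 1).toNat, ?_⟩
    rw [← hv.2, eq_comm, perm_inv_apply_eq_iff]
    omega
  · rintro ⟨i, hi⟩
    rw [← hv.2, eq_comm, perm_inv_apply_eq_iff] at hi
    omega

theorem HasHoles.step {l : ℤ} {h : ℕ → ℤ} (hmono : StrictMono h) {c : ℕ} {v : Equiv.Perm ℤ}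
    (hv : HasHoles l h c v) : HasHoles l h (c + 1) (hstep v (h c - 1)) := by
  have h1 : ¬ l < v (h c - 1) := by
    rw [hv.lt_apply_iff]
    rintro ⟨i, hi⟩
    split_ifs at hi with hic
    · have := hmono hic
      omega
    · have := hmono.monotone (not_lt.1 hic)
      omega
  have h2 : v (h c - 1 + 1) = l + 1 + c := by
    rw [← perm_inv_apply_eq_iff, hv.2, if_neg (lt_irrefl c)]
    ring
  have hlt : v (h c - 1) < v (h c - 1 + 1) := by omega
  have e1 : v⁻¹ (v (h c - 1)) = h c - 1 := by simp
  rw [hstep_of_lt hlt]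
  constructor
  · intro k hk
    have h3 := hv.1 k hk
    rw [mul_inv_rev, simpleTransposition_inv, Equiv.Perm.mul_apply, Equiv.Perm.mul_apply]
    have : ¬ (v⁻¹ k = h c - 1 ∧ v⁻¹ (k + 1) = h c - 1 + 1) := by
      rintro ⟨h4, h5⟩
      rw [perm_inv_apply_eq_iff] at h4 h5
      omega
    simp only [simpleTransposition_apply]
    split_ifs <;> omega
  · intro i
    rw [mul_inv_rev, simpleTransposition_inv, Equiv.Perm.mul_apply, hv.2]
    rcases lt_trichotomy i c with hi | rfl | hi
    · have := hmono hi
      rw [if_pos hi, if_pos (by omega), simpleTransposition_of_ne (by omega) (by omega)]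
    · rw [if_neg (lt_irrefl _), if_pos (by omega), simpleTransposition_apply]
      split_ifs <;> omega
    · have := hmono hi
      rw [if_neg (by omega), if_neg (by omega), simpleTransposition_of_ne (by omega) (by omega)]

theorem HasHoles.foldl {l : ℤ} {h : ℕ → ℤ} (hmono : StrictMono h) {v : Equiv.Perm ℤ}
    (hv : HasHoles l h 0 v) (a : ℕ) :
    HasHoles l h a (((List.range a).map fun k => h k - 1).foldl hstep v) := by
  induction a with
  | zero => simpa using hv
  | succ a ih =>
    rw [List.range_succ, List.map_append, List.foldl_append]
    exact ih.step hmono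

/-- The letters of an increasing word, bounded by the first `s` holes, are forced when the
word keeps the permutation inverse Grassmannian. -/
theorem HasHoles.word_eq {l : ℤ} {h : ℕ → ℤ} (hmono : StrictMono h) {s : ℕ}
    (hs : ∀ i, s ≤ i → h (i + 1) = h i + 1) (a : List ℤ) {c : ℕ} {v : Equiv.Perm ℤ}
    (hv : HasHoles l h c v) (ha : a.Pairwise (· < ·)) (hlow : ∀ r ∈ a, ∀ i < c, h i ≤ r)
    (hup : ∀ (k : ℕ) (hk : k < a.length), c + k < s → a[k] < h (c + k))
    (hfin : IsInverseGrassmannian l (a.foldl hstep v)) :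
    a = (List.range a.length).map fun k => h (c + k) - 1 := by
  induction a generalizing c v with
  | nil => rfl
  | cons r a ih =>
    have hr := IsInverseGrassmannian.not_iff (isInverseGrassmannian_of_foldl hfin)
    have hcons : ∀ d : ℕ, s ≤ c → h (c + d) = h c + d := by
      intro d hc
      induction d with
      | zero => simp
      | succ d ihd =>
        rw [← add_assoc, hs _ (by omega), ihd]
        push_cast
        ring
    have hlow' := hlow r List.mem_cons_self
    have hlt : r < h c := by
      by_cases hc : c < s
      · exact hup 0 (by simp) hc
      · by_contra hcon
        apply hr
        have e1 : l < v r := (hv.lt_apply_iff r).2 ⟨c + (r - h c).toNat, by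
          rw [if_neg (by omega), hcons _ (by omega)]
          omega⟩
        have e2 : l < v (r + 1) := (hv.lt_apply_iff _).2 ⟨c + (r + 1 - h c).toNat, by
          rw [if_neg (by omega), hcons _ (by omega)]
          omega⟩
        omega
    have hnot : ¬ l < v r := by
      rw [hv.lt_apply_iff]
      rintro ⟨i, hi⟩
      split_ifs at hi with hic
      · have := hlow' i hic
        omega
      · have := hmono.monotone (not_lt.1 hic)
        omega
    have hhole : l < v (r + 1) := by
      by_contra hcon
      exact hr (by omega)
    rw [hv.lt_apply_iff] at hhole
    obtain ⟨i, hi⟩ := hhole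
    have hrc : r = h c - 1 := by
      split_ifs at hi with hic
      · have := hlow' i hic
        omega
      · have := hmono.monotone (not_lt.1 hic)
        omega
    rw [List.pairwise_cons] at ha
    have key := ih (c := c + 1) (v := hstep v r) (hrc ▸ hv.step hmono) ha.2
      (fun r' hr' i hi => by
        have := ha.1 r' hr'
        have := hmono.monotone (Nat.le_of_lt_succ hi)
        omega)
      (fun k hk hks => by
        have := hup (k + 1) (by simpa using hk) (by omega)
        rw [List.getElem_cons_succ] at this
        rwa [add_assoc, add_comm 1 k]) hfin
    rw [List.length_cons, List.range_succ_eq_map, List.map_cons, add_zero, ← hrc, List.map_map]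
    congr 1
    conv_lhs => rw [key]
    refine List.map_congr_left fun k _ => ?_
    simp only [Function.comp_apply, Nat.succ_eq_add_one]
    rw [add_assoc, add_comm 1 k]

/-- Consecutive rows of an increasing tableau of straight shape. -/
def Dominates (S S' : Finset ℤ) : Prop :=
  ∀ j, (S'.filter (· ≤ j)).card ≤ (S.filter (· < j)).card

theorem Dominates.card_le {S S' : Finset ℤ} (h : Dominates S S') : S'.card ≤ S.card := by
  obtain ⟨j, hj⟩ := S'.bddAbove
  have := h j
  rw [Finset.filter_true_of_mem fun x hx => hj (Finset.mem_coe.2 hx)] at this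
  exact this.trans (Finset.card_filter_le _ _)

theorem sort_image_range {g : ℕ → ℤ} (hg : StrictMono g) (a : ℕ) :
    ((Finset.range a).image g).sort (· ≤ ·) = (List.range a).map g := by
  induction a with
  | zero => simp
  | succ a ih =>
    rw [Finset.range_add_one, Finset.image_insert, sort_insert_max, ih, List.range_succ,
      List.map_append]
    · rfl
    · intro x hx
      obtain ⟨k, hk, rfl⟩ := Finset.mem_image.1 hx
      exact hg (Finset.mem_range.1 hk)

theorem getElem_sort_lt {S : Finset ℤ} {k : ℕ} (hk : k < (S.sort (· ≤ ·)).length) {y : ℤ}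
    (h : k + 1 ≤ (S.filter (· < y)).card) : (S.sort (· ≤ ·))[k] < y := by
  by_contra hcon
  have hsub : S.filter (· < y) ⊆ ((S.sort (· ≤ ·)).take k).toFinset := by
    intro z hz
    rw [Finset.mem_filter] at hz
    obtain ⟨i, hi, rfl⟩ := List.mem_iff_getElem.1 ((Finset.mem_sort (· ≤ ·)).2 hz.1)
    rw [List.mem_toFinset]
    have hik : i < k := by
      by_contra hik
      have := (Finset.sortedLT_sort S).strictMono_get.monotone
        (show (⟨k, hk⟩ : Fin _) ≤ ⟨i, hi⟩ from not_lt.1 hik)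
      simp only [List.get_eq_getElem] at this
      omega
    rw [List.mem_take_iff_getElem]
    exact ⟨i, by omega, rfl⟩
  have h1 := Finset.card_le_card hsub
  have h2 := List.toFinset_card_le ((S.sort (· ≤ ·)).take k)
  rw [List.length_take] at h2
  omega

theorem IsInverseGrassmannian.strictMono_holes {l : ℤ} {v : Equiv.Perm ℤ}
    (h : IsInverseGrassmannian l v) : StrictMono fun i : ℕ => v⁻¹ (l + 1 + i) :=
  fun i j hij => h.lt (by omega) (by omega)

theorem IsInverseGrassmannian.hasHoles {l : ℤ} {v : Equiv.Perm ℤ}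
    (h : IsInverseGrassmannian l v) : HasHoles l (fun i : ℕ => v⁻¹ (l + 1 + i)) 0 v :=
  ⟨h, fun i => by simp⟩

theorem strictMono_sub_one {h : ℕ → ℤ} (hmono : StrictMono h) : StrictMono fun k => h k - 1 :=
  fun i j hij => by
    have := hmono hij
    dsimp only
    omega

/-- Let `S` be the first row of an increasing tableau of straight shape whose rows below the
first one are `L`. If the Hecke permutation is inverse Grassmannian, then the rows are determined
by their lengths, and so are the holes. -/
theorem rowsAct_spec {l : ℤ} {L : List (Finset ℤ)} (hchain : L.IsChain Dominates)
    (hL : IsInverseGrassmannian l (rowsAct L)) :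
    (∀ c : ℕ, (rowsAct L)⁻¹ (l + 1 + c) = l + 1 + c - (L.countP fun S => c < S.card : ℕ)) ∧
    ∀ S L', L = S :: L' → S = (Finset.range S.card).image
      fun c : ℕ => l + c - (L'.countP fun S => c < S.card : ℕ) := by
  induction L with
  | nil =>
    refine ⟨fun c => by simp [rowsAct], fun S L' h => by simp at h⟩
  | cons S L ih =>
    have hL' : IsInverseGrassmannian l (rowsAct L) := isInverseGrassmannian_of_foldl hL
    obtain ⟨ih1, ih2⟩ := ih hchain.tail hL'
    set h : ℕ → ℤ := fun i => (rowsAct L)⁻¹ (l + 1 + i) with hdef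
    have hmono : StrictMono h := hL'.strictMono_holes
    have hh : ∀ c : ℕ, h c = l + 1 + c - (L.countP fun S => c < S.card : ℕ) := ih1
    -- `s` is the length of the first row of `L`, which consists of the first `s` holes
    obtain ⟨s, hs1, hs2, hs3⟩ : ∃ s : ℕ, s ≤ S.card ∧
        (∀ c, s ≤ c → L.countP (fun S => c < S.card) = 0) ∧
        ∀ c, c < s → c + 1 ≤ (S.filter (· < h c)).card := by
      cases L with
      | nil => exact ⟨0, Nat.zero_le _, fun c _ => by simp, fun c hc => by omega⟩
      | cons S' L =>
        have hd : Dominates S S' := (List.isChain_cons_cons.1 hchain).1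
        have hmax : ∀ U ∈ S' :: L, U.card ≤ S'.card := by
          intro U hU
          have hp : ((S' :: L).map Finset.card).Pairwise (· ≥ ·) := by
            rw [← List.isChain_iff_pairwise, List.isChain_map]
            exact hchain.tail.imp fun a b hab => hab.card_le
          rw [List.map_cons, List.pairwise_cons] at hp
          rcases List.mem_cons.1 hU with rfl | hU
          · exact le_rfl
          · exact hp.1 U.card (List.mem_map_of_mem hU)
        refine ⟨S'.card, hd.card_le, fun c hc => ?_, fun c hc => ?_⟩
        · rw [List.countP_eq_zero]
          intro U hU
          have := hmax U hU
          simp only [decide_eq_true_eq]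
          omega
        · have hS' := ih2 S' L rfl
          have hg : ∀ i, i < S'.card →
              l + i - (L.countP fun S => i < S.card : ℕ) = h i := fun i hi => by
            rw [hh, List.countP_cons_of_pos (by simpa using hi)]
            push_cast
            ring
          have hS'' : S' = (Finset.range S'.card).image h := by
            conv_lhs => rw [hS']
            exact Finset.image_congr fun i hi => hg i (Finset.mem_range.1 hi)
          have hsub : (Finset.range (c + 1)).image h ⊆ S'.filter (· ≤ h c) := by
            intro y hy
            obtain ⟨i, hi, rfl⟩ := Finset.mem_image.1 hy
            rw [Finset.mem_range] at hi
            rw [Finset.mem_filter]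
            refine ⟨?_, hmono.monotone (by omega)⟩
            rw [hS'']
            exact Finset.mem_image_of_mem _ (Finset.mem_range.2 (by omega))
          have h1 := Finset.card_le_card hsub
          rw [Finset.card_image_of_injective _ hmono.injective, Finset.card_range] at h1
          exact h1.trans (hd (h c))
    have hcons : ∀ i, s ≤ i → h (i + 1) = h i + 1 := fun i hi => by
      rw [hh, hh, hs2 i hi, hs2 (i + 1) (by omega)]
      push_cast
      ring
    have hword := HasHoles.word_eq hmono (s := s) hcons (S.sort (· ≤ ·)) (c := 0)
      hL'.hasHoles (Finset.sortedLT_sort S).pairwise (fun _ _ _ h => by omega)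
      (fun k hk hks => by
        rw [zero_add] at hks ⊢
        exact getElem_sort_lt hk (hs3 k hks)) hL
    rw [Finset.length_sort] at hword
    simp only [zero_add] at hword
    have hS : S = (Finset.range S.card).image fun k => h k - 1 := by
      rw [← Finset.sort_toFinset (s := S) (r := (· ≤ ·)), hword, ← sort_image_range (strictMono_sub_one hmono),
        Finset.sort_toFinset]
      simp [Finset.card_image_of_injective _ (strictMono_sub_one hmono).injective]
    constructor
    · intro c
      have := (HasHoles.foldl hmono hL'.hasHoles S.card).2 c
      rw [← hword] at this
      change (rowAct (rowsAct L) S)⁻¹ (l + 1 + c) = _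
      rw [rowAct, this, hh, List.countP_cons]
      simp only [decide_eq_true_eq]
      split_ifs <;> push_cast <;> ring
    · rintro S₁ L₁ ⟨⟩
      conv_lhs => rw [hS]
      refine Finset.image_congr fun c _ => ?_
      rw [hh]
      ring

/-- Two increasing tableaux of the same straight shape with inverse Grassmannian Hecke
permutations, for the same descent, agree. -/
theorem rows_eq_of_isInverseGrassmannian {l : ℤ} {L L' : List (Finset ℤ)}
    (h1 : L.IsChain Dominates) (h2 : L'.IsChain Dominates)
    (hL : IsInverseGrassmannian l (rowsAct L)) (hL' : IsInverseGrassmannian l (rowsAct L'))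
    (hcard : L.map Finset.card = L'.map Finset.card) : L = L' := by
  induction L generalizing L' with
  | nil =>
    symm
    simpa using hcard.symm
  | cons S L ih =>
    cases L' with
    | nil => simp at hcard
    | cons S' L' =>
      simp only [List.map_cons, List.cons.injEq] at hcard
      have e := ih h1.tail h2.tail (isInverseGrassmannian_of_foldl hL)
        (isInverseGrassmannian_of_foldl hL') hcard.2
      subst e
      rw [(rowsAct_spec h1 hL).2 S L rfl, (rowsAct_spec h2 hL').2 S' L rfl, hcard.1]

section Superstandard

variable (μ : YoungDiagram)

theorem lt_rowLen_iff (r c : ℕ) : c < μ.rowLen r ↔ r < μ.colLen c := by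
  rw [← YoungDiagram.mem_iff_lt_rowLen, ← YoungDiagram.mem_iff_lt_colLen]

/-- The rows of the increasing tableau of shape `μ` whose Hecke permutation is the inverse of the
Grassmannian permutation of `μ`: column `c` consists of consecutive integers and ends with
`colLen 0 + c`. -/
def grassmannianRow (k : ℕ) : Finset ℤ :=
  (Finset.range (μ.rowLen k)).image
    fun c : ℕ => (μ.colLen 0 : ℤ) + 1 + c - (μ.colLen c - (k + 1) : ℕ) - 1

theorem strictMono_grassmannian_holes (k : ℕ) :
    StrictMono fun c : ℕ => (μ.colLen 0 : ℤ) + 1 + c - (μ.colLen c - k : ℕ) := by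
  refine strictMono_nat_of_lt_succ fun c => ?_
  have := μ.colLen_anti c (c + 1) (Nat.le_succ c)
  push_cast
  omega

theorem card_grassmannianRow (k : ℕ) : (grassmannianRow μ k).card = μ.rowLen k := by
  unfold grassmannianRow
  rw [Finset.card_image_of_injective _ (strictMono_sub_one (strictMono_grassmannian_holes μ (k + 1))).injective,
    Finset.card_range]

theorem dominates_grassmannianRow (k : ℕ) :
    Dominates (grassmannianRow μ k) (grassmannianRow μ (k + 1)) := by
  intro j
  refine Finset.card_le_card_of_injOn (· - 1) (fun y hy => ?_) (sub_left_injective.injOn)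
  simp only [grassmannianRow, Finset.coe_filter, Finset.mem_image, Finset.mem_range,
    Set.mem_ofPred_eq] at hy ⊢
  obtain ⟨⟨c, hc, rfl⟩, hj⟩ := hy
  have h1 := μ.rowLen_anti k (k + 1) (Nat.le_succ k)
  have h2 := (lt_rowLen_iff μ (k + 1) c).1 hc
  refine ⟨⟨c, by omega, ?_⟩, ?_⟩ <;> omega

theorem hasHoles_grassmannianRow {n : ℕ} (hn : μ.colLen 0 ≤ n) (k : ℕ) (hk : k ≤ n) :
    HasHoles (μ.colLen 0) (fun c : ℕ => (μ.colLen 0 : ℤ) + 1 + c - (μ.colLen c - (n - k) : ℕ)) 0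
      (rowsAct ((List.ofFn fun i : Fin n => grassmannianRow μ i).drop (n - k))) := by
  induction k with
  | zero =>
    rw [List.drop_eq_nil_of_le (by simp)]
    refine ⟨isInverseGrassmannian_one _, fun c => ?_⟩
    have := μ.colLen_anti 0 c (Nat.zero_le c)
    simp only [rowsAct, List.foldr_nil, inv_one, Equiv.Perm.one_apply, not_lt_zero, if_false]
    omega
  | succ k ih =>
    have e : n - k = n - (k + 1) + 1 := by omega
    have h1 := ih (by omega)
    rw [e] at h1
    rw [List.drop_eq_getElem_cons (by simp; omega), List.getElem_ofFn]
    have h2 := h1.foldl (strictMono_grassmannian_holes μ _) (μ.rowLen (n - (k + 1)))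
    rw [← sort_image_range (strictMono_sub_one (strictMono_grassmannian_holes μ _))] at h2
    refine ⟨h2.1, fun c => ?_⟩
    refine (h2.2 c).trans ?_
    have := lt_rowLen_iff μ (n - (k + 1)) c
    simp only [not_lt_zero, if_false]
    split_ifs <;> omega

theorem isInverseGrassmannian_grassmannianPerm_inv :
    IsInverseGrassmannian (μ.colLen 0) (grassmannianPerm μ)⁻¹ := fun k hk => by
  rw [inv_inv]
  exact (grassmannianPerm_spec μ).2.2.2 k hk

theorem grassmannianPerm_apply_of_lt (c : ℕ) :
    grassmannianPerm μ (μ.colLen 0 + 1 + c) = μ.colLen 0 + 1 + c - μ.colLen c := by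
  change grassmannianFun μ _ = _
  unfold grassmannianFun
  rw [if_neg (by omega), if_neg (by omega)]
  congr 3
  omega

/-- An inverse Grassmannian permutation is determined by its descent and its holes. -/
theorem IsInverseGrassmannian.eq_of_holes {l : ℤ} {v w : Equiv.Perm ℤ}
    (hv : IsInverseGrassmannian l v) (hw : IsInverseGrassmannian l w)
    (h : ∀ c : ℕ, v⁻¹ (l + 1 + c) = w⁻¹ (l + 1 + c)) : v = w := by
  have hbig : ∀ k, l < k → v⁻¹ k = w⁻¹ k := fun k hk => by
    have := h (k - l - 1).toNat
    have e : l + 1 + ((k - l - 1).toNat : ℕ) = k := by omega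
    rwa [e] at this
  have hanti : ∀ u : Equiv.Perm ℤ, IsInverseGrassmannian l u →
      StrictMono fun k : ℕ => OrderDual.toDual (u⁻¹ (l - k)) := fun u hu i j hij =>
    hu.lt (by omega) (by omega)
  have hrange : ∀ u : Equiv.Perm ℤ, Set.range (fun k : ℕ => OrderDual.toDual (u⁻¹ (l - k))) =
      {y | u (OrderDual.ofDual y) ≤ l} := fun u => by
    ext y
    simp only [Set.mem_range, Set.mem_ofPred_eq]
    constructor
    · rintro ⟨k, rfl⟩
      simp
    · intro hy
      refine ⟨(l - u (OrderDual.ofDual y)).toNat, ?_⟩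
      have e : l - ((l - u (OrderDual.ofDual y)).toNat : ℕ) = u (OrderDual.ofDual y) := by omega
      rw [e]
      simp
  have hiff : ∀ y, v y ≤ l ↔ w y ≤ l := by
    intro y
    rw [← not_iff_not, not_le, not_le]
    constructor <;> intro hy
    · have := hbig _ hy
      rw [eq_comm, perm_inv_apply_eq_iff] at this
      rw [show w y = v y by simpa using this]
      exact hy
    · have := hbig _ hy
      rw [perm_inv_apply_eq_iff] at this
      rw [show v y = w y by simpa using this]
      exact hy
  have heq := (StrictMono.range_inj (hanti v hv) (hanti w hw)).1 (by
    rw [hrange, hrange]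
    ext y
    exact hiff _)
  rw [← inv_inj]
  ext k
  by_cases hk : l < k
  · exact hbig k hk
  · have := congrFun heq (l - k).toNat
    have e : l - ((l - k).toNat : ℕ) = k := by omega
    simpa only [OrderDual.toDual_inj, e] using this

theorem rowsAct_grassmannianRow {n : ℕ} (hn : μ.colLen 0 ≤ n) :
    rowsAct (List.ofFn fun i : Fin n => grassmannianRow μ i) = (grassmannianPerm μ)⁻¹ := by
  have h := hasHoles_grassmannianRow μ hn n le_rfl
  rw [Nat.sub_self, List.drop_zero] at h
  refine h.1.eq_of_holes (isInverseGrassmannian_grassmannianPerm_inv μ) fun c => ?_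
  rw [inv_inv, grassmannianPerm_apply_of_lt, h.2]
  simp

theorem isChain_ofFn_of_isColumnStrict {n : ℕ} {T : Fin n → Finset ℤ}
    (h : IsColumnStrict (fun _ => 0) T) : (List.ofFn T).IsChain Dominates := by
  rw [List.isChain_iff_getElem]
  intro i hi j
  rw [List.length_ofFn] at hi
  have := h ⟨i, by omega⟩ ⟨i + 1, hi⟩ rfl j
  simp only [Violates, zero_add, not_lt] at this
  simpa using this

theorem isColumnStrict_grassmannianRow (n : ℕ) :
    IsColumnStrict (fun _ => 0) fun i : Fin n => grassmannianRow μ i := by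
  intro i i' hi j
  simp only [Violates, zero_add, not_lt, ← hi]
  exact dominates_grassmannianRow μ i j

theorem card_filter_lt_eq_iff {n : ℕ} {e : Fin n → ℕ} (he : Antitone e) (c : ℕ) (k : Fin n) :
    c < e k ↔ (k : ℕ) < (List.ofFn e).countP (c < ·) := by
  have hcount : (List.ofFn e).countP (c < ·) = (Finset.univ.filter fun i : Fin n => c < e i).card := by
    rw [List.countP_eq_length_filter, ← List.map_id (List.ofFn e)]
    rw [List.ofFn_eq_map, List.map_map, List.filter_map, List.length_map]
    rw [← List.toFinset_card_of_nodup ((List.nodup_finRange n).filter _)]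
    congr 1
    ext i
    simp
  rw [hcount]
  constructor
  · intro hk
    have hsub : Finset.Iic k ⊆ Finset.univ.filter fun i : Fin n => c < e i := fun i hi => by
      rw [Finset.mem_Iic] at hi
      simpa using hk.trans_le (he hi)
    have := Finset.card_le_card hsub
    rw [Fin.card_Iic] at this
    omega
  · intro hk
    by_contra hcon
    have hsub : (Finset.univ.filter fun i : Fin n => c < e i) ⊆ Finset.Iio k := fun i hi => by
      rw [Finset.mem_Iio]
      by_contra hik
      have := he (not_lt.1 hik)
      have := (Finset.mem_filter.1 hi).2
      omega
    have := Finset.card_le_card hsub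
    rw [Fin.card_Iio] at this
    omega

/-- There is exactly one increasing tableau of straight shape whose Hecke permutation is the
inverse of a given Grassmannian permutation. -/
theorem isColumnStrict_and_rowsAct_eq_iff {n : ℕ} (hn : μ.colLen 0 ≤ n) (T : Fin n → Finset ℤ) :
    IsColumnStrict (fun _ => 0) T ∧ rowsAct (List.ofFn T) = (grassmannianPerm μ)⁻¹ ↔
      T = fun i : Fin n => grassmannianRow μ i := by
  constructor
  swap
  · rintro rfl
    exact ⟨isColumnStrict_grassmannianRow μ n, rowsAct_grassmannianRow μ hn⟩
  rintro ⟨hT, hact⟩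
  have hG := isInverseGrassmannian_grassmannianPerm_inv μ
  have hchain := isChain_ofFn_of_isColumnStrict hT
  have hspec := (rowsAct_spec hchain (hact ▸ hG)).1
  have hcol : ∀ c, ((List.ofFn T).countP fun S => c < S.card) = μ.colLen c := fun c => by
    have := hspec c
    rw [hact, inv_inv, grassmannianPerm_apply_of_lt] at this
    omega
  have hanti : Antitone fun k => (T k).card := by
    have hp : ((List.ofFn T).map Finset.card).Pairwise (· ≥ ·) := by
      rw [← List.isChain_iff_pairwise, List.isChain_map]
      exact hchain.imp fun a b hab => hab.card_le
    rw [List.map_ofFn, List.pairwise_ofFn] at hp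
    intro i j hij
    rcases hij.lt_or_eq with h | rfl
    · exact hp h
    · exact le_rfl
  have hcard : ∀ k, (T k).card = μ.rowLen k := fun k => by
    have key : ∀ c, c < (T k).card ↔ c < μ.rowLen k := fun c => by
      rw [card_filter_lt_eq_iff hanti, lt_rowLen_iff, ← hcol]
      have : (List.ofFn fun k => (T k).card) = (List.ofFn T).map Finset.card := by
        rw [List.map_ofFn]
        rfl
      rw [this, List.countP_map]
      rfl
    have h1 := key (T k).card
    have h2 := key (μ.rowLen k)
    omega
  have := rows_eq_of_isInverseGrassmannian hchain
    (isChain_ofFn_of_isColumnStrict (isColumnStrict_grassmannianRow μ n)) (hact ▸ hG)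
    ((rowsAct_grassmannianRow μ hn) ▸ hG) (by
      rw [List.map_ofFn, List.map_ofFn]
      congr 1
      funext k
      simp [hcard, card_grassmannianRow])
  exact List.ofFn_injective this

/-- The coefficient of the inverse of a Grassmannian permutation is a quotient of alternants. -/
theorem alternant_mul_blockCoeff_grassmannianPerm {R : Type*} [CommRing R] {n : ℕ}
    (hn : μ.colLen 0 ≤ n) {a b : ℤ} (hfix : ∀ x, x < a ∨ b + 1 < x → grassmannianPerm μ x = x)
    (x : ℕ → R) :
    alternant (fun _ : Fin n => 0) (fun k => x k) *
      blockCoeff x (fun _ => Finset.Icc a b) n (grassmannianPerm μ)⁻¹ =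
    alternant (fun k : Fin n => μ.rowLen k) (fun k => x k) := by
  classical
  rw [alternant_mul_blockCoeff (fun _ _ _ => le_rfl)]
  have hfix' : ∀ x, x < a ∨ b + 1 < x → (grassmannianPerm μ)⁻¹ x = x := fun x hx => by
    rw [perm_inv_apply_eq_iff, hfix x hx]
  rw [Finset.sum_eq_single_of_mem (fun i : Fin n => grassmannianRow μ i)]
  · simp [card_grassmannianRow]
  · rw [Finset.mem_filter, Fintype.mem_piFinset]
    refine ⟨fun k => Finset.mem_powerset.2 ?_, isColumnStrict_grassmannianRow μ n,
      rowsAct_grassmannianRow μ hn⟩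
    have := subset_Icc_of_rowsAct (L := List.ofFn fun i : Fin n => grassmannianRow μ i)
      (S := grassmannianRow μ k) (p := a) (q := b + 1) (by
        rw [rowsAct_grassmannianRow μ hn]
        exact hfix') (List.mem_ofFn.2 ⟨k, rfl⟩)
    rwa [add_sub_cancel_right] at this
  · intro T hT hne
    exact (hne ((isColumnStrict_and_rowsAct_eq_iff μ hn T).1 (Finset.mem_filter.1 hT).2)).elim

end Superstandard

/-! ### Grothendieck polynomials as coefficients -/

section Recursion

variable {R : Type*} [CommRing R]

theorem leftHeckeOp_apply_of_lt {i : ℤ} {v : Equiv.Perm ℤ} (h : v⁻¹ i < v⁻¹ (i + 1))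
    (a : Equiv.Perm ℤ →₀ R) :
    leftHeckeOp R i a v = 0 ∧
      leftHeckeOp R i a (simpleTransposition i * v) = a v + a (simpleTransposition i * v) := by
  classical
  induction a using Finsupp.induction_linear with
  | zero => simp
  | add f g hf hg =>
    simp only [map_add, Finsupp.add_apply, hf.1, hg.1, hf.2, hg.2, add_zero, true_and]
    abel
  | single u c =>
    have hne : v ≠ simpleTransposition i * v := fun h' => by
      have := congrArg (fun w : Equiv.Perm ℤ => w (v⁻¹ i)) h'
      simp [simpleTransposition_left] at this
    simp only [leftHeckeOp_single, Finsupp.single_apply]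
    by_cases hu : u⁻¹ i < u⁻¹ (i + 1)
    · have h1 : simpleTransposition i * u ≠ v := by
        rintro rfl
        rw [mul_inv_rev, simpleTransposition_inv, Equiv.Perm.mul_apply, Equiv.Perm.mul_apply,
          simpleTransposition_left, simpleTransposition_right] at h
        omega
      have h2 : u ≠ simpleTransposition i * v := by
        rintro rfl
        rw [mul_inv_rev, simpleTransposition_inv, Equiv.Perm.mul_apply, Equiv.Perm.mul_apply,
          simpleTransposition_left, simpleTransposition_right] at hu
        omega
      simp [show lstep i u = simpleTransposition i * u from if_pos hu, h1, h2]
    · have h1 : u ≠ v := by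
        rintro rfl
        exact hu h
      simp [show lstep i u = u from if_neg hu, h1]

theorem block_commute_leftHeckeOp (i : ℤ) (x : R) (S : Finset ℤ) :
    Commute (leftHeckeOp R i) (block (heckeOp R) x S) := by
  refine commute_decProd _ fun j _ => ?_
  exact (Commute.one_right _).add_right ((commute_leftHeckeOp_heckeOp i j).smul_right x)

/-- The alphabets `{k + 1, …, N}` of the rows `k` in the formula for Grothendieck polynomials. -/
def flag (N : ℕ) (k : ℕ) : Finset ℤ := Finset.Icc (k + 1) N

theorem blockProd_succ (x : ℕ → R) (S : ℕ → Finset ℤ) (n : ℕ) :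
    blockProd x S (n + 1) = blockProd x S n * block (heckeOp R) (x n) (S n) := by
  simp [blockProd, List.range_succ]

theorem blockProd_succ' (x : ℕ → R) (S : ℕ → Finset ℤ) (n : ℕ) :
    blockProd x S (n + 1) = block (heckeOp R) (x 0) (S 0) *
      blockProd (fun k => x (k + 1)) (fun k => S (k + 1)) n := by
  simp [blockProd, List.range_succ_eq_map, Function.comp_def]

/-- Multiplication by a factor with the smallest letter of a row extends the alphabet of the
next row, because the factor commutes with all rows further down. -/
theorem blockProd_flag_mul (x : ℕ → R) {N k n : ℕ} (hk : k + 2 ≤ n) (hN : k + 1 ≤ N) :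
    blockProd x (flag N) n * (1 + x (k + 1) • heckeOp R (k + 1)) =
      blockProd x (Function.update (flag N) (k + 1) (flag N k)) n := by
  induction n, hk using Nat.le_induction with
  | base =>
    have h1 : blockProd x (Function.update (flag N) (k + 1) (flag N k)) (k + 1) =
        blockProd x (flag N) (k + 1) := by
      unfold blockProd
      congr 1
      refine List.map_congr_left fun j hj => ?_
      rw [List.mem_range] at hj
      rw [Function.update_of_ne (by omega)]
    rw [blockProd_succ, blockProd_succ _ _ (k + 1), h1, Function.update_self, mul_assoc]
    congr 1
    rw [flag, flag, block_Icc_eq_mul (a := (k : ℤ) + 1) _ _ (by omega)]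
    push_cast
    rfl
  | succ n hn ih =>
    rw [blockProd_succ, blockProd_succ, ← ih, Function.update_of_ne (by omega), mul_assoc,
      mul_assoc, (commute_factor_block (heckeRelations_heckeOp (R := R)) _ _ fun j hj => ?_).eq]
    rw [flag, Finset.mem_Icc] at hj
    omega

theorem blockProd_swap (x : ℕ → R) {S : ℕ → Finset ℤ} {k n : ℕ} (hk : k + 2 ≤ n) {a b : ℤ}
    (h1 : S k = Finset.Icc a b) (h2 : S (k + 1) = Finset.Icc a b) :
    blockProd (x ∘ Equiv.swap k (k + 1)) S n = blockProd x S n := by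
  have hof : ∀ y : ℕ → R, blockProd y S n =
      (List.ofFn fun j : Fin n => block (heckeOp R) (y j) (S j)).prod := fun y => by
    unfold blockProd
    congr 1
    refine List.ext_getElem (by simp) fun j _ _ => ?_
    simp
  obtain ⟨p, q, hpq⟩ := prod_ofFn_eq_of_adjacent
    (fun j : Fin n => block (heckeOp R) (x j) (S j))
    (i := ⟨k, by omega⟩) (i' := ⟨k + 1, by omega⟩) rfl
  rw [hof, hof, hpq _ fun _ _ _ => rfl, hpq _ fun j hj1 hj2 => ?_]
  · simp only [Function.comp_apply, Equiv.swap_apply_left, Equiv.swap_apply_right, h1, h2]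
    rw [(commute_block_Icc (heckeRelations_heckeOp (R := R)) _ _ _ _).eq]
  · simp only [ne_eq, Fin.ext_iff] at hj1 hj2
    simp only [Function.comp_apply]
    rw [Equiv.swap_apply_of_ne_of_ne hj1 hj2]

/-- The recursion for the coefficients of the product of blocks with flagged alphabets. -/
theorem blockCoeff_flag_recursion (x : ℕ → R) {N k : ℕ} (hk : k + 2 ≤ N) {v : Equiv.Perm ℤ}
    (h : v⁻¹ (k + 1) < v⁻¹ (k + 1 + 1)) :
    blockCoeff x (flag N) N v * (x k - x (k + 1)) =
      (1 + x (k + 1)) * blockCoeff x (flag N) N (simpleTransposition (k + 1) * v) -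
      (1 + x k) * blockCoeff (x ∘ Equiv.swap k (k + 1)) (flag N) N
        (simpleTransposition (k + 1) * v) := by
  -- left multiplication by `s_{k + 1}` passes through all blocks, and on the permutation `1` it
  -- equals right multiplication, which adds the letter `k + 1` to the alphabet of row `k + 1`
  have hleft : ∀ y : ℕ → R,
      (1 + y (k + 1) • leftHeckeOp R (k + 1)) (blockProd y (flag N) N (Finsupp.single 1 1)) =
      blockProd y (Function.update (flag N) (k + 1) (flag N k)) N (Finsupp.single 1 1) := by
    intro y
    have hc : Commute (leftHeckeOp R (k + 1)) (blockProd y (flag N) N) := by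
      refine Commute.list_prod_right _ _ fun z hz => ?_
      obtain ⟨j, -, rfl⟩ := List.mem_map.1 hz
      exact block_commute_leftHeckeOp _ _ _
    have e : leftHeckeOp R (k + 1) (Finsupp.single 1 1) = heckeOp R (k + 1) (Finsupp.single 1 1) := by
      rw [leftHeckeOp_single, heckeOp_single, lstep_one]
    rw [← blockProd_flag_mul y hk (by omega), Module.End.mul_apply, LinearMap.add_apply,
      LinearMap.add_apply, LinearMap.smul_apply, LinearMap.smul_apply, map_add, map_smul, ← e,
      ← Module.End.mul_apply (leftHeckeOp R (k + 1)), hc.eq]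
    rfl
  have hsym : blockProd (x ∘ Equiv.swap k (k + 1))
      (Function.update (flag N) (k + 1) (flag N k)) N =
      blockProd x (Function.update (flag N) (k + 1) (flag N k)) N :=
    blockProd_swap x hk (a := (k : ℤ) + 1) (b := N)
      (by rw [Function.update_of_ne (by omega)]; rfl) (by rw [Function.update_self]; rfl)
  have key := (hleft x).trans ((congrArg (fun f : Module.End R (Equiv.Perm ℤ →₀ R) =>
    f (Finsupp.single 1 1)) hsym).symm.trans (hleft _).symm)
  have c1 := congrArg (· v) key
  have c2 := congrArg (· (simpleTransposition (k + 1) * v)) key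
  have a1 := leftHeckeOp_apply_of_lt h (blockProd x (flag N) N (Finsupp.single 1 1))
  have a2 := leftHeckeOp_apply_of_lt h
    (blockProd (x ∘ Equiv.swap k (k + 1)) (flag N) N (Finsupp.single 1 1))
  simp only [LinearMap.add_apply, LinearMap.smul_apply, Module.End.one_apply, Finsupp.add_apply,
    Finsupp.smul_apply, smul_eq_mul, a1.1, a1.2, a2.1, a2.2, Function.comp_apply,
    Equiv.swap_apply_right, mul_zero, add_zero] at c1 c2
  unfold blockCoeff
  linear_combination x k * c1 - c2

theorem preservesCut_of_blockProd_apply_ne_zero {x : ℕ → R} {S : ℕ → Finset ℤ} {n : ℕ} {c : ℤ}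
    (hc : ∀ k < n, c ∉ S k) {v : Equiv.Perm ℤ}
    (h : blockProd x S n (Finsupp.single 1 1) v ≠ 0) : PreservesCut c v := by
  classical
  let P : (Equiv.Perm ℤ →₀ R) → Prop := fun a => ∀ w, a w ≠ 0 → PreservesCut c w
  have hsingle : ∀ u r, (r ≠ 0 → PreservesCut c u) → P (Finsupp.single u r) := by
    intro u r hu w hw
    rw [Finsupp.single_apply] at hw
    split_ifs at hw with h'
    · exact h' ▸ hu hw
    · exact (hw rfl).elim
  have hadd : ∀ a b, P a → P b → P (a + b) := by
    intro a b ha hb w hw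
    by_contra hcon
    have e1 : a w = 0 := by
      by_contra h'
      exact hcon (ha w h')
    have e2 : b w = 0 := by
      by_contra h'
      exact hcon (hb w h')
    exact hw (by rw [Finsupp.add_apply, e1, e2, add_zero])
  have hsmul : ∀ (r : R) a, P a → P (r • a) := by
    intro r a ha w hw
    refine ha w fun h' => hw ?_
    rw [Finsupp.smul_apply, h', smul_zero]
  have hop : ∀ i, i ≠ c → ∀ a, P a → P (heckeOp R i a) := by
    intro i hi a ha
    rw [heckeOp, Finsupp.lmapDomain_apply, Finsupp.mapDomain, Finsupp.sum]
    refine Finset.sum_induction _ P hadd (fun w hw => (hw rfl).elim) fun u hu => ?_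
    exact hsingle _ _ fun h' => preservesCut_hstep (ha u h') hi
  have hblock : ∀ (z : R) (U : Finset ℤ), c ∉ U → ∀ a, P a → P (block (heckeOp R) z U a) := by
    intro z U
    unfold block
    induction U using Finset.induction_on_max with
    | empty => exact fun _ a ha => by simpa using ha
    | insert m U hm ih =>
      intro hcU a ha
      rw [Finset.mem_insert, not_or] at hcU
      have ha' := ih hcU.2 a ha
      rw [decProd_insert_max _ hm, Module.End.mul_apply, LinearMap.add_apply,
        Module.End.one_apply, LinearMap.smul_apply]
      exact hadd _ _ ha' (hsmul _ _ (hop m (Ne.symm hcU.1) _ ha'))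
  exact blockProd_induction (x := x) (y := x) (S := S) (S' := S) (n := n) (fun a _ => P a)
    (fun k hk a b h => hblock _ _ (hc k hk) a h) (b := 0)
    (hsingle 1 1 fun _ x => Iff.rfl) v h

/-- The permutation that reverses the interval `[a, b]`. -/
def reversal (a b : ℤ) : Equiv.Perm ℤ :=
  Function.Involutive.toPerm (fun i : ℤ => if a ≤ i ∧ i ≤ b then a + b - i else i) (by
    intro i
    dsimp only
    split_ifs <;> omega)

theorem reversal_apply (a b i : ℤ) :
    reversal a b i = if a ≤ i ∧ i ≤ b then a + b - i else i := rfl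

theorem reversal_inv (a b : ℤ) : (reversal a b)⁻¹ = reversal a b := by
  ext i
  rw [perm_inv_apply_eq_iff]
  simp only [reversal_apply]
  split_ifs <;> omega

theorem longest_eq_reversal (n : ℕ) : longest n = reversal 1 n := by
  ext i
  change (if 1 ≤ i ∧ i ≤ n then (n : ℤ) + 1 - i else i) = if 1 ≤ i ∧ i ≤ n then 1 + (n : ℤ) - i else i
  split_ifs <;> ring

theorem rowAct_Ico {u : Equiv.Perm ℤ} {a : ℤ} (h1 : u a = a) (h2 : PreservesCut a u) (d : ℕ)
    (x : ℤ) : rowAct u (Finset.Ico a (a + d)) x =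
      if a ≤ x ∧ x < a + d then u (x + 1) else if x = a + d then a else u x := by
  induction d generalizing x with
  | zero =>
    simp only [rowAct, Nat.cast_zero, add_zero, Finset.Ico_self, Finset.sort_empty,
      List.foldl_nil]
    split_ifs with h3 h4
    · omega
    · rw [h4, h1]
    · rfl
  | succ d ih =>
    have e : rowAct u (Finset.Ico a (a + (d + 1 : ℕ))) =
        hstep (rowAct u (Finset.Ico a (a + d))) (a + d) := by
      unfold rowAct
      rw [Ico_succ_eq_insert, sort_insert_max fun y hy => (Finset.mem_Ico.1 hy).2]
      simp
    have h3 := h2 (a + d + 1)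
    have hlt : rowAct u (Finset.Ico a (a + d)) (a + d) <
        rowAct u (Finset.Ico a (a + d)) (a + d + 1) := by
      rw [ih, ih, if_neg (by omega), if_pos rfl, if_neg (by omega), if_neg (by omega)]
      omega
    rw [e, hstep_of_lt hlt, Equiv.Perm.mul_apply, simpleTransposition_apply]
    push_cast
    by_cases g1 : x = a + d
    · rw [if_pos g1, ih, if_neg (by omega), if_neg (by omega), if_pos (by omega), g1]
    · rw [if_neg g1]
      by_cases g2 : x = a + d + 1
      · rw [if_pos g2, ih, if_neg (by omega), if_pos rfl, if_neg (by omega), if_pos (by omega)]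
      · rw [if_neg g2, ih]
        by_cases g3 : a ≤ x ∧ x < a + d
        · rw [if_pos g3, if_pos (by omega)]
        · rw [if_neg g3, if_neg g1, if_neg (by omega), if_neg (by omega)]

/-- If `u` fixes all integers up to `a`, a row of letters from `[a, b)` turns `u` into the reversal
of `[a, b]` only if the row is complete. -/
theorem rowAct_eq_reversal_iff {u : Equiv.Perm ℤ} {a : ℤ} (h1 : u a = a) (h2 : PreservesCut a u)
    (d : ℕ) {T : Finset ℤ} (hT : T ⊆ Finset.Ico a (a + d)) :
    rowAct u T = reversal a (a + d) ↔
      T = Finset.Ico a (a + d) ∧ u = reversal (a + 1) (a + d) := by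
  constructor
  · intro h
    have hTeq : T = Finset.Ico a (a + d) := by
      refine Finset.Subset.antisymm hT fun c hc => ?_
      by_contra hcT
      rw [Finset.mem_Ico] at hc
      -- without the letter `c` the value `a` cannot leave the positions up to `c`
      have hpos : ∀ (l : List ℤ) (v : Equiv.Perm ℤ), c ∉ l → v⁻¹ a ≤ c →
          (l.foldl hstep v)⁻¹ a ≤ c := by
        intro l
        induction l with
        | nil => exact fun v _ hv => hv
        | cons r l ih =>
          intro v hr hv
          rw [List.mem_cons, not_or] at hr
          refine ih _ hr.2 ?_
          unfold hstep
          split_ifs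
          · rw [mul_inv_rev, simpleTransposition_inv, Equiv.Perm.mul_apply,
              simpleTransposition_apply]
            split_ifs <;> omega
          · exact hv
      have hle := hpos (T.sort (· ≤ ·)) u (by simpa using hcT)
        (by rw [perm_inv_apply_eq_iff.2 h1]; exact hc.1)
      change (rowAct u T)⁻¹ a ≤ c at hle
      rw [h, reversal_inv, reversal_apply, if_pos (by omega)] at hle
      omega
    refine ⟨hTeq, ?_⟩
    subst hTeq
    ext y
    have h3 := rowAct_Ico h1 h2 d
    rw [h] at h3
    rw [reversal_apply]
    split_ifs with hy
    · have := h3 (y - 1)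
      rw [reversal_apply, if_pos (by omega), if_pos (by omega), sub_add_cancel] at this
      omega
    · by_cases hya : y = a
      · rw [hya, h1]
      · have := h3 y
        rw [reversal_apply, if_neg (by omega), if_neg (by omega), if_neg (by omega)] at this
        omega
  · rintro ⟨rfl, rfl⟩
    ext x
    rw [rowAct_Ico h1 h2]
    simp only [reversal_apply]
    split_ifs <;> omega

/-- The coefficient of a reversal in a product of blocks with flagged alphabets. -/
theorem blockCoeff_reversal (d : ℕ) (a : ℤ) (x : ℕ → R) :
    blockCoeff x (fun k => Finset.Ico (a + k) (a + d)) d (reversal a (a + d)) =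
      ∏ k ∈ Finset.range d, x k ^ (d - k) := by
  classical
  induction d generalizing a x with
  | zero =>
    have : reversal a (a + (0 : ℕ)) = 1 := by
      ext i
      simp only [reversal_apply, Equiv.Perm.one_apply]
      split_ifs <;> omega
    rw [this]
    simp [blockCoeff, blockProd]
  | succ d ih =>
    have hS : (fun k : ℕ => Finset.Ico (a + (k + 1 : ℕ)) (a + (d + 1 : ℕ))) =
        fun k : ℕ => Finset.Ico (a + 1 + k) (a + 1 + d) := by
      funext k
      congr 1 <;> push_cast <;> ring
    have ih' := ih (a + 1) fun k => x (k + 1)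
    unfold blockCoeff at ih' ⊢
    rw [blockProd_succ', Module.End.mul_apply, hS]
    set z := blockProd (fun k => x (k + 1)) (fun k : ℕ => Finset.Ico (a + 1 + k) (a + 1 + d)) d
      (Finsupp.single 1 1) with hz
    have hcut : ∀ u ∈ z.support, u a = a ∧ PreservesCut a u := by
      intro u hu
      rw [Finsupp.mem_support_iff, hz] at hu
      have h1 : PreservesCut a u := preservesCut_of_blockProd_apply_ne_zero (fun k _ hk => by
        rw [Finset.mem_Ico] at hk
        omega) hu
      have h2 : PreservesCut (a - 1) u := preservesCut_of_blockProd_apply_ne_zero (fun k _ hk => by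
        rw [Finset.mem_Ico] at hk
        omega) hu
      have h3 := h1 a
      have h4 := h2 a
      exact ⟨by omega, h1⟩
    have hterm : ∀ u ∈ z.support, block (heckeOp R) (x 0) (Finset.Ico a (a + (d + 1 : ℕ)))
        (Finsupp.single u (z u)) (reversal a (a + (d + 1 : ℕ))) =
        if u = reversal (a + 1) (a + 1 + d) then x 0 ^ (d + 1) * z u else 0 := by
      intro u hu
      obtain ⟨h1, h2⟩ := hcut u hu
      have e : a + ((d + 1 : ℕ) : ℤ) = a + 1 + d := by push_cast; ring
      rw [block_eq_sum, LinearMap.sum_apply, Finsupp.finsetSum_apply,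
        Finset.sum_eq_single_of_mem (Finset.Ico a (a + (d + 1 : ℕ)))]
      · rw [LinearMap.smul_apply, decProd_heckeOp_single, Finsupp.smul_apply,
          Finsupp.single_apply]
        have hiff := rowAct_eq_reversal_iff h1 h2 (d + 1) subset_rfl
        rw [← e]
        simp only [hiff, true_and, Int.card_Ico, add_sub_cancel_left, Int.toNat_natCast,
          smul_eq_mul, mul_ite, mul_zero]
      · exact Finset.mem_powerset_self _
      · intro T hT hne
        rw [LinearMap.smul_apply, decProd_heckeOp_single, Finsupp.smul_apply,
          Finsupp.single_apply, if_neg fun h => hne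
            ((rowAct_eq_reversal_iff h1 h2 (d + 1) (Finset.mem_powerset.1 hT)).1 h).1, smul_zero]
    rw [Nat.cast_zero, add_zero]
    conv_lhs => rw [← Finsupp.sum_single z]
    rw [Finsupp.sum, map_sum, Finsupp.finsetSum_apply, Finset.sum_congr rfl hterm,
      Finset.sum_ite_eq', Finset.prod_range_succ', Nat.sub_zero]
    have hfin : x 0 ^ (d + 1) * z (reversal (a + 1) (a + 1 + d)) =
        (∏ k ∈ Finset.range d, x (k + 1) ^ (d + 1 - (k + 1))) * x 0 ^ (d + 1) := by
      rw [ih', mul_comm]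
      congr 1
      exact Finset.prod_congr rfl fun k _ => by rw [Nat.add_sub_add_right]
    rw [← hfin]
    split_ifs with h
    · rfl
    · rw [Finsupp.notMem_support_iff.1 h, mul_zero]

end Recursion

/-- The formula of Fomin and Kirillov for the Grothendieck polynomial of `w`, as a coefficient
in a product of `N` blocks. It holds when `N` is large. -/
def flagPoly (N : ℕ) (w : Equiv.Perm ℤ) : MvPolynomial ℕ ℤ :=
  blockCoeff MvPolynomial.X (flag N) N w⁻¹

theorem flagPoly_longest {n N : ℕ} (h : n ≤ N) :
    flagPoly N (longest n) =
      ∏ k ∈ Finset.range (n - 1), MvPolynomial.X k ^ (n - (k + 1)) := by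
  unfold flagPoly
  rw [longest_eq_reversal, reversal_inv,
    blockCoeff_of_subset (S' := fun k : ℕ => Finset.Ico (1 + (k : ℤ)) n)]
  · rw [blockCoeff_of_trivial (m := n - 1) (by omega)]
    · obtain _ | n := n
      · have : reversal 1 (0 : ℕ) = 1 := by
          ext i
          simp only [reversal_apply, Equiv.Perm.one_apply]
          split_ifs <;> omega
        rw [this]
        simp [blockCoeff, blockProd]
      · have := blockCoeff_reversal n 1 (MvPolynomial.X (R := ℤ) (σ := ℕ))
        rw [add_comm (1 : ℤ) (n : ℤ)] at this
        rw [Nat.add_sub_cancel, Nat.cast_add, Nat.cast_one, this]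
        exact Finset.prod_congr rfl fun k _ => by rw [Nat.add_sub_add_right]
    · intro k hk1 hk2
      right
      rw [Finset.Ico_eq_empty_iff]
      omega
  · intro k _ c hc
    rw [flag, Finset.mem_Icc]
    rw [Finset.mem_Ico] at hc
    omega
  · intro k _ c hc hc'
    rw [flag, Finset.mem_Icc] at hc
    rw [Finset.mem_Ico] at hc'
    refine preservesCut_of_bounds (p := 1) (q := n) (fun x hx => ?_) (by omega)
    rw [reversal_apply, if_neg (by omega)]

theorem flagPoly_recursion {N k : ℕ} (hk : k + 2 ≤ N) {w : Equiv.Perm ℤ}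
    (h : w (k + 1) < w (k + 1 + 1)) :
    flagPoly N w * (MvPolynomial.X k - MvPolynomial.X (k + 1)) =
      (1 + MvPolynomial.X (k + 1)) * flagPoly N (w * simpleTransposition (k + 1)) -
      (1 + MvPolynomial.X k) * MvPolynomial.rename (Equiv.swap k (k + 1))
        (flagPoly N (w * simpleTransposition (k + 1))) := by
  have h1 := blockCoeff_flag_recursion (MvPolynomial.X (R := ℤ) (σ := ℕ)) hk (v := w⁻¹)
    (by simpa using h)
  have h2 := map_blockCoeff (MvPolynomial.rename (R := ℤ) (Equiv.swap k (k + 1))).toRingHom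
    MvPolynomial.X (flag N) N (simpleTransposition (k + 1) * w⁻¹)
  simp only [AlgHom.toRingHom_eq_coe, RingHom.coe_coe, MvPolynomial.rename_X] at h2
  unfold flagPoly
  rw [h1, mul_inv_rev, simpleTransposition_inv, h2]
  rfl

theorem X_sub_X_succ_ne_zero (k : ℕ) :
    (MvPolynomial.X k - MvPolynomial.X (k + 1) : MvPolynomial ℕ ℤ) ≠ 0 := by
  rw [sub_ne_zero]
  intro h
  have := MvPolynomial.X_injective h
  omega

theorem IsGrothendieck.eventually_eq_flagPoly {w : Equiv.Perm ℤ} {f : MvPolynomial ℕ ℤ}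
    (h : IsGrothendieck w f) : ∃ N₀, ∀ N, N₀ ≤ N → flagPoly N w = f := by
  induction h with
  | longest n => exact ⟨n, fun N hN => flagPoly_longest hN⟩
  | step w k f g hasc _ hg ih =>
    obtain ⟨N₀, ih⟩ := ih
    refine ⟨max N₀ (k + 2), fun N hN => ?_⟩
    have h1 := flagPoly_recursion ((le_max_right _ _).trans hN) hasc
    rw [ih N ((le_max_left _ _).trans hN), ← hg] at h1
    exact mul_right_cancel₀ (X_sub_X_succ_ne_zero k) h1

theorem X_sub_X_succ_dvd (k : ℕ) (f : MvPolynomial ℕ ℤ) :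
    (MvPolynomial.X k - MvPolynomial.X (k + 1) : MvPolynomial ℕ ℤ) ∣
      (1 + MvPolynomial.X (k + 1)) * f -
        (1 + MvPolynomial.X k) * MvPolynomial.rename (Equiv.swap k (k + 1)) f := by
  rw [← Ideal.mem_span_singleton, ← Ideal.Quotient.eq_zero_iff_mem]
  set q := Ideal.Quotient.mkₐ ℤ
    (Ideal.span {(MvPolynomial.X k - MvPolynomial.X (k + 1) : MvPolynomial ℕ ℤ)}) with hq
  have hX : q (MvPolynomial.X k) = q (MvPolynomial.X (k + 1)) := by
    rw [← sub_eq_zero, ← map_sub]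
    exact Ideal.Quotient.eq_zero_iff_mem.2 (Ideal.mem_span_singleton_self _)
  have hswap : q.comp (MvPolynomial.rename (Equiv.swap k (k + 1))) = q := by
    refine MvPolynomial.algHom_ext fun j => ?_
    rw [AlgHom.comp_apply, MvPolynomial.rename_X, Equiv.swap_apply_def]
    split_ifs with h1 h2
    · rw [h1, hX]
    · rw [h2, hX]
    · rfl
  change q _ = 0
  rw [map_sub, map_mul, map_mul, map_add, map_add, hX, ← AlgHom.comp_apply, hswap, sub_self]

theorem eq_longest_of_no_ascent {u : Equiv.Perm ℤ} {n : ℕ}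
    (hfix : ∀ x : ℤ, x < 1 ∨ (n : ℤ) < x → u x = x)
    (h : ∀ k : ℕ, k + 2 ≤ n → u (k + 1 + 1) < u (k + 1)) : u = longest n := by
  have h0 := preservesCut_of_bounds hfix (c := 0) (by omega)
  have hn := preservesCut_of_bounds hfix (c := n) (by omega)
  have hup : ∀ k : ℕ, k + 1 ≤ n → u (k + 1) ≤ n - k := by
    intro k
    induction k with
    | zero =>
      intro hk
      have := hn 1
      simp only [Nat.cast_zero, zero_add, sub_zero]
      omega
    | succ k ih =>
      intro hk
      have h1 := ih (by omega)
      have h2 := h k (by omega)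
      push_cast
      omega
  have hlow : ∀ d k : ℕ, k + 1 + d = n → (d : ℤ) + 1 ≤ u (k + 1) := by
    intro d
    induction d with
    | zero =>
      intro k hk
      have := h0 (k + 1)
      simp only [Nat.cast_zero]
      omega
    | succ d ih =>
      intro k hk
      have h1 := ih (k + 1) (by omega)
      have h2 := h k (by omega)
      push_cast at h1 ⊢
      omega
  rw [longest_eq_reversal]
  ext x
  rw [reversal_apply]
  split_ifs with hx
  · have e : x = ((x - 1).toNat : ℕ) + 1 := by omega
    have h1 := hup (x - 1).toNat (by omega)
    have h2 := hlow (n - x).toNat (x - 1).toNat (by omega)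
    rw [← e] at h1 h2
    omega
  · exact hfix x (by omega)

/-- A permutation of `[1, n]` other than the longest one has an ascent `i < n`, where its length can
be increased. The numerator of the recursion vanishes for `x_i = x_{i+1}`. -/
theorem exists_isGrothendieck {u : Equiv.Perm ℤ} (hu : FinitelySupported u)
    (h : ∀ x : ℤ, x ≤ 0 → u x = x) : ∃ f, IsGrothendieck u f := by
  obtain ⟨n, hn⟩ : ∃ n : ℕ, ∀ x : ℤ, x < 1 ∨ (n : ℤ) < x → u x = x := by
    obtain ⟨p, q, -, hpq⟩ := hu.exists_bounds
    refine ⟨q.toNat, fun x hx => ?_⟩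
    rcases hx with hx | hx
    · exact h x (by omega)
    · exact hpq x (by omega)
  clear h
  have hlen : ∀ v : Equiv.Perm ℤ, (∀ x : ℤ, x < 1 ∨ (n : ℤ) < x → v x = x) →
      length v ≤ ((Set.Icc (1 : ℤ) n) ×ˢ (Set.Icc (1 : ℤ) n)).ncard := fun v hv =>
    Set.ncard_le_ncard (inversions_subset hv) ((Set.finite_Icc _ _).prod (Set.finite_Icc _ _))
  generalize hB : ((Set.Icc (1 : ℤ) n) ×ˢ (Set.Icc (1 : ℤ) n)).ncard = B at hlen
  clear hB
  induction hd : B - length u using Nat.strong_induction_on generalizing u with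
  | _ d ih =>
  by_cases hasc : ∃ k : ℕ, k + 2 ≤ n ∧ u (k + 1) < u (k + 1 + 1)
  · obtain ⟨k, hk, hasc⟩ := hasc
    have h1 := length_mul_simpleTransposition hu hasc
    have h2 : ∀ x : ℤ, x < 1 ∨ (n : ℤ) < x → (u * simpleTransposition (k + 1)) x = x := by
      intro x hx
      rw [Equiv.Perm.mul_apply, simpleTransposition_of_ne (by omega) (by omega), hn x hx]
    have h3 := hlen _ h2
    obtain ⟨f, hf⟩ := ih _ (by omega)
      (hu.mul (finitelySupported_simpleTransposition _)) h2 rfl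
    obtain ⟨g, hg⟩ := X_sub_X_succ_dvd k f
    exact ⟨g, IsGrothendieck.step u k f g hasc hf (by rw [hg, mul_comm])⟩
  · push Not at hasc
    have : u = longest n := eq_longest_of_no_ascent hn fun k hk =>
      lt_of_le_of_ne (hasc k hk) (apply_ne_apply_succ u _).symm
    exact ⟨_, this ▸ IsGrothendieck.longest n⟩

theorem IsGrothendieck.unique {w : Equiv.Perm ℤ} {f g : MvPolynomial ℕ ℤ}
    (hf : IsGrothendieck w f) (hg : IsGrothendieck w g) : f = g := by
  obtain ⟨N, h1⟩ := hf.eventually_eq_flagPoly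
  obtain ⟨N', h2⟩ := hg.eventually_eq_flagPoly
  rw [← h1 _ (le_max_left N N'), h2 _ (le_max_right N N')]

/-! ### Stable Grothendieck polynomials -/

/-- The stable Grothendieck polynomial of `w` in the variables `x_k`, `k < M`, where the letters
of the Hecke words of `w` belong to `[a, b]`. -/
def truncatedGroth (a b : ℤ) (M : ℕ) (w : Equiv.Perm ℤ) : MvPolynomial ℕ ℤ :=
  blockCoeff MvPolynomial.X (fun _ => Finset.Icc a b) M w⁻¹

/-- The substitution `x_k = 0` for `k ≥ M`. -/
def killVars (M : ℕ) : MvPolynomial ℕ ℤ →ₐ[ℤ] MvPolynomial ℕ ℤ :=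
  MvPolynomial.aeval fun k => if k < M then MvPolynomial.X k else 0

theorem coeff_killVars {M : ℕ} {d : ℕ →₀ ℕ} (hd : ∀ k ∈ d.support, k < M)
    (f : MvPolynomial ℕ ℤ) : (killVars M f).coeff d = f.coeff d := by
  induction f using MvPolynomial.induction_on' with
  | add p q hp hq => simp [hp, hq]
  | monomial e c =>
    by_cases he : ∀ k ∈ e.support, k < M
    · have : killVars M (MvPolynomial.monomial e c) = MvPolynomial.monomial e c := by
        rw [killVars, MvPolynomial.aeval_monomial, MvPolynomial.monomial_eq]
        congr 1
        exact Finset.prod_congr rfl fun k hk => by simp only [if_pos (he k hk)]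
      rw [this]
    · push Not at he
      obtain ⟨k, hk, hkM⟩ := he
      have : killVars M (MvPolynomial.monomial e c) = 0 := by
        rw [killVars, MvPolynomial.aeval_monomial, Finsupp.prod, Finset.prod_eq_zero hk, mul_zero]
        rw [if_neg (by omega), zero_pow (Finsupp.mem_support_iff.1 hk)]
      rw [this, MvPolynomial.coeff_zero, MvPolynomial.coeff_monomial, if_neg]
      rintro rfl
      have := hd k hk
      omega

/-- For large `m`, the polynomial `𝔊_{1^m × w}` agrees with the truncated stable polynomial on
monomials in the first `M` variables. -/
theorem coeff_grothendieck_shift {w : Equiv.Perm ℤ} {a b : ℤ}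
    (hfix : ∀ x, x < a ∨ b + 1 < x → w x = x) {M m : ℕ} (hm : M + 1 ≤ m + a) {d : ℕ →₀ ℕ}
    (hd : ∀ k ∈ d.support, k < M) :
    (grothendieck (shift m w)).coeff d = (truncatedGroth a b M w).coeff d := by
  have hfix' : ∀ x, x < m + a ∨ m + b + 1 < x → shift m w x = x := fun x hx => by
    rw [shift_apply, hfix (x - m) (by omega)]
    ring
  have hex : ∃ f, IsGrothendieck (shift m w) f :=
    exists_isGrothendieck (finitelySupported_of_bounds fun x hx => hfix' x (by
      rcases hx with h | h
      · exact Or.inl h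
      · exact Or.inr h)) fun x hx => hfix' x (by omega)
  have hG : IsGrothendieck (shift m w) (grothendieck (shift m w)) := by
    unfold grothendieck
    rw [dif_pos hex]
    exact hex.choose_spec
  obtain ⟨N₀, hN₀⟩ := hG.eventually_eq_flagPoly
  set N := max N₀ (max M (m + b).toNat) with hN
  have hNM : M ≤ N := (le_max_left _ _).trans (le_max_right _ _)
  have hNb : m + b ≤ N := by
    have : (m + b).toNat ≤ N := (le_max_right _ _).trans (le_max_right _ _)
    omega
  rw [← hN₀ N (le_max_left _ _), ← coeff_killVars hd]
  have e1 : killVars M (flagPoly N (shift m w)) =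
      blockCoeff (fun k => killVars M (MvPolynomial.X k)) (flag N) N (shift m w)⁻¹ :=
    map_blockCoeff (killVars M).toRingHom _ _ _ _
  rw [e1, blockCoeff_of_trivial hNM fun k hk _ => Or.inl (by simp [killVars, not_lt.2 hk]),
    blockCoeff_of_subset (S' := fun _ => Finset.Icc (a + m) (b + m))]
  · rw [← coeff_killVars hd (truncatedGroth a b M w)]
    have e2 : killVars M (truncatedGroth a b M w) =
        blockCoeff (fun k => killVars M (MvPolynomial.X k)) (fun _ => Finset.Icc a b) M w⁻¹ :=
      map_blockCoeff (killVars M).toRingHom _ _ _ _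
    have e3 := blockCoeff_shift m (fun k => killVars M (MvPolynomial.X k))
      (fun _ => Finset.Icc a b) M w⁻¹
    simp only [Finset.image_add_right_Icc] at e3
    rw [e2, shift_inv, e3]
  · intro k hk c hc
    rw [Finset.mem_Icc] at hc
    rw [flag, Finset.mem_Icc]
    omega
  · intro k hk c hc hc'
    rw [flag, Finset.mem_Icc] at hc
    rw [Finset.mem_Icc] at hc'
    refine preservesCut_of_bounds (p := m + a) (q := m + b + 1) (fun x hx => ?_) (by omega)
    rw [perm_inv_apply_eq_iff, hfix' x hx]

/-- The limit exists because its coefficient at a monomial in `x_k`, `k < M`, is eventually that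
of the truncated stable polynomial. -/
theorem tendsto_shiftedGrothendieck {w : Equiv.Perm ℤ} (hw : FinitelySupported w) :
    Tendsto (shiftedGrothendieck w) atTop (𝓝 (stableGrothendieck w)) := by
  obtain ⟨p, q, -, hpq⟩ := hw.exists_bounds
  have hfix : ∀ x, x < p ∨ (q - 1) + 1 < x → w x = x := fun x hx => hpq x (by omega)
  let L : MvPowerSeries ℕ ℤ := fun d =>
    (truncatedGroth p (q - 1) (d.support.sup id + 1) w).coeff d
  have hL : Tendsto (shiftedGrothendieck w) atTop (𝓝 L) := by
    rw [MvPowerSeries.WithPiTopology.tendsto_iff_coeff_tendsto]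
    intro d
    refine tendsto_const_nhds.congr' ?_
    rw [EventuallyEq, eventually_atTop]
    refine ⟨(d.support.sup id + 2 - p).toNat, fun m hm => ?_⟩
    rw [shiftedGrothendieck, MvPolynomial.coeff_coe,
      coeff_grothendieck_shift hfix (M := d.support.sup id + 1) (by push_cast; omega)
        fun k hk => Nat.lt_succ_of_le (Finset.le_sup (f := id) hk)]
    rfl
  have : stableGrothendieck w = L := hL.limUnder_eq
  rw [this]
  exact hL

theorem coeff_stableGrothendieck {w : Equiv.Perm ℤ} {a b : ℤ}
    (hfix : ∀ x, x < a ∨ b + 1 < x → w x = x) {M : ℕ} {d : ℕ →₀ ℕ}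
    (hd : ∀ k ∈ d.support, k < M) :
    MvPowerSeries.coeff d (stableGrothendieck w) = (truncatedGroth a b M w).coeff d := by
  have h1 := (MvPowerSeries.WithPiTopology.tendsto_iff_coeff_tendsto _ _ _).1
    (tendsto_shiftedGrothendieck (finitelySupported_of_bounds hfix)) d
  have h2 : Tendsto (fun m => MvPowerSeries.coeff d (shiftedGrothendieck w m)) atTop
      (𝓝 ((truncatedGroth a b M w).coeff d)) := by
    refine tendsto_const_nhds.congr' ?_
    rw [EventuallyEq, eventually_atTop]
    refine ⟨(M + 1 - a).toNat, fun m hm => ?_⟩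
    rw [shiftedGrothendieck, MvPolynomial.coeff_coe,
      coeff_grothendieck_shift hfix (by omega) hd]
  exact tendsto_nhds_unique h1 h2

/-! ### Increasing tableaux as tuples of rows -/

section Rows

variable {e : ℕ → ℤ} {m l : ℕ}

theorem card_filter_lt_le (he : StrictMonoOn e (Set.Ico m l)) {c : ℕ} (hc : c ∈ Set.Ico m l)
    {j : ℤ} (h : j ≤ e c) : (((Finset.Ico m l).image e).filter (· < j)).card ≤ c - m := by
  rw [← Nat.card_Ico]
  refine le_trans (Finset.card_le_card ?_) (Finset.card_image_le (f := e))
  intro y hy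
  rw [Finset.mem_filter, Finset.mem_image] at hy
  obtain ⟨⟨c', hc', rfl⟩, hy⟩ := hy
  rw [Finset.mem_Ico] at hc'
  have : c' < c := (he.lt_iff_lt hc' hc).1 (hy.trans_le h)
  exact Finset.mem_image_of_mem _ (Finset.mem_Ico.2 ⟨hc'.1, this⟩)

theorem lt_card_filter_lt (he : StrictMonoOn e (Set.Ico m l)) {c : ℕ} (hc : c ∈ Set.Ico m l)
    {j : ℤ} (h : e c < j) : c - m < (((Finset.Ico m l).image e).filter (· < j)).card := by
  have hsub : (Finset.Ico m (c + 1)).image e ⊆ ((Finset.Ico m l).image e).filter (· < j) := by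
    intro y hy
    rw [Finset.mem_image] at hy
    obtain ⟨c', hc', rfl⟩ := hy
    rw [Finset.mem_Ico] at hc'
    have hc2 : c' ∈ Set.Ico m l := ⟨hc'.1, by have := hc.2; omega⟩
    rw [Finset.mem_filter]
    exact ⟨Finset.mem_image_of_mem _ (Finset.mem_Ico.2 hc2),
      ((he.le_iff_le hc2 hc).2 (by omega)).trans_lt h⟩
  have hcard : ((Finset.Ico m (c + 1)).image e).card = c + 1 - m := by
    rw [Finset.card_image_of_injOn, Nat.card_Ico]
    refine he.injOn.mono fun c' hc' => ?_
    rw [Finset.coe_Ico, Set.mem_Ico] at hc'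
    exact ⟨hc'.1, by have := hc.2; omega⟩
  have := Finset.card_le_card hsub
  have := hc.1
  omega

theorem filter_le_eq (S : Finset ℤ) (j : ℤ) : S.filter (· ≤ j) = S.filter (· < j + 1) := by
  simp only [Int.lt_add_one_iff]

/-- Column strictness of two consecutive rows says that each entry of the upper row is smaller
than the entry below it. -/
theorem not_violates_iff {n : ℕ} {μ ν : Fin n → ℕ} {e : Fin n → ℕ → ℤ}
    (he : ∀ i, StrictMonoOn (e i) (Set.Ico (μ i) (ν i))) {i i' : Fin n} (hμ : μ i' ≤ μ i)
    (hν : ν i' ≤ ν i) :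
    (∀ j, ¬ Violates μ (fun i => (Finset.Ico (μ i) (ν i)).image (e i)) i i' j) ↔
      ∀ c, μ i ≤ c → c < ν i' → e i c < e i' c := by
  constructor
  · intro h c h1 h2
    by_contra hcon
    refine h (e i' c) ?_
    have k1 := card_filter_lt_le (he i) ⟨h1, h2.trans_le hν⟩ (not_lt.1 hcon)
    have k2 := lt_card_filter_lt (he i') ⟨hμ.trans h1, h2⟩ (lt_add_one (e i' c))
    unfold Violates
    rw [filter_le_eq]
    dsimp only
    omega
  · intro h j hj
    unfold Violates at hj
    rw [filter_le_eq] at hj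
    dsimp only at hj
    set q := (((Finset.Ico (μ i) (ν i)).image (e i)).filter (· < j)).card with hq
    set p := (((Finset.Ico (μ i') (ν i')).image (e i')).filter (· < j + 1)).card with hp
    -- the entry of the lower row in column `μ i' + p - 1` is the last one that is at most `j`
    have hp1 : p ≤ ν i' - μ i' := by
      rw [← Nat.card_Ico]
      exact (Finset.card_le_card (Finset.filter_subset _ _)).trans Finset.card_image_le
    have hc' : μ i' + p - 1 ∈ Set.Ico (μ i') (ν i') := ⟨by omega, by omega⟩
    have hc : μ i' + p - 1 ∈ Set.Ico (μ i) (ν i) := ⟨by omega, by omega⟩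
    have hle : e i' (μ i' + p - 1) < j + 1 := by
      by_contra hcon
      have := card_filter_lt_le (he i') hc' (not_lt.1 hcon)
      omega
    have hlt := h _ hc.1 hc'.2
    have := lt_card_filter_lt (he i) hc (show e i (μ i' + p - 1) < j by omega)
    omega

theorem eqOn_of_image_eq {e' : ℕ → ℤ} (he : StrictMonoOn e (Set.Ico m l))
    (he' : StrictMonoOn e' (Set.Ico m l))
    (h : (Finset.Ico m l).image e = (Finset.Ico m l).image e') {c : ℕ} (hc : c ∈ Set.Ico m l) :
    e c = e' c := by
  rcases lt_trichotomy (e c) (e' c) with hlt | heq | hlt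
  · have h1 := lt_card_filter_lt he hc hlt
    have h2 := card_filter_lt_le he' hc (le_refl (e' c))
    rw [h] at h1
    omega
  · exact heq
  · have h1 := lt_card_filter_lt he' hc hlt
    have h2 := card_filter_lt_le he hc (le_refl (e c))
    rw [h] at h2
    omega

end Rows

section Tableaux

variable {ν μ : YoungDiagram}

open Classical in
/-- The entry of a filling in row `r` and column `c`, and `0` for positions outside its shape. -/
def entry (T : SkewFilling ν μ) (r c : ℕ) : ℤ :=
  if h : (r, c) ∈ ν ∧ (r, c) ∉ μ then T ⟨(r, c), h⟩ else 0

theorem entry_coe (T : SkewFilling ν μ) (x : {c : ℕ × ℕ // c ∈ ν ∧ c ∉ μ}) :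
    entry T x.1.1 x.1.2 = T x := by
  rw [entry, dif_pos x.2]

theorem mem_skew_iff {r c : ℕ} :
    ((r, c) ∈ ν ∧ (r, c) ∉ μ) ↔ c ∈ Set.Ico (μ.rowLen r) (ν.rowLen r) := by
  rw [YoungDiagram.mem_iff_lt_rowLen, YoungDiagram.mem_iff_lt_rowLen, not_lt, Set.mem_Ico, and_comm]

theorem isIncreasing_iff {T : SkewFilling ν μ} :
    IsIncreasing T ↔
      (∀ r, StrictMonoOn (entry T r) (Set.Ico (μ.rowLen r) (ν.rowLen r))) ∧
      ∀ r c, μ.rowLen r ≤ c → c < ν.rowLen (r + 1) → entry T r c < entry T (r + 1) c := by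
  constructor
  · intro h
    constructor
    · intro r c hc c' hc' hlt
      rw [entry, entry, dif_pos (mem_skew_iff.2 hc), dif_pos (mem_skew_iff.2 hc')]
      exact h (Subtype.mk_lt_mk.2 (Prod.mk_lt_mk.2 (Or.inr ⟨le_rfl, hlt⟩)))
    · intro r c h1 h2
      have hr : (r, c) ∈ ν ∧ (r, c) ∉ μ :=
        mem_skew_iff.2 ⟨h1, h2.trans_le (ν.rowLen_anti _ _ (Nat.le_succ r))⟩
      have hr' : (r + 1, c) ∈ ν ∧ (r + 1, c) ∉ μ :=
        mem_skew_iff.2 ⟨(μ.rowLen_anti _ _ (Nat.le_succ r)).trans h1, h2⟩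
      rw [entry, entry, dif_pos hr, dif_pos hr']
      exact h (Subtype.mk_lt_mk.2 (Prod.mk_lt_mk.2 (Or.inl ⟨Nat.lt_succ_self r, le_rfl⟩)))
  · rintro ⟨h1, h2⟩ ⟨⟨r, c⟩, hx⟩ ⟨⟨r', c'⟩, hy⟩ hlt
    have hle : r ≤ r' ∧ c ≤ c' := Prod.mk_le_mk.1 (Subtype.mk_lt_mk.1 hlt).le
    have hne : r ≠ r' ∨ c ≠ c' := by
      by_contra! hcon
      obtain ⟨rfl, rfl⟩ := hcon
      exact lt_irrefl _ hlt
    rw [← entry_coe T ⟨(r, c), hx⟩, ← entry_coe T ⟨(r', c'), hy⟩]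
    dsimp only
    have hc := mem_skew_iff.1 hx
    have hc' := mem_skew_iff.1 hy
    -- go along row `r` to column `c'` and then down this column
    have hmid : c' ∈ Set.Ico (μ.rowLen r) (ν.rowLen r) :=
      ⟨hc.1.trans hle.2, hc'.2.trans_le (ν.rowLen_anti _ _ hle.1)⟩
    have hdown : ∀ k, r + k ≤ r' → entry T r c' + k ≤ entry T (r + k) c' := by
      intro k hk
      induction k with
      | zero => simp
      | succ k ih =>
        have h3 := h2 (r + k) c' ((μ.rowLen_anti _ _ (Nat.le_add_right r k)).trans hmid.1)
          (hc'.2.trans_le (ν.rowLen_anti _ _ hk))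
        have h4 := ih (by omega)
        rw [add_assoc] at h3
        push_cast
        omega
    have h3 := hdown (r' - r) (by omega)
    rw [Nat.add_sub_cancel' hle.1] at h3
    have h4 := (h1 r).monotoneOn hc hmid hle.2
    by_cases hr : r = r'
    · have h5 := h1 r hc hmid (by omega)
      omega
    · omega

/-- The set of the entries of a filling in row `r`. -/
def rowSet (T : SkewFilling ν μ) (r : ℕ) : Finset ℤ :=
  (Finset.Ico (μ.rowLen r) (ν.rowLen r)).image (entry T r)

open Classical in
theorem sort_rowSet {T : SkewFilling ν μ} {r : ℕ}
    (h : StrictMonoOn (entry T r) (Set.Ico (μ.rowLen r) (ν.rowLen r))) :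
    (rowSet T r).sort (· ≤ ·) = (List.range (ν.rowLen r)).filterMap fun c =>
      if h : (r, c) ∈ ν ∧ (r, c) ∉ μ then some (T ⟨(r, c), h⟩) else none := by
  set l := (List.range (ν.rowLen r)).filterMap fun c =>
      if h : (r, c) ∈ ν ∧ (r, c) ∉ μ then some (T ⟨(r, c), h⟩) else none with hl
  have hlt : l.Pairwise (· < ·) := by
    rw [hl, List.pairwise_filterMap]
    refine List.pairwise_lt_range.imp fun {c c'} hcc b hb b' hb' => ?_
    split_ifs at hb hb' with h1 h2
    rw [Option.some_inj] at hb hb'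
    have := h (mem_skew_iff.1 h1) (mem_skew_iff.1 h2) hcc
    rwa [entry, entry, dif_pos h1, dif_pos h2, hb, hb'] at this
  have hset : rowSet T r = l.toFinset := by
    ext y
    rw [rowSet, Finset.mem_image, List.mem_toFinset, hl, List.mem_filterMap]
    constructor
    · rintro ⟨c, hc, rfl⟩
      rw [Finset.mem_Ico] at hc
      refine ⟨c, List.mem_range.2 hc.2, ?_⟩
      rw [entry, dif_pos (mem_skew_iff.2 hc), dif_pos (mem_skew_iff.2 hc)]
    · rintro ⟨c, -, hc⟩
      split_ifs at hc with h1
      refine ⟨c, Finset.mem_Ico.2 (mem_skew_iff.1 h1), ?_⟩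
      rw [entry, dif_pos h1]
      exact Option.some_inj.1 hc
  rw [hset]
  exact (List.toFinset_sort (· ≤ ·) hlt.nodup).2 (hlt.imp le_of_lt)

theorem heckePerm_eq_rowsAct {T : SkewFilling ν μ}
    (h : ∀ r, StrictMonoOn (entry T r) (Set.Ico (μ.rowLen r) (ν.rowLen r))) {n : ℕ}
    (hn : ν.colLen 0 ≤ n) :
    heckePerm T = rowsAct (List.ofFn fun r : Fin n => rowSet T r) := by
  have hof : (List.ofFn fun r : Fin n => rowSet T r) = (List.range n).map (rowSet T) :=
    List.ext_getElem (by simp) (by simp)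
  have hfold : ∀ k, (List.range k).reverse.foldl (fun v r => rowAct v (rowSet T r)) 1 =
      rowsAct ((List.range k).map (rowSet T)) := by
    intro k
    rw [List.foldl_reverse, rowsAct, List.foldr_map]
  rw [heckePerm, heckeWord_eq, rowWord, List.foldl_flatMap, hof, ← hfold]
  simp only [← sort_rowSet (h _)]
  change List.foldl (fun v r => rowAct v (rowSet T r)) 1 _ = _
  -- rows below the last one of the shape are empty
  induction n, hn using Nat.le_induction with
  | base => rfl
  | succ n hn ih =>
    have hempty : rowSet T n = ∅ := by
      have : ν.rowLen n = 0 := by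
        by_contra hne
        have := (lt_rowLen_iff ν n 0).1 (by omega)
        omega
      rw [rowSet, this]
      simp
    rw [ih (List.ext_getElem (by simp) (by simp)), List.range_succ, List.reverse_append, List.reverse_singleton,
      List.singleton_append, List.foldl_cons, hempty]
    simp [rowAct]

open Classical in
/-- The tuples of rows that correspond to the increasing tableaux `T` of shape `ν/μ` such that
`w(T) = w⁻¹`, if `ν` has at most `n` rows and `w` fixes all integers outside `[a, b + 1]`. -/
def rowTuples (w : Equiv.Perm ℤ) (a b : ℤ) (n : ℕ) (μ ν : YoungDiagram) :
    Finset (Fin n → Finset ℤ) :=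
  (Fintype.piFinset fun _ : Fin n => (Finset.Icc a b).powerset).filter fun T =>
    (IsColumnStrict (fun k => μ.rowLen k) T ∧ rowsAct (List.ofFn T) = w⁻¹) ∧
      ∀ k : Fin n, μ.rowLen k + (T k).card = ν.rowLen k

theorem card_rowSet {T : SkewFilling ν μ} {r : ℕ}
    (h : StrictMonoOn (entry T r) (Set.Ico (μ.rowLen r) (ν.rowLen r))) :
    (rowSet T r).card = ν.rowLen r - μ.rowLen r := by
  rw [rowSet, Finset.card_image_of_injOn (by rw [Finset.coe_Ico]; exact h.injOn), Nat.card_Ico]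

theorem isIncreasing_iff_isColumnStrict {T : SkewFilling ν μ} {n : ℕ} (hn : ν.colLen 0 ≤ n)
    (h : ∀ r, StrictMonoOn (entry T r) (Set.Ico (μ.rowLen r) (ν.rowLen r))) :
    IsIncreasing T ↔ IsColumnStrict (fun k : Fin n => μ.rowLen k) fun r => rowSet T r := by
  have key : ∀ i i' : Fin n, (i : ℕ) + 1 = i' → ((∀ j, ¬ Violates (fun k : Fin n => μ.rowLen k) (fun r => rowSet T r) i i' j) ↔
      ∀ c, μ.rowLen i ≤ c → c < ν.rowLen i' → entry T i c < entry T i' c) := fun i i' hi =>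
    not_violates_iff (e := fun i => entry T i) (fun i => h i) (μ.rowLen_anti _ _ (by omega))
      (ν.rowLen_anti _ _ (by omega))
  rw [isIncreasing_iff, and_iff_right h]
  constructor
  · intro hc i i' hi
    refine (key i i' hi).2 ?_
    rw [← hi]
    exact hc i
  · intro hc r c h1 h2
    have h3 : r + 1 < n := by
      have := (lt_rowLen_iff ν (r + 1) 0).1 (by omega)
      omega
    exact (key ⟨r, by omega⟩ ⟨r + 1, h3⟩ rfl).1 (hc _ _ rfl) c h1 h2

theorem bijOn_heckeTableaux {w : Equiv.Perm ℤ} {a b : ℤ}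
    (hfix : ∀ x, x < a ∨ b + 1 < x → w x = x) (hμν : μ ≤ ν) {n : ℕ} (hn : ν.colLen 0 ≤ n) :
    Set.BijOn (fun T (r : Fin n) => rowSet T r) (heckeTableaux w μ ν) (rowTuples w a b n μ ν) := by
  classical
  have hrow : ∀ r, μ.rowLen r ≤ ν.rowLen r := fun r => by
    by_contra hcon
    have h1 : (r, ν.rowLen r) ∈ μ := YoungDiagram.mem_iff_lt_rowLen.2 (by omega)
    exact lt_irrefl _ (YoungDiagram.mem_iff_lt_rowLen.1 (hμν h1))
  have hlt : ∀ r, n ≤ r → ν.rowLen r = 0 := fun r hr => by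
    by_contra hne
    have := (lt_rowLen_iff ν r 0).1 (by omega)
    omega
  refine ⟨?_, ?_, ?_⟩
  · rintro T ⟨hT, hw⟩
    have h := (isIncreasing_iff.1 hT).1
    have hrows := (heckePerm_eq_rowsAct h hn).symm.trans hw
    rw [Finset.mem_coe, rowTuples, Finset.mem_filter, Fintype.mem_piFinset]
    refine ⟨fun r => ?_, ⟨(isIncreasing_iff_isColumnStrict hn h).1 hT, hrows⟩, fun r => ?_⟩
    · rw [Finset.mem_powerset]
      have := subset_Icc_of_rowsAct (p := a) (q := b + 1) (S := rowSet T r)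
        (L := List.ofFn fun r : Fin n => rowSet T r) (fun x hx => by
          rw [hrows, perm_inv_apply_eq_iff, hfix x hx]) (List.mem_ofFn.2 ⟨r, rfl⟩)
      rwa [add_sub_cancel_right] at this
    · rw [card_rowSet (h r)]
      have := hrow r
      omega
  · rintro T ⟨hT, -⟩ T' ⟨hT', -⟩ heq
    funext x
    obtain ⟨⟨r, c⟩, hx⟩ := x
    have hc := mem_skew_iff.1 hx
    have hr : r < n := by
      by_contra hcon
      have := hlt r (not_lt.1 hcon)
      have := hc.2
      omega
    have := eqOn_of_image_eq ((isIncreasing_iff.1 hT).1 r) ((isIncreasing_iff.1 hT').1 r)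
      (congrFun heq ⟨r, hr⟩) hc
    rwa [entry, entry, dif_pos hx, dif_pos hx] at this
  · intro R hR
    rw [Finset.mem_coe, rowTuples, Finset.mem_filter] at hR
    obtain ⟨-, ⟨hcs, hact⟩, hcard⟩ := hR
    have hcell : ∀ x : {c : ℕ × ℕ // c ∈ ν ∧ c ∉ μ}, ∃ hr : x.1.1 < n,
        x.1.2 - μ.rowLen x.1.1 < (R ⟨x.1.1, hr⟩).card := by
      rintro ⟨⟨r, c⟩, hx⟩
      obtain ⟨h1, h2⟩ := mem_skew_iff.1 hx
      have hr : r < n := by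
        by_contra hcon
        have := hlt r (not_lt.1 hcon)
        omega
      refine ⟨hr, ?_⟩
      have := hcard ⟨r, hr⟩
      dsimp only at this ⊢
      omega
    let T : SkewFilling ν μ := fun x =>
      (R ⟨x.1.1, (hcell x).1⟩).orderEmbOfFin rfl ⟨x.1.2 - μ.rowLen x.1.1, (hcell x).2⟩
    have hmono : ∀ r, StrictMonoOn (entry T r) (Set.Ico (μ.rowLen r) (ν.rowLen r)) := by
      intro r c hc c' hc' hlt
      rw [entry, entry, dif_pos (mem_skew_iff.2 hc), dif_pos (mem_skew_iff.2 hc')]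
      refine (OrderEmbedding.lt_iff_lt _).2 ?_
      rw [Fin.mk_lt_mk]
      have := hc.1
      dsimp only
      omega
    have hset : (fun r : Fin n => rowSet T r) = R := by
      funext r
      refine Finset.eq_of_subset_of_card_le ?_ ?_
      · intro y hy
        rw [rowSet, Finset.mem_image] at hy
        obtain ⟨c, hc, rfl⟩ := hy
        rw [Finset.mem_Ico] at hc
        rw [entry, dif_pos (mem_skew_iff.2 hc)]
        exact Finset.orderEmbOfFin_mem _ _ _
      · rw [card_rowSet (hmono r)]
        have := hcard r
        omega
    refine ⟨T, ⟨?_, ?_⟩, hset⟩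
    · rw [isIncreasing_iff_isColumnStrict hn hmono, hset]
      exact hcs
    · rw [heckePerm_eq_rowsAct hmono hn, hset, hact]

end Tableaux

/-! ### The product formula -/

variable {w : Equiv.Perm ℤ} {a b : ℤ} {μ ν : YoungDiagram}

theorem coefficient_eq_card_rowTuples (hfix : ∀ x, x < a ∨ b + 1 < x → w x = x) (hμν : μ ≤ ν)
    {n : ℕ} (hn : ν.colLen 0 ≤ n) : coefficient w μ ν = (rowTuples w a b n μ ν).card := by
  rw [coefficient, (bijOn_heckeTableaux hfix hμν hn).ncard_eq, Set.ncard_coe_finset]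

theorem finite_heckeTableaux (hw : FinitelySupported w) (hμν : μ ≤ ν) :
    (heckeTableaux w μ ν).Finite := by
  obtain ⟨p, q, -, hpq⟩ := hw.exists_bounds
  have h := bijOn_heckeTableaux (w := w) (a := p) (b := q - 1)
    (fun x hx => hpq x (by omega)) hμν le_rfl
  exact h.finite_iff_finite.2 (Finset.finite_toSet _)

theorem youngDiagram_ext (h : ∀ r, μ.rowLen r = ν.rowLen r) : μ = ν := by
  refine YoungDiagram.ext (Finset.ext fun x => ?_)
  rw [YoungDiagram.mem_cells, YoungDiagram.mem_cells, ← Prod.mk.eta (p := x),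
    YoungDiagram.mem_iff_lt_rowLen, YoungDiagram.mem_iff_lt_rowLen, h]

theorem le_of_rowLen_le (h : ∀ r, μ.rowLen r ≤ ν.rowLen r) : μ ≤ ν := by
  rintro ⟨r, c⟩ hx
  exact YoungDiagram.mem_iff_lt_rowLen.2 ((YoungDiagram.mem_iff_lt_rowLen.1 hx).trans_le (h r))

theorem rowLen_eq_zero {r : ℕ} : ν.rowLen r = 0 ↔ ν.colLen 0 ≤ r := by
  have := lt_rowLen_iff ν r 0
  omega

theorem exists_rowLen_eq {f : ℕ → ℕ} (hf : Antitone f) {n : ℕ} (hn : f n = 0) :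
    ∃ ν : YoungDiagram, ∀ r, ν.rowLen r = f r := by
  have hmem : ∀ r c, (r, c) ∈ (Finset.range n ×ˢ Finset.range (f 0)).filter
      (fun x : ℕ × ℕ => x.2 < f x.1) ↔ c < f r := by
    intro r c
    rw [Finset.mem_filter, Finset.mem_product, Finset.mem_range, Finset.mem_range]
    refine ⟨fun h => h.2, fun h => ⟨⟨?_, h.trans_le (hf (Nat.zero_le r))⟩, h⟩⟩
    by_contra hcon
    have := hf (not_lt.1 hcon)
    dsimp only at *
    omega
  refine ⟨⟨(Finset.range n ×ˢ Finset.range (f 0)).filter (fun x : ℕ × ℕ => x.2 < f x.1), ?_⟩,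
    fun r => ?_⟩
  · rintro ⟨r, c⟩ ⟨r', c'⟩ hle hx
    rw [Finset.mem_coe, hmem] at hx ⊢
    exact (hle.2.trans_lt hx).trans_le (hf hle.1)
  · refine eq_of_forall_lt_iff fun c => ?_
    rw [← YoungDiagram.mem_iff_lt_rowLen, ← hmem]
    rfl

/-- A row of an increasing tableau and the part of its first column below the inner shape have
distinct entries, all of them letters of `w⁻¹`. This bounds the outer shape. -/
theorem finite_setOf_coefficient_ne_zero (hw : FinitelySupported w) (μ : YoungDiagram) :
    {ν : YoungDiagram | μ ≤ ν ∧ coefficient w μ ν ≠ 0}.Finite := by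
  classical
  obtain ⟨p, q, -, hpq⟩ := hw.exists_bounds
  set B := (Finset.Icc p (q - 1)).card with hB
  refine Set.Finite.of_injOn (f := YoungDiagram.cells) (t := ((Finset.range (μ.colLen 0 + B) ×ˢ
    Finset.range (μ.rowLen 0 + B)).powerset : Finset (Finset (ℕ × ℕ)))) ?_
    (fun x _ y _ h => YoungDiagram.ext h) (Finset.finite_toSet _)
  rintro ν ⟨hμν, hne⟩
  obtain ⟨T, hT⟩ := Set.nonempty_of_ncard_ne_zero hne
  have hR := (bijOn_heckeTableaux (w := w) (a := p) (b := q - 1)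
    (fun x hx => hpq x (by omega)) hμν le_rfl).mapsTo hT
  rw [Finset.mem_coe, rowTuples, Finset.mem_filter, Fintype.mem_piFinset] at hR
  obtain ⟨hsub, -, hcard⟩ := hR
  have hrow : ∀ r, r < ν.colLen 0 → ν.rowLen r ≤ μ.rowLen 0 + B := by
    intro r hr
    have h1 := hcard ⟨r, hr⟩
    have h2 := Finset.card_le_card (Finset.mem_powerset.1 (hsub ⟨r, hr⟩))
    have h3 := μ.rowLen_anti 0 r (Nat.zero_le r)
    dsimp only at *
    omega
  have hcol : ν.colLen 0 ≤ μ.colLen 0 + B := by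
    have hinc := (isIncreasing_iff.1 hT.1).2
    have hmono : StrictMonoOn (fun r => entry T r 0) (Set.Ico (μ.colLen 0) (ν.colLen 0)) := by
      refine strictMonoOn_of_lt_succ Set.ordConnected_Ico fun r _ hr hr' => ?_
      refine hinc r 0 ?_ ?_
      · exact (rowLen_eq_zero.2 hr.1).le
      · exact (lt_rowLen_iff ν _ 0).2 hr'.2
    have hle : (Finset.Ico (μ.colLen 0) (ν.colLen 0)).card ≤ B := by
      refine Finset.card_le_card_of_injOn (fun r => entry T r 0) (fun r hr => ?_) ?_
      · rw [Finset.coe_Ico] at hr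
        refine Finset.mem_powerset.1 (hsub ⟨r, hr.2⟩) (Finset.mem_image_of_mem _ ?_)
        rw [Finset.mem_Ico]
        exact ⟨(rowLen_eq_zero.2 hr.1).le, (lt_rowLen_iff ν _ 0).2 hr.2⟩
      · rw [Finset.coe_Ico]
        exact hmono.injOn
    rw [Nat.card_Ico] at hle
    omega
  rw [Finset.mem_coe, Finset.mem_powerset]
  rintro ⟨r, c⟩ hx
  rw [YoungDiagram.mem_cells] at hx
  have h1 := YoungDiagram.mem_iff_lt_rowLen.1 hx
  have h2 : r < ν.colLen 0 := (lt_rowLen_iff ν r 0).1 (by omega)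
  have := hrow r h2
  rw [Finset.mem_product, Finset.mem_range, Finset.mem_range]
  dsimp only
  omega

/-- The product formula in `n` variables, multiplied by the alternant of the empty shape. -/
theorem alternant_rowLen_mul_truncatedGroth (hfix : ∀ x, x < a ∨ b + 1 < x → w x = x)
    {F : Finset YoungDiagram} (hF : ∀ ν, ν ∈ F ↔ μ ≤ ν ∧ coefficient w μ ν ≠ 0) {n : ℕ}
    (hμ : μ.colLen 0 ≤ n) (hn : ∀ ν ∈ F, ν.colLen 0 ≤ n) :
    alternant (fun k : Fin n => μ.rowLen k) (fun k => (MvPolynomial.X (k : ℕ) : MvPolynomial ℕ ℤ)) *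
        truncatedGroth a b n w =
      ∑ ν ∈ F, coefficient w μ ν •
        alternant (fun k : Fin n => ν.rowLen k) (fun k => MvPolynomial.X (k : ℕ)) := by
  classical
  rw [truncatedGroth, alternant_mul_blockCoeff fun i j hij => μ.rowLen_anti _ _ hij]
  have hunion : ((Fintype.piFinset fun _ : Fin n => (Finset.Icc a b).powerset).filter fun T =>
      IsColumnStrict (fun k => μ.rowLen k) T ∧ rowsAct (List.ofFn T) = w⁻¹) =
      F.biUnion fun ν => rowTuples w a b n μ ν := by
    ext T
    rw [Finset.mem_biUnion]
    constructor
    · intro hT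
      obtain ⟨hsub, hcs, hact⟩ := Finset.mem_filter.1 hT
      rw [Fintype.mem_piFinset] at hsub
      -- the rows of a column strict tuple end at the boundary of a Young diagram
      let f : ℕ → ℕ := fun r => if h : r < n then μ.rowLen r + (T ⟨r, h⟩).card else 0
      have hf : Antitone f := by
        refine antitone_nat_of_succ_le fun r => ?_
        by_cases h : r + 1 < n
        · have hv := hcs ⟨r, by omega⟩ ⟨r + 1, h⟩ rfl (b + 1)
          have hsub' : ∀ i, ∀ y ∈ T i, y < b + 1 := fun i y hy => by
            have := (Finset.mem_Icc.1 (Finset.mem_powerset.1 (hsub i) hy)).2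
            omega
          unfold Violates at hv
          rw [Finset.filter_true_of_mem (hsub' _),
            Finset.filter_true_of_mem fun y hy => (hsub' _ y hy).le] at hv
          simp only [f, dif_pos h, dif_pos (show r < n by omega)]
          exact not_lt.1 hv
        · simp only [f, dif_neg h]
          exact Nat.zero_le _
      obtain ⟨ν, hν⟩ := exists_rowLen_eq hf (n := n) (by simp [f])
      have hνn : ν.colLen 0 ≤ n := rowLen_eq_zero.1 (by rw [hν]; simp [f])
      have hμν : μ ≤ ν := le_of_rowLen_le fun r => by
        rw [hν]
        by_cases h : r < n
        · simp [f, h]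
        · rw [rowLen_eq_zero.2 (hμ.trans (not_lt.1 h))]
          exact Nat.zero_le _
      have hmem : T ∈ rowTuples w a b n μ ν := by
        rw [rowTuples, Finset.mem_filter]
        refine ⟨(Finset.mem_filter.1 hT).1, ⟨hcs, hact⟩, fun k => ?_⟩
        rw [hν]
        simp [f]
      refine ⟨ν, (hF ν).2 ⟨hμν, ?_⟩, hmem⟩
      rw [coefficient_eq_card_rowTuples hfix hμν hνn]
      exact Finset.card_ne_zero_of_mem hmem
    · rintro ⟨ν, -, hT⟩
      rw [rowTuples, Finset.mem_filter] at hT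
      exact Finset.mem_filter.2 ⟨hT.1, hT.2.1⟩
  rw [hunion, Finset.sum_biUnion]
  · refine Finset.sum_congr rfl fun ν hν => ?_
    rw [coefficient_eq_card_rowTuples hfix ((hF ν).1 hν).1 (hn ν hν), ← Finset.sum_const]
    refine Finset.sum_congr rfl fun T hT => ?_
    rw [rowTuples, Finset.mem_filter] at hT
    congr 1
    funext k
    exact hT.2.2 k
  · intro ν hν ν' hν' hne
    rw [Function.onFun, Finset.disjoint_left]
    intro T hT hT'
    rw [rowTuples, Finset.mem_filter] at hT hT'
    refine hne (youngDiagram_ext fun r => ?_)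
    by_cases h : r < n
    · exact (hT.2.2 ⟨r, h⟩).symm.trans (hT'.2.2 ⟨r, h⟩)
    · rw [rowLen_eq_zero.2 ((hn ν hν).trans (not_lt.1 h)),
        rowLen_eq_zero.2 ((hn ν' hν').trans (not_lt.1 h))]

theorem stableGrothendieck_mul_eq_sum (hw : FinitelySupported w) {F : Finset YoungDiagram}
    (hF : ∀ ν, ν ∈ F ↔ μ ≤ ν ∧ coefficient w μ ν ≠ 0) :
    stableGrothendieck w * stableGrothendieckOfDiagram μ =
      ∑ ν ∈ F, coefficient w μ ν • stableGrothendieckOfDiagram ν := by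
  classical
  obtain ⟨p, q, -, hpq⟩ := hw.exists_bounds
  have hw' : ∀ x, x < p ∨ (q - 1) + 1 < x → w x = x := fun x hx => hpq x (by omega)
  choose p' q' _ hpq' using fun ν => (grassmannianPerm_spec ν).1.exists_bounds
  have hν' : ∀ ν x, x < p' ν ∨ (q' ν - 1) + 1 < x → grassmannianPerm ν x = x :=
    fun ν x hx => hpq' ν x (by omega)
  refine MvPowerSeries.ext fun d => ?_
  set n := max (d.support.sup id + 1) (max (μ.colLen 0) (F.sup fun ν => ν.colLen 0)) with hn
  have hd : ∀ k ∈ d.support, k < n := fun k hk =>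
    (Nat.lt_succ_of_le (Finset.le_sup (f := id) hk)).trans_le (le_max_left _ _)
  have hμn : μ.colLen 0 ≤ n := (le_max_left _ _).trans (le_max_right _ _)
  have hFn : ∀ ν ∈ F, ν.colLen 0 ≤ n := fun ν hν =>
    (Finset.le_sup (f := fun ν : YoungDiagram => ν.colLen 0) hν).trans
      ((le_max_right _ _).trans (le_max_right _ _))
  have hG : ∀ ν : YoungDiagram, ν.colLen 0 ≤ n →
      alternant (fun _ : Fin n => 0) (fun k => (MvPolynomial.X (k : ℕ) : MvPolynomial ℕ ℤ)) *
        truncatedGroth (p' ν) (q' ν - 1) n (grassmannianPerm ν) =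
      alternant (fun k : Fin n => ν.rowLen k) (fun k => MvPolynomial.X (k : ℕ)) := fun ν hν =>
    alternant_mul_blockCoeff_grassmannianPerm ν hν (hν' ν) _
  have hpoly : truncatedGroth p (q - 1) n w *
        truncatedGroth (p' μ) (q' μ - 1) n (grassmannianPerm μ) =
      ∑ ν ∈ F, coefficient w μ ν • truncatedGroth (p' ν) (q' ν - 1) n (grassmannianPerm ν) := by
    refine mul_left_cancel₀ (alternant_zero_ne_zero n) ?_
    rw [mul_comm (truncatedGroth p (q - 1) n w), ← mul_assoc, hG μ hμn,
      alternant_rowLen_mul_truncatedGroth hw' hF hμn hFn, Finset.mul_sum]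
    refine Finset.sum_congr rfl fun ν hν => ?_
    rw [mul_smul_comm, hG ν (hFn ν hν)]
  have hc := congrArg (MvPolynomial.coeff d) hpoly
  rw [MvPolynomial.coeff_mul, MvPolynomial.coeff_sum] at hc
  rw [MvPowerSeries.coeff_mul, map_sum]
  refine (Finset.sum_congr rfl fun e he => ?_).trans (hc.trans (Finset.sum_congr rfl fun ν _ => ?_))
  · have he' : e.1 + e.2 = d := Finset.HasAntidiagonal.mem_antidiagonal.1 he
    have h1 : ∀ k ∈ e.1.support, k < n := fun k hk => hd k (by
      rw [← he']
      simp only [Finsupp.mem_support_iff, Finsupp.add_apply] at hk ⊢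
      omega)
    have h2 : ∀ k ∈ e.2.support, k < n := fun k hk => hd k (by
      rw [← he']
      simp only [Finsupp.mem_support_iff, Finsupp.add_apply] at hk ⊢
      omega)
    rw [coeff_stableGrothendieck hw' h1, stableGrothendieckOfDiagram,
      coeff_stableGrothendieck (hν' μ) h2]
  · rw [MvPolynomial.coeff_smul, map_nsmul, stableGrothendieckOfDiagram,
      coeff_stableGrothendieck (hν' ν) hd]

end StableGroth

end

open Filter Topology in
open scoped MvPowerSeries.WithPiTopology in
open StableGroth in
theorem mainTheorem9 :
    -- Grothendieck polynomials are well defined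
    (∀ u : Equiv.Perm ℤ, FinitelySupported u → (∀ x : ℤ, x ≤ 0 → u x = x) →
      ∃! f : MvPolynomial ℕ ℤ, IsGrothendieck u f) ∧
    -- the limits defining the stable Grothendieck polynomials exist
    (∀ u : Equiv.Perm ℤ, FinitelySupported u →
      Tendsto (shiftedGrothendieck u) atTop (𝓝 (stableGrothendieck u))) ∧
    -- the product formula; its coefficients are counts of finite sets and its sum is finite
    (∀ (w : Equiv.Perm ℤ) (_ : FinitelySupported w) (μ : YoungDiagram),
      (∀ ν : YoungDiagram, μ ≤ ν → (heckeTableaux w μ ν).Finite) ∧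
      {ν : YoungDiagram | μ ≤ ν ∧ coefficient w μ ν ≠ 0}.Finite ∧
      stableGrothendieck w * stableGrothendieckOfDiagram μ =
        ∑ᶠ (ν : YoungDiagram) (_ : μ ≤ ν),
          coefficient w μ ν • stableGrothendieckOfDiagram ν) := by
  refine ⟨fun u hu hpos => ?_, fun u hu => tendsto_shiftedGrothendieck hu, fun w hw μ =>
    ⟨fun ν hμν => finite_heckeTableaux hw hμν, finite_setOf_coefficient_ne_zero hw μ, ?_⟩⟩
  · obtain ⟨f, hf⟩ := exists_isGrothendieck hu hpos
    exact ⟨f, hf, fun g hg => hg.unique hf⟩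
  · have hfin := finite_setOf_coefficient_ne_zero hw μ
    rw [stableGrothendieck_mul_eq_sum hw (F := hfin.toFinset) fun ν => hfin.mem_toFinset]
    refine (finsum_mem_eq_sum_of_inter_support_eq
      (fun ν => coefficient w μ ν • stableGrothendieckOfDiagram ν) (s := {ν | μ ≤ ν}) ?_).symm
    ext ν
    simp only [Set.mem_inter_iff, Function.mem_support, Set.Finite.coe_toFinset, Set.mem_ofPred_eq]
    refine ⟨fun h => ⟨⟨h.1, fun h0 => h.2 (by rw [h0, zero_smul])⟩, h.2⟩, fun h => ⟨h.1.1, h.2⟩⟩
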